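/- Let $(M,g)$ be a smooth Lorentzian manifold of dimension $2m+2$ and signature $(2m+1,1)$. Extend $g$ and the Lie bracket complex-(bi)linearly to $T^{\mathbb C}M=TM\otimes\mathbb C$. Let $\mathcal N\subset T^{\mathbb C}M$ be an almost Robinson structure, i.e. a smooth complex subbundle of rank $m+1$ with $\mathcal N^{\perp}=\mathcal N$. Let $\mathcal R\subset TM$ be the real null line bundle with $\mathcal R^{\mathbb C}=\mathcal N\cap\overline{\mathcal N}$, and let $\mathcal R^*\subset TM$ be a smooth null line subbundle with $TM=\mathcal R^*\oplus\mathcal R^{\perp}$. Put $\mathcal S=\mathcal R^\perp\cap(\mathcal R^*)^\perp$, $\mathcal S^{1,0}=\mathcal N\cap\mathcal S^{\mathbb C}$ and $\mathcal S^{0,1}=\overline{\mathcal N}\cap\mathcal S^{\mathbb C}$, so that $$T^{\mathbb C}M=(\mathcal R^{\mathbb C}\oplus(\mathcal R^*)^{\mathbb C})\oplus(\mathcal S^{1,0}\oplus\mathcal S^{0,1})$$ (the Witt decomposition). Write $v^{1,0}$, $v^{0,1}$, $v_{\mathcal S}$ for the components of $v$ in $\mathcal S^{1,0}$, $\mathcal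 S^{0,1}$, $\mathcal S^{\mathbb C}$. Let $Jv=\sqrt{-1}\,v^{1,0}-\sqrt{-1}\,v^{0,1}$ and $\omega(X,Y)=g(JX,Y)$. Let $(\nu,\nu^*)$ be a $g$-optical pairing: smooth real vector fields $\nu\in\Gamma(\mathcal R)$, $\nu^*\in\Gamma(\mathcal R^*)$ on $M$ with $g(\nu,\nu^*)=1$. Put $\sigma=g(\nu^*,\cdot)$ and $\sigma^*=g(\nu,\cdot)$. Write $X^\flat=g(X,\cdot)$, $d\alpha(X,Y)=X\alpha(Y)-Y\alpha(X)-\alpha([X,Y])$ for $1$-forms (and correspondingly for $2$-forms, without numerical factor), $\mathcal L$ for the Lie derivative, and $(J^*\beta)(X,Y,Z)=\beta(JX,JY,JZ)$. Then there is a unique connection $\nabla$ on $T^{\mathbb C}M$ (the Chern–Robinson connection; $\nabla_XY$ is defined for complex vector fields $X,Y$ and is complex-linear over smooth complex functions in $X$) such that $\nabla g=0$, $\nabla$ preserves each of $\mathcal R^{\mathbb C}$, $(\mathcal R^*)^{\mathbb C}$, $\mathcal S^{1,0}$, $\mathcal S^{0,1}$, and its torsion $T(X,Y)=\nabla_XY-\nabla_YX-[X,Y]$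 is given, for all $X,Y\in\Gamma(\mathcal S^{1,0})$ and $\bar Y\in\Gamma(\mathcal S^{0,1})$, by $$\begin{aligned} T(X,Y)&=-[X,Y]^{0,1}+d\sigma(X,Y)\,\nu+d\sigma^*(X,Y)\,\nu^*+\mathcal T^{1,0}(X,Y),\\ T(X,\bar Y)&=d\sigma(X,\bar Y)\,\nu+d\sigma^*(X,\bar Y)\,\nu^*,\\ T(\nu,X)&=-[\nu,X]^{0,1}+(\mathcal L_\nu\sigma^*)(X)\,\nu^*-\tfrac12(\mathcal L_Xg)(\nu,\nu^*)\,\nu+\mathcal T^{1,0}(\nu,X),\\ T(\nu^*,X)&=-[\nu^*,X]^{0,1}+(\mathcal L_{\nu^*}\sigma)(X)\,\nu-\tfrac12(\mathcal L_Xg)(\nu,\nu^*)\,\nu^*+\mathcal T^{1,0}(\nu^*,X),\\ T(\nu,\nu^*)&=-[\nu,\nu^*]_{\mathcal S}, \end{aligned}$$ the remaining components being the complex conjugates $T(\overline X,\overline Y)=\overline{T(X,Y)}$, $T(\nu,\overline X)=\overline{T(\nu,X)}$, $T(\nu^*,\overline X)=\overline{T(\nu^*,X)}$ for $X,Y\in\Gamma(\mathcal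 S^{1,0})$. Here $\mathcal T^{1,0}$ is the $\mathcal S^{1,0}$-valued term determined, for $X,Y\in\Gamma(\mathcal S^{1,0})$, $\bar Z\in\Gamma(\mathcal S^{0,1})$ and $n\in\{\nu,\nu^*\}$, by $$g(\mathcal T^{1,0}(X,Y),\bar Z)=(\mathcal L_Xg)(\bar Z,Y)+dX^\flat(\bar Z,Y),\qquad g(\mathcal T^{1,0}(n,X),\bar Z)=\tfrac12(\mathcal L_ng)(X,\bar Z).$$ Moreover, for the same $X,Y,\bar Z,n$, $$(\mathcal L_Xg)(\bar Z,Y)+dX^\flat(\bar Z,Y)=-\sqrt{-1}\,(d\omega)(X,Y,\bar Z)=-(J^*d\omega)(X,Y,\bar Z),$$ $$\tfrac12(\mathcal L_ng)(X,\bar Z)=-\tfrac{\sqrt{-1}}2(\mathcal L_n\omega)(X,\bar Z),$$ $$-g([n,X]^{0,1},Y)=-\tfrac12g\bigl((J\mathcal L_nJ)(X),Y\bigr)=\tfrac12(\mathcal L_ng)(X,Y)+\tfrac{\sqrt{-1}}2(\mathcal L_n\omega)(X,Y),$$ and the Chern–Robinson connection satisfies $\nabla_{\bar Y}X=\bar\partial_{\bar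 Y}X$ for $X\in\Gamma(\mathcal S^{1,0})$, $\bar Y\in\Gamma(\mathcal S^{0,1})$, where $\bar\partial_{\bar Y}X:=[\bar Y,X]^{1,0}$. -/

import Mathlib

open scoped TensorProduct Manifold ContDiff
open Bundle Module

noncomputable section

namespace Robinson

/-! ### Linear algebra on the complexification `ℂ ⊗[ℝ] V` of a real vector space -/

section LinearAlgebra

variable {V : Type*} [AddCommGroup V] [Module ℝ V]

/-- The real part `a` of `a + √-1 b ∈ V^ℂ`. -/
def reT : ℂ ⊗[ℝ] V →ₗ[ℝ] V :=
  (TensorProduct.lid ℝ V).toLinearMap ∘ₗ LinearMap.rTensor V Complex.reLm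

/-- The imaginary part `b` of `a + √-1 b ∈ V^ℂ`. -/
def imT : ℂ ⊗[ℝ] V →ₗ[ℝ] V :=
  (TensorProduct.lid ℝ V).toLinearMap ∘ₗ LinearMap.rTensor V Complex.imLm

@[simp] theorem reT_tmul (z : ℂ) (v : V) : reT (z ⊗ₜ[ℝ] v) = z.re • v := by simp [reT]

@[simp] theorem imT_tmul (z : ℂ) (v : V) : imT (z ⊗ₜ[ℝ] v) = z.im • v := by simp [imT]

theorem reT_smul (z : ℂ) (w : ℂ ⊗[ℝ] V) : reT (z • w) = z.re • reT w - z.im • imT w := by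
  induction w using TensorProduct.induction_on with
  | zero => simp
  | tmul a v => simp [TensorProduct.smul_tmul', sub_smul, mul_smul]
  | add a b ha hb => rw [smul_add, map_add, ha, hb, map_add, map_add]; module

theorem imT_smul (z : ℂ) (w : ℂ ⊗[ℝ] V) : imT (z • w) = z.re • imT w + z.im • reT w := by
  induction w using TensorProduct.induction_on with
  | zero => simp
  | tmul a v => simp [TensorProduct.smul_tmul', add_smul, mul_smul]
  | add a b ha hb => rw [smul_add, map_add, ha, hb, map_add, map_add]; module

theorem eq_re_add_im (w : ℂ ⊗[ℝ] V) :
    w = (1 : ℂ) ⊗ₜ[ℝ] reT w + Complex.I ⊗ₜ[ℝ] imT w := by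
  induction w using TensorProduct.induction_on with
  | zero => simp
  | tmul a v =>
    rw [reT_tmul, imT_tmul, TensorProduct.tmul_smul, TensorProduct.tmul_smul,
      TensorProduct.smul_tmul', TensorProduct.smul_tmul', ← TensorProduct.add_tmul]
    congr 1
    apply Complex.ext <;> simp
  | add a b ha hb =>
    nth_rewrite 1 [ha, hb]
    rw [map_add, map_add, TensorProduct.tmul_add, TensorProduct.tmul_add]
    abel

theorem ext_re_im {w w' : ℂ ⊗[ℝ] V} (h₁ : reT w = reT w') (h₂ : imT w = imT w') : w = w' := by
  rw [eq_re_add_im w, eq_re_add_im w', h₁, h₂]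

/-- Complex conjugation on `V^ℂ`. -/
def conjT : ℂ ⊗[ℝ] V →ₛₗ[starRingEnd ℂ] ℂ ⊗[ℝ] V where
  toFun w := (1 : ℂ) ⊗ₜ[ℝ] reT w - Complex.I ⊗ₜ[ℝ] imT w
  map_add' v w := by simp only [map_add, TensorProduct.tmul_add]; abel
  map_smul' z w := by
    apply ext_re_im <;> simp [reT_smul, imT_smul]; abel

@[simp] theorem reT_conjT (w : ℂ ⊗[ℝ] V) : reT (conjT w) = reT w := by simp [conjT]

@[simp] theorem imT_conjT (w : ℂ ⊗[ℝ] V) : imT (conjT w) = - imT w := by simp [conjT]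

@[simp] theorem conjT_conjT (w : ℂ ⊗[ℝ] V) : conjT (conjT w) = w := by
  apply ext_re_im <;> simp

theorem mem_baseChange_iff (p : Submodule ℝ V) (w : ℂ ⊗[ℝ] V) :
    w ∈ p.baseChange ℂ ↔ reT w ∈ p ∧ imT w ∈ p := by
  constructor
  · rintro ⟨u, rfl⟩
    induction u using TensorProduct.induction_on with
    | zero => simp
    | tmul a v =>
      simpa using ⟨p.smul_mem _ v.2, p.smul_mem _ v.2⟩
    | add a b ha hb =>
      simpa using ⟨p.add_mem ha.1 hb.1, p.add_mem ha.2 hb.2⟩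
  · rintro ⟨h₁, h₂⟩
    rw [eq_re_add_im w]
    exact add_mem (Submodule.tmul_mem_baseChange_of_mem _ h₁)
      (Submodule.tmul_mem_baseChange_of_mem _ h₂)

/-- A symmetric bilinear form of signature `(n - 1, 1)`. -/
structure IsLorentzForm (B : LinearMap.BilinForm ℝ V) : Prop where
  symm : ∀ v w, B v w = B w v
  index_one : ∃ v, B v v < 0 ∧ ∀ w, B v w = 0 → w ≠ 0 → 0 < B w w

/-- The conjugate `N̄` of a complex subspace `N` of `V^ℂ`. -/
def conjSub (N : Submodule ℂ (ℂ ⊗[ℝ] V)) : Submodule ℂ (ℂ ⊗[ℝ] V) := N.comap conjT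

@[simp] theorem mem_conjSub {N : Submodule ℂ (ℂ ⊗[ℝ] V)} {w : ℂ ⊗[ℝ] V} :
    w ∈ conjSub N ↔ conjT w ∈ N := Iff.rfl

/-- The real subspace `R` of `V` with `R^ℂ = N ∩ N̄`: the real vectors of `N`. -/
def realPart (N : Submodule ℂ (ℂ ⊗[ℝ] V)) : Submodule ℝ V :=
  (N.restrictScalars ℝ).comap (TensorProduct.mk ℝ ℂ V 1)

@[simp] theorem mem_realPart {N : Submodule ℂ (ℂ ⊗[ℝ] V)} {v : V} :
    v ∈ realPart N ↔ (1 : ℂ) ⊗ₜ[ℝ] v ∈ N := Iff.rfl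

theorem realPart_baseChange (N : Submodule ℂ (ℂ ⊗[ℝ] V)) :
    (realPart N).baseChange ℂ = N ⊓ conjSub N := by
  ext w
  rw [mem_baseChange_iff, Submodule.mem_inf, mem_conjSub, mem_realPart, mem_realPart]
  have e₁ : (2 : ℂ) • ((1 : ℂ) ⊗ₜ[ℝ] reT w) = w + conjT w := by
    apply ext_re_im <;> simp [two_smul]
  have e₂ : (2 * Complex.I : ℂ) • ((1 : ℂ) ⊗ₜ[ℝ] imT w) = w - conjT w := by
    apply ext_re_im <;> simp [reT_smul, imT_smul, two_smul]
  have e₃ : w = (1 : ℂ) • ((1 : ℂ) ⊗ₜ[ℝ] reT w) + Complex.I • ((1 : ℂ) ⊗ₜ[ℝ] imT w) := by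
    apply ext_re_im <;> simp [reT_smul, imT_smul]
  have e₄ : conjT w = (1 : ℂ) • ((1 : ℂ) ⊗ₜ[ℝ] reT w) - Complex.I • ((1 : ℂ) ⊗ₜ[ℝ] imT w) := by
    apply ext_re_im <;> simp [reT_smul, imT_smul]
  constructor
  · rintro ⟨h₁, h₂⟩
    refine ⟨?_, ?_⟩
    · rw [e₃]; exact add_mem (N.smul_mem _ h₁) (N.smul_mem _ h₂)
    · rw [e₄]; exact sub_mem (N.smul_mem _ h₁) (N.smul_mem _ h₂)
  · rintro ⟨h₁, h₂⟩
    refine ⟨?_, ?_⟩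
    · rw [← N.smul_mem_iff (two_ne_zero (α := ℂ)), e₁]; exact add_mem h₁ h₂
    · rw [← N.smul_mem_iff (mul_ne_zero two_ne_zero Complex.I_ne_zero), e₂]; exact sub_mem h₁ h₂

/-- The screen space `S = R^⊥ ∩ L^⊥`, where `R` is the real part of `N`. -/
def screen (B : LinearMap.BilinForm ℝ V) (N : Submodule ℂ (ℂ ⊗[ℝ] V)) (L : Submodule ℝ V) :
    Submodule ℝ V :=
  B.orthogonal (realPart N) ⊓ B.orthogonal L

/-- `S^{1,0} = N ∩ S^ℂ`. -/
def S10 (B : LinearMap.BilinForm ℝ V) (N : Submodule ℂ (ℂ ⊗[ℝ] V)) (L : Submodule ℝ V) :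
    Submodule ℂ (ℂ ⊗[ℝ] V) :=
  N ⊓ (screen B N L).baseChange ℂ

/-- `S^{0,1} = N̄ ∩ S^ℂ`. -/
def S01 (B : LinearMap.BilinForm ℝ V) (N : Submodule ℂ (ℂ ⊗[ℝ] V)) (L : Submodule ℝ V) :
    Submodule ℂ (ℂ ⊗[ℝ] V) :=
  conjSub N ⊓ (screen B N L).baseChange ℂ

/-- `N` is maximally totally null for the complexified Lorentzian form `B`, and `L` is a null line
with `V = L ⊕ R^⊥`, where `R^ℂ = N ∩ N̄`. -/
structure IsWittDatum (B : LinearMap.BilinForm ℝ V) (N : Submodule ℂ (ℂ ⊗[ℝ] V))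
    (L : Submodule ℝ V) : Prop where
  lorentz : IsLorentzForm B
  maxNull : (B.baseChange ℂ).orthogonal N = N
  finrank_eq : finrank ℝ L = 1
  null : ∀ v ∈ L, B v v = 0
  isCompl : IsCompl L (B.orthogonal (realPart N))

theorem baseChange_one_left (B : LinearMap.BilinForm ℝ V) (v : V) (w : ℂ ⊗[ℝ] V) :
    B.baseChange ℂ ((1 : ℂ) ⊗ₜ[ℝ] v) w = B v (reT w) + B v (imT w) * Complex.I := by
  conv_lhs => rw [eq_re_add_im w]
  simp [LinearMap.BilinForm.baseChange_tmul]

theorem baseChange_symm {B : LinearMap.BilinForm ℝ V} (hB : ∀ v w, B v w = B w v)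
    (v w : ℂ ⊗[ℝ] V) : B.baseChange ℂ v w = B.baseChange ℂ w v :=
  (LinearMap.BilinForm.IsSymm.baseChange ℂ (B₂ := B) ⟨hB⟩).eq v w

theorem IsLorentzForm.nondeg {B : LinearMap.BilinForm ℝ V} (hB : IsLorentzForm B) (a : V)
    (ha : ∀ b, B a b = 0) : a = 0 := by
  obtain ⟨v, hv, h⟩ := hB.index_one
  by_contra h0
  have := h a (by rw [hB.symm]; exact ha v) h0
  rw [ha a] at this
  exact lt_irrefl _ this

theorem IsLorentzForm.null_dep {B : LinearMap.BilinForm ℝ V} (hB : IsLorentzForm B) {a b : V}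
    (ha : a ≠ 0) (haa : B a a = 0) (hab : B a b = 0) (hbb : B b b = 0) : ∃ c : ℝ, b = c • a := by
  obtain ⟨v, hv, h⟩ := hB.index_one
  have hva : B v a ≠ 0 := fun h0 => by
    have := h a h0 ha
    rw [haa] at this
    exact lt_irrefl _ this
  refine ⟨B v b / B v a, ?_⟩
  by_contra hne
  have := h (b - (B v b / B v a) • a) (by simp; field_simp; simp) (sub_ne_zero.2 hne)
  have hba : B b a = 0 := by rw [hB.symm]; exact hab
  simp [haa, hab, hbb, hba] at this

/-- A Witt datum always admits a null basis `(n, n')` of `R ⊕ L` with `B n n' = 1`. -/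
theorem IsWittDatum.exists_pair {B : LinearMap.BilinForm ℝ V} {N : Submodule ℂ (ℂ ⊗[ℝ] V)}
    {L : Submodule ℝ V} (h : IsWittDatum B N L) :
    ∃ n n' : V, realPart N = Submodule.span ℝ {n} ∧ L = Submodule.span ℝ {n'} ∧
      B n n = 0 ∧ B n' n' = 0 ∧ B n n' = 1 := by
  obtain ⟨l, hl0, hl⟩ := finrank_eq_one_iff'.1 h.finrank_eq
  have hLs : L = Submodule.span ℝ {(l : V)} := by
    apply le_antisymm
    · intro v hv
      obtain ⟨c, hc⟩ := hl ⟨v, hv⟩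
      exact Submodule.mem_span_singleton.2 ⟨c, congrArg Subtype.val hc⟩
    · rw [Submodule.span_singleton_le_iff_mem]; exact l.2
  have hl0' : (l : V) ≠ 0 := fun hh => hl0 (Subtype.ext hh)
  have hlR : (l : V) ∉ B.orthogonal (realPart N) := fun hh =>
    hl0' (Submodule.disjoint_def.1 h.isCompl.disjoint _ l.2 hh)
  rw [LinearMap.BilinForm.mem_orthogonal_iff] at hlR
  push Not at hlR
  obtain ⟨n, hn, hnl⟩ := hlR
  have hnl : B n l ≠ 0 := hnl
  have hnull : ∀ a ∈ realPart N, ∀ b ∈ realPart N, B a b = 0 := fun a ha b hb => by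
    have h1 : (1 : ℂ) ⊗ₜ[ℝ] b ∈ (B.baseChange ℂ).orthogonal N := by rw [h.maxNull]; exact hb
    have := (LinearMap.BilinForm.mem_orthogonal_iff.1 h1) _ ha
    simpa [LinearMap.BilinForm.baseChange_tmul] using this
  have hn0 : n ≠ 0 := fun hh => hnl (by simp [hh])
  refine ⟨n, (B n l)⁻¹ • (l : V), ?_, ?_, hnull n hn n hn, ?_, ?_⟩
  · apply le_antisymm
    · intro b hb
      obtain ⟨c, rfl⟩ := h.lorentz.null_dep hn0 (hnull n hn n hn) (hnull n hn b hb) (hnull b hb b hb)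
      exact Submodule.mem_span_singleton.2 ⟨c, rfl⟩
    · rw [Submodule.span_singleton_le_iff_mem]; exact hn
  · exact hLs.trans (Submodule.span_singleton_smul_eq (IsUnit.mk0 _ (inv_ne_zero hnl)) _).symm
  · simp [h.null l l.2]
  · simp [hnl]

theorem mem_baseChange_orthogonal_span (B : LinearMap.BilinForm ℝ V) (n : V) (w : ℂ ⊗[ℝ] V) :
    w ∈ (B.orthogonal (Submodule.span ℝ {n})).baseChange ℂ ↔
      B.baseChange ℂ ((1 : ℂ) ⊗ₜ[ℝ] n) w = 0 := by
  have key : ∀ v, v ∈ B.orthogonal (Submodule.span ℝ {n}) ↔ B n v = 0 := fun v => by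
    rw [LinearMap.BilinForm.mem_orthogonal_iff]
    constructor
    · intro hh; exact hh n (Submodule.mem_span_singleton_self n)
    · rintro hh b hb
      obtain ⟨c, rfl⟩ := Submodule.mem_span_singleton.1 hb
      show B (c • n) v = 0
      simp [hh]
  rw [mem_baseChange_iff, key, key, baseChange_one_left, Complex.ext_iff]
  simp

theorem mem_screen_baseChange {B : LinearMap.BilinForm ℝ V} {N : Submodule ℂ (ℂ ⊗[ℝ] V)}
    {L : Submodule ℝ V} {n n' : V} (hn : realPart N = Submodule.span ℝ {n})
    (hn' : L = Submodule.span ℝ {n'}) (w : ℂ ⊗[ℝ] V) :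
    w ∈ (screen B N L).baseChange ℂ ↔ B.baseChange ℂ ((1 : ℂ) ⊗ₜ[ℝ] n) w = 0 ∧
      B.baseChange ℂ ((1 : ℂ) ⊗ₜ[ℝ] n') w = 0 := by
  rw [← mem_baseChange_orthogonal_span, ← mem_baseChange_orthogonal_span, screen, hn, hn']
  simp only [mem_baseChange_iff, Submodule.mem_inf]
  tauto

variable [FiniteDimensional ℝ V]

theorem sup_conj_eq {B : LinearMap.BilinForm ℝ V} (hB : IsLorentzForm B)
    {N : Submodule ℂ (ℂ ⊗[ℝ] V)} (hN : (B.baseChange ℂ).orthogonal N = N) {w : ℂ ⊗[ℝ] V}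
    (hw : ∀ u ∈ N ⊓ conjSub N, B.baseChange ℂ u w = 0) : w ∈ N ⊔ conjSub N := by
  have hconj : ∀ u v, B.baseChange ℂ (conjT u) (conjT v) = starRingEnd ℂ (B.baseChange ℂ u v) := by
    intro u v
    rw [eq_re_add_im u, eq_re_add_im v]
    simp [conjT, LinearMap.BilinForm.baseChange_tmul]
    ring
  have hs := baseChange_symm hB.symm
  have hnd : (B.baseChange ℂ).Nondegenerate := by
    have : ∀ a, (∀ b, B.baseChange ℂ a b = 0) → a = 0 := by
      intro a ha
      have h1 : ∀ b, B (reT a) b = 0 ∧ B (imT a) b = 0 := fun b => by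
        have := ha ((1 : ℂ) ⊗ₜ[ℝ] b)
        rw [hs, baseChange_one_left, Complex.ext_iff] at this
        simp at this
        rwa [hB.symm, hB.symm b] at this
      rw [eq_re_add_im a, hB.nondeg _ fun b => (h1 b).1, hB.nondeg _ fun b => (h1 b).2]
      simp
    exact ⟨this, fun a ha => this a fun b => by rw [hs]; exact ha b⟩
  have hrefl : (B.baseChange ℂ).IsRefl := fun x y hxy => by rw [hs]; exact hxy
  rw [← LinearMap.BilinForm.orthogonal_orthogonal hnd hrefl (N ⊔ conjSub N),
    LinearMap.BilinForm.mem_orthogonal_iff]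
  intro u hu
  rw [LinearMap.BilinForm.mem_orthogonal_iff] at hu
  apply hw
  refine Submodule.mem_inf.2 ⟨?_, ?_⟩
  · rw [← hN, LinearMap.BilinForm.mem_orthogonal_iff]
    exact fun v hv => hu v (Submodule.mem_sup_left hv)
  · rw [mem_conjSub, ← hN, LinearMap.BilinForm.mem_orthogonal_iff]
    intro v hv
    have := hu (conjT v) (Submodule.mem_sup_right (by simpa using hv))
    have h2 := hconj (conjT v) u
    rw [conjT_conjT, show B.baseChange ℂ (conjT v) u = 0 from this, map_zero] at h2
    exact h2

/-- The Witt decomposition `V^ℂ = (R^ℂ ⊕ L^ℂ) ⊕ (S^{1,0} ⊕ S^{0,1})`, seen from its summand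
`S^{1,0}`. -/
theorem IsWittDatum.isCompl_S10 {B : LinearMap.BilinForm ℝ V} {N : Submodule ℂ (ℂ ⊗[ℝ] V)}
    {L : Submodule ℝ V} (h : IsWittDatum B N L) :
    IsCompl (S10 B N L) ((realPart N).baseChange ℂ ⊔ L.baseChange ℂ ⊔ S01 B N L) := by
  obtain ⟨n, n', hn, hn', hnn, hnn', h1⟩ := h.exists_pair
  have hs := baseChange_symm h.lorentz.symm
  set β := B.baseChange ℂ with hβ
  set e : ℂ ⊗[ℝ] V := (1 : ℂ) ⊗ₜ[ℝ] n with he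
  set f : ℂ ⊗[ℝ] V := (1 : ℂ) ⊗ₜ[ℝ] n' with hf
  have hee : β e e = 0 := by simp [hβ, he, LinearMap.BilinForm.baseChange_tmul, hnn]
  have hff : β f f = 0 := by simp [hβ, hf, LinearMap.BilinForm.baseChange_tmul, hnn']
  have hef : β e f = 1 := by simp [hβ, he, hf, LinearMap.BilinForm.baseChange_tmul, h1]
  have hfe : β f e = 1 := by rw [hs]; exact hef
  have eN : e ∈ N := by
    have : n ∈ realPart N := by rw [hn]; exact Submodule.mem_span_singleton_self n
    exact this
  have eNb : e ∈ conjSub N := by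
    have : conjT e = e := by apply ext_re_im <;> simp [he]
    rw [mem_conjSub, this]; exact eN
  have hR : (realPart N).baseChange ℂ = Submodule.span ℂ {e} := by
    rw [hn, Submodule.baseChange_span]; simp [he]
  have hL : L.baseChange ℂ = Submodule.span ℂ {f} := by
    rw [hn', Submodule.baseChange_span]; simp [hf]
  have hNe : ∀ w ∈ N, β e w = 0 := fun w hw => by
    rw [← h.maxNull, LinearMap.BilinForm.mem_orthogonal_iff] at hw
    exact hw e eN
  have hNbe : ∀ w ∈ conjSub N, β e w = 0 := fun w hw => by
    have h2 := hNe _ hw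
    rw [hβ, he, baseChange_one_left, Complex.ext_iff] at h2
    simp at h2
    rw [hβ, he, baseChange_one_left, Complex.ext_iff]
    simpa using h2
  have hscr : ∀ w, w ∈ (screen B N L).baseChange ℂ ↔ β e w = 0 ∧ β f w = 0 :=
    fun w => mem_screen_baseChange (B := B) hn hn' w
  constructor
  · rw [Submodule.disjoint_def]
    intro s hsS hs2
    rw [hR, hL] at hs2
    obtain ⟨u, hu, t, ht, rfl⟩ := Submodule.mem_sup.1 hs2
    obtain ⟨u₁, hu₁, u₂, hu₂, rfl⟩ := Submodule.mem_sup.1 hu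
    obtain ⟨a, rfl⟩ := Submodule.mem_span_singleton.1 hu₁
    obtain ⟨b, rfl⟩ := Submodule.mem_span_singleton.1 hu₂
    have k1 := (hscr _).1 hsS.2
    have k2 := (hscr _).1 ht.2
    have hb : b = 0 := by simpa [k2.1, hee, hef] using k1.1
    have ha : a = 0 := by simpa [k2.2, hff, hfe] using k1.2
    subst ha hb
    simp only [zero_smul, zero_add] at hsS ⊢
    have : t ∈ Submodule.span ℂ {e} := by
      rw [← hR, realPart_baseChange]; exact ⟨hsS.1, ht.1⟩
    obtain ⟨c, rfl⟩ := Submodule.mem_span_singleton.1 this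
    have : c = 0 := by simpa [hfe] using k2.2
    simp [this]
  · rw [codisjoint_iff, eq_top_iff]
    intro v _
    set w := v - β f v • e - β e v • f with hw
    have hwe : β e w = 0 := by simp [hw, hee, hef]
    have hwf : β f w = 0 := by simp [hw, hff, hfe]
    have hwN : w ∈ N ⊔ conjSub N := by
      apply sup_conj_eq h.lorentz h.maxNull
      intro u hu
      rw [← realPart_baseChange, hR] at hu
      obtain ⟨c, rfl⟩ := Submodule.mem_span_singleton.1 hu
      rw [map_smul, LinearMap.smul_apply, ← hβ, hwe, smul_zero]
    obtain ⟨p, hp, q, hq, hpq⟩ := Submodule.mem_sup.1 hwN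
    have hp' : p - β f p • e ∈ S10 B N L := by
      refine ⟨sub_mem hp (N.smul_mem _ eN), (hscr _).2 ⟨?_, ?_⟩⟩
      · simp [hee, hNe p hp]
      · simp [hfe]
    have hq' : q - β f q • e ∈ S01 B N L := by
      refine ⟨sub_mem hq ((conjSub N).smul_mem _ eNb), (hscr _).2 ⟨?_, ?_⟩⟩
      · simp [hee, hNbe q hq]
      · simp [hfe]
    have hc : β f p + β f q = 0 := by rw [← map_add, hpq, hwf]
    have : v = (p - β f p • e) + ((β f v • e + β e v • f) + (q - β f q • e)) := by
      have hv : v = w + β f v • e + β e v • f := by rw [hw]; abel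
      have hc' : β f q = - β f p := by linear_combination hc
      refine hv.trans ?_
      rw [← hpq, hc']
      module
    rw [this, hR, hL]
    refine Submodule.add_mem_sup hp' (Submodule.add_mem_sup (Submodule.add_mem_sup ?_ ?_) hq')
    · exact Submodule.smul_mem _ _ (Submodule.mem_span_singleton_self e)
    · exact Submodule.smul_mem _ _ (Submodule.mem_span_singleton_self f)

/-- The projection `v ↦ v^{1,0}` of `V^ℂ` onto `S^{1,0}` along `R^ℂ ⊕ L^ℂ ⊕ S^{0,1}`. -/
def proj10 {B : LinearMap.BilinForm ℝ V} {N : Submodule ℂ (ℂ ⊗[ℝ] V)} {L : Submodule ℝ V}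
    (h : IsWittDatum B N L) : ℂ ⊗[ℝ] V →ₗ[ℂ] ℂ ⊗[ℝ] V :=
  Submodule.projection _ _ h.isCompl_S10

/-- The projection `v ↦ v^{0,1}` of `V^ℂ` onto `S^{0,1}`, which is the conjugate of `proj10`. -/
def proj01 {B : LinearMap.BilinForm ℝ V} {N : Submodule ℂ (ℂ ⊗[ℝ] V)} {L : Submodule ℝ V}
    (h : IsWittDatum B N L) : ℂ ⊗[ℝ] V →ₗ[ℂ] ℂ ⊗[ℝ] V :=
  conjT.comp ((proj10 h).comp conjT)

end LinearAlgebra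

/-! ### Complex vector fields -/

section Manifold

variable {E : Type*} [NormedAddCommGroup E] [NormedSpace ℝ E]
  {H : Type*} [TopologicalSpace H] (I : ModelWithCorners ℝ E H)
  {M : Type*} [TopologicalSpace M] [ChartedSpace H M] [IsManifold I ∞ M]

/-- The complexified tangent space `T_x^ℂ M`. -/
abbrev CTangent (x : M) : Type _ :=
  ℂ ⊗[ℝ] TangentSpace I x

/-- The section `x ↦ X x` of `T^ℂ M` is smooth on `U`. -/
def SmoothOnC (X : Π x : M, CTangent I x) (U : Set M) : Prop :=
  ContMDiffOn I I.tangent ∞ (fun x => (⟨x, reT (X x)⟩ : TangentBundle I M)) U ∧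
  ContMDiffOn I I.tangent ∞ (fun x => (⟨x, imT (X x)⟩ : TangentBundle I M)) U

/-- The vector field `x ↦ X x` is smooth on `U`. -/
def SmoothOnR (X : Π x : M, TangentSpace I x) (U : Set M) : Prop :=
  ContMDiffOn I I.tangent ∞ (fun x => (⟨x, X x⟩ : TangentBundle I M)) U

/-- `F` is a smooth complex subbundle of rank `k` of `T^ℂ M`. -/
def IsComplexSubbundle (F : Π x : M, Submodule ℂ (CTangent I x)) (k : ℕ) : Prop :=
  ∀ x₀ : M, ∃ U : Set M, IsOpen U ∧ x₀ ∈ U ∧ ∃ e : Fin k → Π x : M, CTangent I x,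
    (∀ i, SmoothOnC I (e i) U) ∧
    ∀ x ∈ U, LinearIndependent ℂ (fun i => e i x) ∧
      Submodule.span ℂ (Set.range fun i => e i x) = F x

/-- `F` is a smooth real subbundle of rank `k` of `TM`. -/
def IsRealSubbundle (F : Π x : M, Submodule ℝ (TangentSpace I x)) (k : ℕ) : Prop :=
  ∀ x₀ : M, ∃ U : Set M, IsOpen U ∧ x₀ ∈ U ∧ ∃ e : Fin k → Π x : M, TangentSpace I x,
    (∀ i, SmoothOnR I (e i) U) ∧
    ∀ x ∈ U, LinearIndependent ℝ (fun i => e i x) ∧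
      Submodule.span ℝ (Set.range fun i => e i x) = F x

variable (M)

/-- `Γ(T^ℂ M)`: the smooth sections of `T^ℂ M`, as a complex vector space. -/
def CVF : Submodule ℂ (Π x : M, CTangent I x) where
  carrier := {X | SmoothOnC I X Set.univ}
  zero_mem' := by
    have h : ContMDiffOn I I.tangent ∞ (fun x => (⟨x, 0⟩ : TangentBundle I M)) Set.univ :=
      (Bundle.contMDiff_zeroSection ℝ (TangentSpace I : M → Type _)).contMDiffOn
    constructor
    · simpa using h
    · simpa using h
  add_mem' {X Y} hX hY := by
    constructor
    · simpa using hX.1.add_section hY.1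
    · simpa using hX.2.add_section hY.2
  smul_mem' c X hX := by
    constructor
    · simpa [reT_smul, sub_eq_add_neg] using (hX.1.const_smul_section (a := c.re)).add_section
        (hX.2.const_smul_section (a := c.im)).neg_section
    · simpa [imT_smul] using (hX.2.const_smul_section (a := c.re)).add_section
        (hX.1.const_smul_section (a := c.im))


variable {I M}

/-- Multiplication of a smooth complex vector field by a smooth complex function. -/
def CVF.fsmul (f : C^∞⟮I, M; 𝓘(ℝ, ℂ), ℂ⟯) (X : CVF I M) : CVF I M :=
  ⟨fun x => f x • X.1 x, by
    have hre : ContMDiffOn I 𝓘(ℝ, ℝ) ∞ (fun x => (f x).re) Set.univ :=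
      ((Complex.reCLM.contMDiff (n := ∞)).comp f.contMDiff).contMDiffOn
    have him : ContMDiffOn I 𝓘(ℝ, ℝ) ∞ (fun x => (f x).im) Set.univ :=
      ((Complex.imCLM.contMDiff (n := ∞)).comp f.contMDiff).contMDiffOn
    constructor
    · simpa [reT_smul, sub_eq_add_neg] using (hre.smul_section X.2.1).add_section
        (him.smul_section X.2.2).neg_section
    · simpa [imT_smul] using (hre.smul_section X.2.2).add_section (him.smul_section X.2.1)⟩

/-- The complex conjugate of a smooth complex vector field. -/
def CVF.conj (X : CVF I M) : CVF I M :=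
  ⟨fun x => conjT (X.1 x), by
    constructor
    · simpa using X.2.1
    · simpa using X.2.2.neg_section⟩

/-- A smooth real vector field, as a complex vector field. -/
def CVF.ofReal (v : Π x : M, TangentSpace I x) (hv : SmoothOnR I v Set.univ) : CVF I M :=
  ⟨fun x => (1 : ℂ) ⊗ₜ[ℝ] v x, by
    have h : ContMDiffOn I I.tangent ∞ (fun x => (⟨x, 0⟩ : TangentBundle I M)) Set.univ :=
      (Bundle.contMDiff_zeroSection ℝ (TangentSpace I : M → Type _)).contMDiffOn
    constructor
    · simpa [SmoothOnR] using hv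
    · simpa using h⟩

/-- `X` is a section of the subbundle `F` of `T^ℂ M`. -/
def IsSectionOf (X : CVF I M) (F : Π x : M, Submodule ℂ (CTangent I x)) : Prop := ∀ x, X.1 x ∈ F x

/-! ### Differential calculus, extended complex linearly to `T^ℂ M` -/

/-- `X(f)`. -/
def cderiv (X : Π x : M, CTangent I x) (f : M → ℂ) (x : M) : ℂ :=
  mvfderiv I f x (reT (X x)) + Complex.I * mvfderiv I f x (imT (X x))

/-- The complex bilinear extension of the Lie bracket of vector fields. -/
def cbracket (X Y : Π x : M, CTangent I x) (x : M) : CTangent I x :=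
  (1 : ℂ) ⊗ₜ[ℝ]
      (VectorField.mlieBracket I (fun y => reT (X y)) (fun y => reT (Y y)) x
        - VectorField.mlieBracket I (fun y => imT (X y)) (fun y => imT (Y y)) x)
    + Complex.I ⊗ₜ[ℝ]
      (VectorField.mlieBracket I (fun y => reT (X y)) (fun y => imT (Y y)) x
        + VectorField.mlieBracket I (fun y => imT (X y)) (fun y => reT (Y y)) x)

/-- `dα(X, Y)` for a `1`-form `α`. -/
def d1 (α : Π x : M, CTangent I x →ₗ[ℂ] ℂ) (X Y : Π x : M, CTangent I x) (x : M) : ℂ :=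
  cderiv X (fun y => α y (Y y)) x - cderiv Y (fun y => α y (X y)) x - α x (cbracket X Y x)

/-- `dβ(X, Y, Z)` for a `2`-form `β`. -/
def d2 (β : Π x : M, LinearMap.BilinForm ℂ (CTangent I x)) (X Y Z : Π x : M, CTangent I x)
    (x : M) : ℂ :=
  cderiv X (fun y => β y (Y y) (Z y)) x - cderiv Y (fun y => β y (X y) (Z y)) x
    + cderiv Z (fun y => β y (X y) (Y y)) x
    - β x (cbracket X Y x) (Z x) + β x (cbracket X Z x) (Y x) - β x (cbracket Y Z x) (X x)

/-- `(L_X α)(Y)` for a `1`-form `α`. -/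
def lie1 (X : Π x : M, CTangent I x) (α : Π x : M, CTangent I x →ₗ[ℂ] ℂ)
    (Y : Π x : M, CTangent I x) (x : M) : ℂ :=
  cderiv X (fun y => α y (Y y)) x - α x (cbracket X Y x)

/-- `(L_X β)(Y, Z)` for a bilinear form `β`. -/
def lie2 (X : Π x : M, CTangent I x) (β : Π x : M, LinearMap.BilinForm ℂ (CTangent I x))
    (Y Z : Π x : M, CTangent I x) (x : M) : ℂ :=
  cderiv X (fun y => β y (Y y) (Z y)) x - β x (cbracket X Y x) (Z x) - β x (Y x) (cbracket X Z x)

/-- `(L_X A)(Y)` for a field of endomorphisms `A`. -/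
def lieEnd (X : Π x : M, CTangent I x) (A : Π x : M, CTangent I x →ₗ[ℂ] CTangent I x)
    (Y : Π x : M, CTangent I x) (x : M) : CTangent I x :=
  cbracket X (fun y => A y (Y y)) x - A x (cbracket X Y x)

/-! ### Almost Robinson structures -/

variable (I M) in
/-- A smooth metric of signature `(n - 1, 1)` on `M`. -/
structure LorentzMetric where
  val (x : M) : TangentSpace I x →L[ℝ] TangentSpace I x →L[ℝ] ℝ
  lorentz (x : M) : IsLorentzForm (val x).toBilinForm
  contMDiff : ContMDiff I (I.prod 𝓘(ℝ, E →L[ℝ] E →L[ℝ] ℝ)) ∞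
    (fun x => TotalSpace.mk' (E →L[ℝ] E →L[ℝ] ℝ)
      (E := fun y : M => TangentSpace I y →L[ℝ] TangentSpace I y →L[ℝ] ℝ) x (val x))

namespace LorentzMetric

/-- The metric at `x` as a bilinear form. -/
def form (g : LorentzMetric I M) (x : M) : LinearMap.BilinForm ℝ (TangentSpace I x) :=
  (g.val x).toBilinForm

/-- The complex bilinear extension of the metric. -/
def cform (g : LorentzMetric I M) (x : M) : LinearMap.BilinForm ℂ (CTangent I x) :=
  (g.form x).baseChange ℂ

/-- `X^♭ = g(X, ·)`. -/
def flat (g : LorentzMetric I M) (X : Π x : M, CTangent I x) (x : M) : CTangent I x →ₗ[ℂ] ℂ :=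
  g.cform x (X x)

end LorentzMetric

/-- An almost Robinson structure: a complex subbundle `N` of `T^ℂ M` of rank `m + 1` with
`N^⊥ = N` (here `dim M = 2m + 2`). -/
structure AlmostRobinsonStructure (g : LorentzMetric I M) (m : ℕ) where
  N (x : M) : Submodule ℂ (CTangent I x)
  isSubbundle : IsComplexSubbundle I N (m + 1)
  maxNull (x : M) : (g.cform x).orthogonal (N x) = N x

/-- The real line bundle `R` with `R^ℂ = N ∩ N̄`. -/
def AlmostRobinsonStructure.R {g : LorentzMetric I M} {m : ℕ}
    (𝒩 : AlmostRobinsonStructure g m) (x : M) : Submodule ℝ (TangentSpace I x) :=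
  realPart (𝒩.N x)

/-- A null line subbundle `R^*` of `TM` with `TM = R^* ⊕ R^⊥`. -/
structure DualNullBundle {g : LorentzMetric I M} {m : ℕ} (𝒩 : AlmostRobinsonStructure g m) where
  Rs (x : M) : Submodule ℝ (TangentSpace I x)
  isSubbundle : IsRealSubbundle I Rs 1
  null (x : M) : ∀ v ∈ Rs x, g.form x v v = 0
  isCompl (x : M) : IsCompl (Rs x) ((g.form x).orthogonal (𝒩.R x))

namespace DualNullBundle

variable {g : LorentzMetric I M} {m : ℕ} {𝒩 : AlmostRobinsonStructure g m}

theorem isWittDatum (ℛ : DualNullBundle 𝒩) (x : M) :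
    IsWittDatum (g.form x) (𝒩.N x) (ℛ.Rs x) where
  lorentz := g.lorentz x
  maxNull := 𝒩.maxNull x
  finrank_eq := by
    obtain ⟨U, -, hx, e, -, he⟩ := ℛ.isSubbundle x
    obtain ⟨hli, hsp⟩ := he x hx
    rw [← hsp, finrank_span_eq_card hli, Fintype.card_fin]
  null := ℛ.null x
  isCompl := ℛ.isCompl x

/-- The summand `R^ℂ`. -/
def RC (_ℛ : DualNullBundle 𝒩) (x : M) : Submodule ℂ (CTangent I x) := (𝒩.R x).baseChange ℂ

/-- The summand `(R^*)^ℂ`. -/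
def RsC (ℛ : DualNullBundle 𝒩) (x : M) : Submodule ℂ (CTangent I x) := (ℛ.Rs x).baseChange ℂ

/-- The summand `S^{1,0} = N ∩ S^ℂ`, where `S = R^⊥ ∩ (R^*)^⊥`. -/
def S10 (ℛ : DualNullBundle 𝒩) (x : M) : Submodule ℂ (CTangent I x) :=
  Robinson.S10 (g.form x) (𝒩.N x) (ℛ.Rs x)

/-- The summand `S^{0,1} = N̄ ∩ S^ℂ`. -/
def S01 (ℛ : DualNullBundle 𝒩) (x : M) : Submodule ℂ (CTangent I x) :=
  Robinson.S01 (g.form x) (𝒩.N x) (ℛ.Rs x)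

variable [FiniteDimensional ℝ E]

instance (x : M) : FiniteDimensional ℝ (TangentSpace I x) := inferInstanceAs (FiniteDimensional ℝ E)

/-- The projection `v ↦ v^{1,0}` onto `S^{1,0}`. -/
def P10 (ℛ : DualNullBundle 𝒩) (x : M) : CTangent I x →ₗ[ℂ] CTangent I x :=
  proj10 (ℛ.isWittDatum x)

/-- The projection `v ↦ v^{0,1}` onto `S^{0,1}`. -/
def P01 (ℛ : DualNullBundle 𝒩) (x : M) : CTangent I x →ₗ[ℂ] CTangent I x :=
  proj01 (ℛ.isWittDatum x)

/-- The endomorphism `J`: multiplication by `±√-1` on `S^{1,0}` and `S^{0,1}`, zero on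
`R ⊕ R^*`. -/
def J (ℛ : DualNullBundle 𝒩) (x : M) : CTangent I x →ₗ[ℂ] CTangent I x :=
  Complex.I • ℛ.P10 x - Complex.I • ℛ.P01 x

/-- The section `J X`. -/
def JX (ℛ : DualNullBundle 𝒩) (X : Π x : M, CTangent I x) (x : M) : CTangent I x := ℛ.J x (X x)

/-- The form `ω(u, v) = g(J u, v)`. -/
def omega (ℛ : DualNullBundle 𝒩) (x : M) : LinearMap.BilinForm ℂ (CTangent I x) :=
  (g.cform x) ∘ₗ (ℛ.J x)

/-- `∂̄_Y X = [Y, X]^{1,0}` (for `Y ∈ Γ(S^{0,1})` and `X ∈ Γ(S^{1,0})`). -/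
def dbar (ℛ : DualNullBundle 𝒩) (Y X : Π x : M, CTangent I x) (x : M) : CTangent I x :=
  ℛ.P10 x (cbracket Y X x)

end DualNullBundle

/-- A `g`-optical pairing `(ν, ν^*)`. -/
structure OpticalPairing {g : LorentzMetric I M} {m : ℕ} {𝒩 : AlmostRobinsonStructure g m}
    (ℛ : DualNullBundle 𝒩) where
  nu (x : M) : TangentSpace I x
  nuS (x : M) : TangentSpace I x
  smooth_nu : SmoothOnR I nu Set.univ
  smooth_nuS : SmoothOnR I nuS Set.univ
  nu_mem (x : M) : nu x ∈ 𝒩.R x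
  nuS_mem (x : M) : nuS x ∈ ℛ.Rs x
  pairing (x : M) : g.form x (nu x) (nuS x) = 1

/-! ### Connections on `T^ℂ M` -/

variable (I M) in
/-- A connection `(X, Y) ↦ ∇_X Y` on `T^ℂ M`, with `X` and `Y` smooth complex vector fields. -/
@[ext]
structure CConnection where
  toFun : CVF I M → CVF I M → CVF I M
  add_left (X X' Y : CVF I M) : toFun (X + X') Y = toFun X Y + toFun X' Y
  smul_left (f : C^∞⟮I, M; 𝓘(ℝ, ℂ), ℂ⟯) (X Y : CVF I M) :
    toFun (CVF.fsmul f X) Y = CVF.fsmul f (toFun X Y)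
  add_right (X Y Y' : CVF I M) : toFun X (Y + Y') = toFun X Y + toFun X Y'
  leibniz (f : C^∞⟮I, M; 𝓘(ℝ, ℂ), ℂ⟯) (X Y : CVF I M) (x : M) :
    (toFun X (CVF.fsmul f Y)).1 x = cderiv X.1 f x • Y.1 x + f x • (toFun X Y).1 x

namespace CConnection

/-- The torsion `T(X, Y) = ∇_X Y - ∇_Y X - [X, Y]`. -/
def torsion (D : CConnection I M) (X Y : CVF I M) (x : M) : CTangent I x :=
  (D.toFun X Y).1 x - (D.toFun Y X).1 x - cbracket X.1 Y.1 x

/-- `∇ g = 0`. -/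
def IsMetric (D : CConnection I M) (g : LorentzMetric I M) : Prop :=
  ∀ (X Y Z : CVF I M) (x : M), cderiv X.1 (fun y => g.cform y (Y.1 y) (Z.1 y)) x =
    g.cform x ((D.toFun X Y).1 x) (Z.1 x) + g.cform x (Y.1 x) ((D.toFun X Z).1 x)

/-- `∇` preserves the subbundle `F`. -/
def Preserves (D : CConnection I M) (F : Π x : M, Submodule ℂ (CTangent I x)) : Prop :=
  ∀ X Y : CVF I M, IsSectionOf Y F → IsSectionOf (D.toFun X Y) F

end CConnection

namespace OpticalPairing

variable {g : LorentzMetric I M} {m : ℕ} {𝒩 : AlmostRobinsonStructure g m}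
  {ℛ : DualNullBundle 𝒩}

/-- `ν` as a complex vector field. -/
def ν (p : OpticalPairing ℛ) : CVF I M := CVF.ofReal p.nu p.smooth_nu

/-- `ν^*` as a complex vector field. -/
def νs (p : OpticalPairing ℛ) : CVF I M := CVF.ofReal p.nuS p.smooth_nuS

/-- The optical form `σ = (ν^*)^♭`. -/
def σ (p : OpticalPairing ℛ) : Π x : M, CTangent I x →ₗ[ℂ] ℂ := g.flat p.νs.1

/-- The optical form `σ^* = ν^♭`. -/
def σs (p : OpticalPairing ℛ) : Π x : M, CTangent I x →ₗ[ℂ] ℂ := g.flat p.ν.1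

/-- The orthogonal projection `v_S = v - σ(v) ν - σ^*(v) ν^*` onto `S^ℂ`. -/
def projS (p : OpticalPairing ℛ) (x : M) (v : CTangent I x) : CTangent I x :=
  v - p.σ x v • p.ν.1 x - p.σs x v • p.νs.1 x

/-- `t` is the section of `S^{1,0}` determined by `g(t, Z) = φ(Z)` for all `Z ∈ Γ(S^{0,1})`. -/
def IsRep (ℛ : DualNullBundle 𝒩) (φ : CVF I M → M → ℂ) (t : CVF I M) : Prop :=
  IsSectionOf t ℛ.S10 ∧ ∀ Z : CVF I M, IsSectionOf Z ℛ.S01 → ∀ x, g.cform x (t.1 x) (Z.1 x) = φ Z x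

variable [FiniteDimensional ℝ E]

/-- The prescribed torsion. In the first, third and fourth clause, `t` is the term `𝒯^{1,0}`.
The last three clauses give the remaining components by conjugation (`ν` and `ν^*` are real). -/
structure HasChernRobinsonTorsion (p : OpticalPairing ℛ) (D : CConnection I M) : Prop where
  hol_hol : ∀ X Y : CVF I M, IsSectionOf X ℛ.S10 → IsSectionOf Y ℛ.S10 → ∃ t : CVF I M,
    IsRep ℛ (fun Z x => lie2 X.1 g.cform Z.1 Y.1 x + d1 (g.flat X.1) Z.1 Y.1 x) t ∧
    ∀ x, D.torsion X Y x = - ℛ.P01 x (cbracket X.1 Y.1 x) + d1 p.σ X.1 Y.1 x • p.ν.1 x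
      + d1 p.σs X.1 Y.1 x • p.νs.1 x + t.1 x
  hol_anti : ∀ X Y : CVF I M, IsSectionOf X ℛ.S10 → IsSectionOf Y ℛ.S01 →
    ∀ x, D.torsion X Y x = d1 p.σ X.1 Y.1 x • p.ν.1 x + d1 p.σs X.1 Y.1 x • p.νs.1 x
  nu_hol : ∀ X : CVF I M, IsSectionOf X ℛ.S10 → ∃ t : CVF I M,
    IsRep ℛ (fun Z x => (1 / 2 : ℂ) * lie2 p.ν.1 g.cform X.1 Z.1 x) t ∧
    ∀ x, D.torsion p.ν X x = - ℛ.P01 x (cbracket p.ν.1 X.1 x)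
      + lie1 p.ν.1 p.σs X.1 x • p.νs.1 x
      - ((1 / 2 : ℂ) * lie2 X.1 g.cform p.ν.1 p.νs.1 x) • p.ν.1 x + t.1 x
  nuS_hol : ∀ X : CVF I M, IsSectionOf X ℛ.S10 → ∃ t : CVF I M,
    IsRep ℛ (fun Z x => (1 / 2 : ℂ) * lie2 p.νs.1 g.cform X.1 Z.1 x) t ∧
    ∀ x, D.torsion p.νs X x = - ℛ.P01 x (cbracket p.νs.1 X.1 x)
      + lie1 p.νs.1 p.σ X.1 x • p.ν.1 x
      - ((1 / 2 : ℂ) * lie2 X.1 g.cform p.ν.1 p.νs.1 x) • p.νs.1 x + t.1 x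
  nu_nuS : ∀ x, D.torsion p.ν p.νs x = - p.projS x (cbracket p.ν.1 p.νs.1 x)
  anti_anti : ∀ X Y : CVF I M, IsSectionOf X ℛ.S10 → IsSectionOf Y ℛ.S10 →
    ∀ x, D.torsion (CVF.conj X) (CVF.conj Y) x = conjT (D.torsion X Y x)
  nu_anti : ∀ X : CVF I M, IsSectionOf X ℛ.S10 →
    ∀ x, D.torsion p.ν (CVF.conj X) x = conjT (D.torsion p.ν X x)
  nuS_anti : ∀ X : CVF I M, IsSectionOf X ℛ.S10 →
    ∀ x, D.torsion p.νs (CVF.conj X) x = conjT (D.torsion p.νs X x)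

/-- A metric connection preserving `R^ℂ`, `(R^*)^ℂ`, `S^{1,0}` and `S^{0,1}`, with the prescribed
torsion. -/
structure IsChernRobinson (p : OpticalPairing ℛ) (D : CConnection I M) : Prop where
  metric : D.IsMetric g
  preserves_R : D.Preserves ℛ.RC
  preserves_Rs : D.Preserves ℛ.RsC
  preserves_S10 : D.Preserves ℛ.S10
  preserves_S01 : D.Preserves ℛ.S01
  torsion : p.HasChernRobinsonTorsion D

end OpticalPairing

end Manifold

end Robinson

end

/-! The torsion conditions leave no choice. The connection preserves the four summands and `T(X, Ȳ)`
has no component in the screen space, so `∇_Ȳ X` must be the (1,0)-part of `[Ȳ, X]`, and `∇_X Ȳ` the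
(0,1)-part of `[X, Ȳ]`. Since `S^{1,0}` pairs only with `S^{0,1}`, metricity then forces `g(∇_X Y,
Z̄) = X g(Y, Z̄) - g(Y, [X, Z̄])`: the metric dual of the bracket derivative. Along `ν` and `ν^*`
the prescribed term `𝒯^{1,0}` makes the derivative of `S^{1,0}` the mean of the bracket derivative
and its metric dual. The null lines follow the same pattern: `R` is differentiated along `ν^*` by
the bracket, along `ν` by the metric dual, along the screen space by the mean of both.

Existence. `koszul` is the common shape of these formulas: metric dual along `Q X`, bracket along
`Q' X`. It is tensorial in `X` because the summands are null (`koszul_smul_left`). The Leibniz rule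
and metricity both come from `Q + Q' = id` (`koszul_smul_middle`, `koszul_add_swap`). Adding the
four forms, one for each summand, gives `g(∇_X Y, ·)`, and `exists_rep` turns this linear form into
a smooth field. The torsion is then read off component by component.

Uniqueness. The difference `A` of two solutions is a tensor that is skew for `g`, preserves the
summands and is symmetric in its arguments, as the torsions agree. On two different summands its
value lies in both, hence vanishes; on one summand, skewness moves `A` onto the dual summand, where
it is already zero (`eq_zero_of_symm`).

Smoothness. The projection to `S^{1,0}` is defined pointwise. It is smooth because a local frame of
`N` has an invertible Gram matrix against a suitable dual family (`exists_frame`).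

The alternative expressions hold because `ω` is `±√-1 g` as soon as one argument lies in `S^{1,0}`
or `S^{0,1}`. -/

set_option linter.unusedSectionVars false

noncomputable section

namespace Robinson

/-! ### Smooth complex functions, and derivatives along complex vector fields -/

section Calculus

variable {E : Type*} [NormedAddCommGroup E] [NormedSpace ℝ E]
  {H : Type*} [TopologicalSpace H] {I : ModelWithCorners ℝ E H}
  {M : Type*} [TopologicalSpace M] [ChartedSpace H M]

variable (I M) in
/-- The ring of smooth complex functions. -/
abbrev CFun : Type _ := C^∞⟮I, M; 𝓘(ℝ, ℂ), ℂ⟯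

/-- Smoothness is over `ℝ` although the values are complex. This instance makes `CFun I M` a
commutative ring, over which complex vector fields form a module; every later identity is proved in
that ring or module. -/
instance : ContMDiffRing 𝓘(ℝ, ℂ) ∞ ℂ :=
  { instNormedSpaceLieAddGroup with
    contMDiff_mul := by
      rw [contMDiff_iff]
      refine ⟨continuous_mul, fun x y => ?_⟩
      simp only [mfld_simps, chartAt_self_eq]
      rw [contDiffOn_univ]
      exact contDiff_mul }

section Functions

theorem mdifferentiableAt_of_smooth {f : M → ℂ} (hf : ContMDiff I 𝓘(ℝ, ℂ) ∞ f) (x : M) :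
    MDifferentiableAt I 𝓘(ℝ, ℂ) f x := (hf x).mdifferentiableAt (by simp)

/-- Used for the real part, the imaginary part and conjugation, all of them only `ℝ`-linear. -/
theorem mvfderiv_clm_comp {F F' : Type*} [NormedAddCommGroup F] [NormedSpace ℝ F]
    [NormedAddCommGroup F'] [NormedSpace ℝ F'] (L : F →L[ℝ] F') {f : M → F} {x : M}
    (hf : MDifferentiableAt I 𝓘(ℝ, F) f x) (v : TangentSpace I x) :
    mvfderiv I (fun y => L (f y)) x v = L (mvfderiv I f x v) := by
  have h := mfderiv_comp (I := I) (I' := 𝓘(ℝ, F)) (I'' := 𝓘(ℝ, F')) x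
    L.differentiableAt.mdifferentiableAt hf
  have h2 := congrArg (fun T => T v) h
  rw [ContinuousLinearMap.mfderiv_eq] at h2
  exact h2

theorem mvfderiv_cmul {f h : M → ℂ} {x : M} (hf : MDifferentiableAt I 𝓘(ℝ, ℂ) f x)
    (hh : MDifferentiableAt I 𝓘(ℝ, ℂ) h x) (v : TangentSpace I x) :
    mvfderiv I (fun y => f y * h y) x v = mvfderiv I f x v * h x + f x * mvfderiv I h x v := by
  have := congrArg (fun T => T v) (hf.hasMFDerivAt.mul hh.hasMFDerivAt).mfderiv
  refine this.trans ?_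
  rw [add_comm, mul_comm (mvfderiv I f x v)]
  rfl

theorem smooth_mvfderiv [IsManifold I ∞ M] {f : M → ℂ} (hf : ContMDiff I 𝓘(ℝ, ℂ) ∞ f)
    {v : Π x : M, TangentSpace I x}
    (hv : ContMDiff I I.tangent ∞ (fun x => (⟨x, v x⟩ : TangentBundle I M))) :
    ContMDiff I 𝓘(ℝ, ℂ) ∞ (fun x => mvfderiv I f x (v x)) := by
  have h1 : ContMDiff I.tangent 𝓘(ℝ, ℂ).tangent ∞ (tangentMap I 𝓘(ℝ, ℂ) f) :=
    hf.contMDiff_tangentMap (by simp)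
  exact (contMDiff_snd_tangentBundle_modelSpace ℂ 𝓘(ℝ, ℂ)).comp (h1.comp hv)

end Functions
theorem CFun.sum_apply {ι : Type*} (s : Finset ι) (f : ι → CFun I M) (x : M) :
    (∑ i ∈ s, f i) x = ∑ i ∈ s, f i x := by
  induction s using Finset.cons_induction with
  | empty => simp
  | cons a s ha ih => simp [Finset.sum_cons, ih]

/-- The conjugate of a smooth complex function. -/
def CFun.conj (f : CFun I M) : CFun I M :=
  ⟨fun x => starRingEnd ℂ (f x), Complex.conjCLE.toContinuousLinearMap.contMDiff.comp f.contMDiff⟩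

@[simp] theorem CFun.conj_apply (f : CFun I M) (x : M) : f.conj x = starRingEnd ℂ (f x) := rfl

variable [IsManifold I ∞ M]

instance : Module (CFun I M) (CVF I M) where
  smul f X := CVF.fsmul f X
  one_smul X := Subtype.ext (funext fun x => one_smul ℂ (X.1 x))
  mul_smul f h X := Subtype.ext (funext fun x => mul_smul (f x) (h x) (X.1 x))
  smul_zero f := Subtype.ext (funext fun x => smul_zero (f x))
  smul_add f X Y := Subtype.ext (funext fun x => smul_add (f x) (X.1 x) (Y.1 x))
  add_smul f h X := Subtype.ext (funext fun x => add_smul (f x) (h x) (X.1 x))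
  zero_smul X := Subtype.ext (funext fun x => zero_smul ℂ (X.1 x))

theorem fsmul_eq (f : CFun I M) (X : CVF I M) : CVF.fsmul f X = f • X := rfl

@[simp] theorem CVF.smul_apply (f : CFun I M) (X : CVF I M) (x : M) :
    (f • X).1 x = f x • X.1 x := rfl

@[simp] theorem CVF.add_apply (X Y : CVF I M) (x : M) : (X + Y).1 x = X.1 x + Y.1 x := rfl

@[simp] theorem CVF.sub_apply (X Y : CVF I M) (x : M) : (X - Y).1 x = X.1 x - Y.1 x := rfl

@[simp] theorem CVF.neg_apply (X : CVF I M) (x : M) : (-X).1 x = -X.1 x := rfl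


theorem CVF.ext' {X Y : CVF I M} (h : ∀ x, X.1 x = Y.1 x) : X = Y := Subtype.ext (funext h)

@[simp] theorem CVF.sum_apply {ι : Type*} (s : Finset ι) (X : ι → CVF I M) (x : M) :
    (∑ i ∈ s, X i).1 x = ∑ i ∈ s, (X i).1 x := by
  induction s using Finset.cons_induction with
  | empty => simp
  | cons a s ha ih => simp [Finset.sum_cons, ih]

@[simp] theorem CVF.conj_apply (X : CVF I M) (x : M) : (CVF.conj X).1 x = conjT (X.1 x) := rfl

@[simp] theorem CVF.conj_conj (X : CVF I M) : CVF.conj (CVF.conj X) = X := CVF.ext' fun x => by simp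

theorem CVF.smooth_re (X : CVF I M) :
    ContMDiff I I.tangent ∞ (fun x => (⟨x, reT (X.1 x)⟩ : TangentBundle I M)) :=
  contMDiffOn_univ.1 X.2.1

theorem CVF.smooth_im (X : CVF I M) :
    ContMDiff I I.tangent ∞ (fun x => (⟨x, imT (X.1 x)⟩ : TangentBundle I M)) :=
  contMDiffOn_univ.1 X.2.2

/-- The derivative of a smooth function along a smooth complex vector field. -/
def der (X : CVF I M) (f : CFun I M) : CFun I M :=
  ⟨cderiv X.1 f, (smooth_mvfderiv f.contMDiff (CVF.smooth_re X)).add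
    (contMDiff_const.mul (smooth_mvfderiv f.contMDiff (CVF.smooth_im X)))⟩

theorem der_apply (X : CVF I M) (f : CFun I M) (x : M) : der X f x = cderiv X.1 f x := rfl

theorem der_add_left (X Y : CVF I M) (f : CFun I M) : der (X + Y) f = der X f + der Y f := by
  ext x; simp [der_apply, cderiv]; ring

theorem der_smul_left (h : CFun I M) (X : CVF I M) (f : CFun I M) :
    der (h • X) f = h * der X f := by
  ext x
  simp only [der_apply, cderiv, CVF.smul_apply, reT_smul, imT_smul, map_sub, map_add, map_smul,
    ContMDiffMap.coe_mul, Pi.mul_apply, Complex.real_smul]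
  -- Once `h x` is split, the two sides differ only in the product of the two imaginary terms.
  conv_rhs => rw [← Complex.re_add_im (h x)]
  linear_combination (-(h x).im * (mvfderiv I f x) (imT (X.1 x))) * Complex.I_sq

theorem der_add_right (X : CVF I M) (f h : CFun I M) : der X (f + h) = der X f + der X h := by
  ext x
  have := mvfderiv_add (mdifferentiableAt_of_smooth f.contMDiff x)
    (mdifferentiableAt_of_smooth h.contMDiff x)
  simp only [der_apply, cderiv, ContMDiffMap.coe_add, Pi.add_apply, this,
    add_apply]
  ring

theorem der_mul (X : CVF I M) (f h : CFun I M) : der X (f * h) = der X f * h + f * der X h := by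
  ext x
  have := mvfderiv_cmul (mdifferentiableAt_of_smooth f.contMDiff x)
    (mdifferentiableAt_of_smooth h.contMDiff x)
  have e : (⇑(f * h) : M → ℂ) = fun y => f y * h y := rfl
  simp only [der_apply, cderiv, e, this, ContMDiffMap.coe_add, Pi.add_apply, ContMDiffMap.coe_mul,
    Pi.mul_apply]
  ring

theorem der_one (X : CVF I M) : der X (1 : CFun I M) = 0 := by
  have := der_mul X (1 : CFun I M) 1
  simpa using this

theorem der_zero (X : CVF I M) : der X (0 : CFun I M) = 0 := by
  have := der_add_right X (0 : CFun I M) 0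
  simpa using this

theorem der_conj (X : CVF I M) (f : CFun I M) : der (CVF.conj X) f.conj = (der X f).conj := by
  ext x
  have := mvfderiv_clm_comp Complex.conjCLE.toContinuousLinearMap
    (mdifferentiableAt_of_smooth f.contMDiff x)
  have e : (⇑f.conj : M → ℂ) = fun y => Complex.conjCLE.toContinuousLinearMap (f y) := rfl
  simp only [der_apply, cderiv, e, this, CFun.conj_apply, CVF.conj_apply, reT_conjT, imT_conjT]
  simp

end Calculus

/-! ### The complex bilinear Lie bracket -/

section Bracket

variable {E : Type*} [NormedAddCommGroup E] [NormedSpace ℝ E]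
  {H : Type*} [TopologicalSpace H] {I : ModelWithCorners ℝ E H}
  {M : Type*} [TopologicalSpace M] [ChartedSpace H M] [IsManifold I ∞ M]

theorem smoothOnC_of_re_im {X : Π x : M, CTangent I x} {v w : Π x : M, TangentSpace I x}
    (hv : ContMDiff I I.tangent ∞ (fun x => (⟨x, v x⟩ : TangentBundle I M)))
    (hw : ContMDiff I I.tangent ∞ (fun x => (⟨x, w x⟩ : TangentBundle I M)))
    (h : ∀ x, reT (X x) = v x) (h' : ∀ x, imT (X x) = w x) : SmoothOnC I X Set.univ := by
  obtain rfl : v = fun x => reT (X x) := funext fun x => (h x).symm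
  obtain rfl : w = fun x => imT (X x) := funext fun x => (h' x).symm
  exact ⟨hv.contMDiffOn, hw.contMDiffOn⟩

theorem mdifferentiableAt_re (X : CVF I M) (x : M) :
    MDifferentiableAt I I.tangent (fun y => (⟨y, reT (X.1 y)⟩ : TangentBundle I M)) x :=
  (CVF.smooth_re X x).mdifferentiableAt (by simp)

theorem mdifferentiableAt_im (X : CVF I M) (x : M) :
    MDifferentiableAt I I.tangent (fun y => (⟨y, imT (X.1 y)⟩ : TangentBundle I M)) x :=
  (CVF.smooth_im X x).mdifferentiableAt (by simp)

variable [CompleteSpace E]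

theorem smooth_mlieBracket {v w : Π x : M, TangentSpace I x}
    (hv : ContMDiff I I.tangent ∞ (fun x => (⟨x, v x⟩ : TangentBundle I M)))
    (hw : ContMDiff I I.tangent ∞ (fun x => (⟨x, w x⟩ : TangentBundle I M))) :
    ContMDiff I I.tangent ∞
      (fun x => (⟨x, VectorField.mlieBracket I v w x⟩ : TangentBundle I M)) := by
  -- The bracket costs one derivative, which is free at order `∞` because `∞ + 1 = ∞`.
  have : IsManifold I ((⊤ : ℕ∞) + 1) M := by simpa using (inferInstance : IsManifold I ∞ M)
  have : IsManifold I (minSmoothness ℝ 2) M := .of_le (n := ∞) (by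
    rw [minSmoothness_of_isRCLikeNormedField]
    exact WithTop.coe_le_coe.2 (le_top : (2 : ℕ∞) ≤ ⊤))
  exact fun x => ContMDiffAt.mlieBracket_vectorField (n := ⊤) (m := ⊤) (hv x) (hw x) (by simp)

/-- The Lie bracket of smooth complex vector fields. -/
def br (X Y : CVF I M) : CVF I M :=
  ⟨cbracket X.1 Y.1, by
    refine smoothOnC_of_re_im
      ((smooth_mlieBracket (CVF.smooth_re X) (CVF.smooth_re Y)).add_section
        (smooth_mlieBracket (CVF.smooth_im X) (CVF.smooth_im Y)).neg_section)
      ((smooth_mlieBracket (CVF.smooth_re X) (CVF.smooth_im Y)).add_section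
        (smooth_mlieBracket (CVF.smooth_im X) (CVF.smooth_re Y)))
      (fun x => ?_) (fun x => ?_)
    · simp [cbracket, sub_eq_add_neg]
    · simp [cbracket]⟩

theorem br_apply (X Y : CVF I M) (x : M) : (br X Y).1 x = cbracket X.1 Y.1 x := rfl

omit [CompleteSpace E] [IsManifold I ∞ M] in
theorem reT_cbracket (X Y : Π x : M, CTangent I x) (x : M) : reT (cbracket X Y x) =
    VectorField.mlieBracket I (fun y => reT (X y)) (fun y => reT (Y y)) x
        - VectorField.mlieBracket I (fun y => imT (X y)) (fun y => imT (Y y)) x := by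
  simp [cbracket]

omit [CompleteSpace E] [IsManifold I ∞ M] in
theorem imT_cbracket (X Y : Π x : M, CTangent I x) (x : M) : imT (cbracket X Y x) =
    VectorField.mlieBracket I (fun y => reT (X y)) (fun y => imT (Y y)) x
        + VectorField.mlieBracket I (fun y => imT (X y)) (fun y => reT (Y y)) x := by
  simp [cbracket]

theorem br_swap (X Y : CVF I M) : br Y X = - br X Y := by
  apply CVF.ext'
  intro x
  rw [CVF.neg_apply, br_apply, br_apply]
  apply ext_re_im
  · rw [map_neg, reT_cbracket, reT_cbracket, VectorField.mlieBracket_swap_apply,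
      VectorField.mlieBracket_swap_apply (V := fun y => imT (Y.1 y))]
    abel
  · rw [map_neg, imT_cbracket, imT_cbracket, VectorField.mlieBracket_swap_apply,
      VectorField.mlieBracket_swap_apply (V := fun y => imT (Y.1 y))]
    abel

theorem br_add_right (X Y Z : CVF I M) : br X (Y + Z) = br X Y + br X Z := by
  apply CVF.ext'
  intro x
  have hre : (fun y => reT ((Y + Z).1 y)) = (fun y => reT (Y.1 y)) + fun y => reT (Z.1 y) :=
    funext fun y => by simp
  have him : (fun y => imT ((Y + Z).1 y)) = (fun y => imT (Y.1 y)) + fun y => imT (Z.1 y) :=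
    funext fun y => by simp
  have h1 := fun V : Π x : M, TangentSpace I x => VectorField.mlieBracket_add_right (V := V)
    (mdifferentiableAt_re Y x) (mdifferentiableAt_re Z x)
  have h2 := fun V : Π x : M, TangentSpace I x => VectorField.mlieBracket_add_right (V := V)
    (mdifferentiableAt_im Y x) (mdifferentiableAt_im Z x)
  rw [CVF.add_apply, br_apply, br_apply, br_apply]
  apply ext_re_im
  · rw [map_add, reT_cbracket, reT_cbracket, reT_cbracket, hre, him, h1, h2]
    abel
  · rw [map_add, imT_cbracket, imT_cbracket, imT_cbracket, hre, him, h1, h2]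
    abel

theorem br_smul_right (f : CFun I M) (X Y : CVF I M) :
    br X (f • Y) = der X f • Y + f • br X Y := by
  apply CVF.ext'
  intro x
  have hf := mdifferentiableAt_of_smooth f.contMDiff x
  have hu : MDifferentiableAt I 𝓘(ℝ, ℝ) (fun y => (f y).re) x :=
    Complex.reCLM.differentiableAt.mdifferentiableAt.comp x hf
  have hw : MDifferentiableAt I 𝓘(ℝ, ℝ) (fun y => -(f y).im) x :=
    (-Complex.imCLM).differentiableAt.mdifferentiableAt.comp x hf
  have hw' : MDifferentiableAt I 𝓘(ℝ, ℝ) (fun y => (f y).im) x :=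
    Complex.imCLM.differentiableAt.mdifferentiableAt.comp x hf
  have du := mvfderiv_clm_comp Complex.reCLM hf
  have dw := mvfderiv_clm_comp (-Complex.imCLM) hf
  have dw' := mvfderiv_clm_comp Complex.imCLM hf
  have hre : (fun y => reT ((f • Y).1 y)) = (fun y => (f y).re) • (fun y => reT (Y.1 y)) +
      (fun y => -(f y).im) • fun y => imT (Y.1 y) :=
    funext fun y => by simp [reT_smul, sub_eq_add_neg]
  have him : (fun y => imT ((f • Y).1 y)) = (fun y => (f y).re) • (fun y => imT (Y.1 y)) +
      (fun y => (f y).im) • fun y => reT (Y.1 y) :=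
    funext fun y => by simp [imT_smul]
  have mdu : ∀ {V : Π x : M, TangentSpace I x} {a : M → ℝ}, MDifferentiableAt I 𝓘(ℝ, ℝ) a x →
      MDifferentiableAt I I.tangent (fun y => (⟨y, V y⟩ : TangentBundle I M)) x →
      MDifferentiableAt I I.tangent (fun y => (⟨y, (a • V) y⟩ : TangentBundle I M)) x :=
    fun ha hV => ha.smul_section hV
  -- For a real field `V`, the real Leibniz rule is applied to `Re f` and `Im f` separately. Taking
  -- for `V` the real and the imaginary part of `X` recovers the complex rule.
  have key1 : ∀ V : Π x : M, TangentSpace I x, VectorField.mlieBracket I V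
      (fun y => reT ((f • Y).1 y)) x = (mvfderiv I f x (V x)).re • reT (Y.1 x) +
        (f x).re • VectorField.mlieBracket I V (fun y => reT (Y.1 y)) x -
        (mvfderiv I f x (V x)).im • imT (Y.1 x) -
        (f x).im • VectorField.mlieBracket I V (fun y => imT (Y.1 y)) x := fun V => by
    rw [hre, VectorField.mlieBracket_add_right (mdu hu (mdifferentiableAt_re Y x))
      (mdu hw (mdifferentiableAt_im Y x)),
      VectorField.mlieBracket_smul_right hu (mdifferentiableAt_re Y x),
      VectorField.mlieBracket_smul_right hw (mdifferentiableAt_im Y x)]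
    erw [du, dw]
    simp
    module
  have key2 : ∀ V : Π x : M, TangentSpace I x, VectorField.mlieBracket I V
      (fun y => imT ((f • Y).1 y)) x = (mvfderiv I f x (V x)).re • imT (Y.1 x) +
        (f x).re • VectorField.mlieBracket I V (fun y => imT (Y.1 y)) x +
        (mvfderiv I f x (V x)).im • reT (Y.1 x) +
        (f x).im • VectorField.mlieBracket I V (fun y => reT (Y.1 y)) x := fun V => by
    rw [him, VectorField.mlieBracket_add_right (mdu hu (mdifferentiableAt_im Y x))
      (mdu hw' (mdifferentiableAt_re Y x)),
      VectorField.mlieBracket_smul_right hu (mdifferentiableAt_im Y x),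
      VectorField.mlieBracket_smul_right hw' (mdifferentiableAt_re Y x)]
    erw [du, dw']
    simp
    module
  rw [CVF.add_apply, CVF.smul_apply, CVF.smul_apply, br_apply, br_apply, der_apply, cderiv]
  apply ext_re_im
  · rw [map_add, reT_smul, reT_smul, reT_cbracket, reT_cbracket, imT_cbracket, key1, key2]
    simp
    module
  · rw [map_add, imT_smul, imT_smul, imT_cbracket, imT_cbracket, reT_cbracket, key1, key2]
    simp
    module

theorem br_add_left (X Y Z : CVF I M) : br (X + Y) Z = br X Z + br Y Z := by
  rw [br_swap Z, br_add_right, br_swap Z X, br_swap Z Y, neg_add]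

theorem br_smul_left (f : CFun I M) (X Y : CVF I M) :
    br (f • X) Y = f • br X Y - der Y f • X := by
  rw [br_swap Y, br_smul_right, br_swap Y X]
  simp [sub_eq_add_neg, add_comm]

theorem br_conj (X Y : CVF I M) : br (CVF.conj X) (CVF.conj Y) = CVF.conj (br X Y) := by
  apply CVF.ext'
  intro x
  rw [CVF.conj_apply, br_apply, br_apply]
  have hn : ∀ Z : CVF I M, (fun y => imT ((CVF.conj Z).1 y)) = (-1 : ℝ) • fun y => imT (Z.1 y) :=
    fun Z => funext fun y => by simp
  have hr : ∀ Z : CVF I M, (fun y => reT ((CVF.conj Z).1 y)) = fun y => reT (Z.1 y) :=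
    fun Z => funext fun y => by simp
  have h1 := fun (V : Π x : M, TangentSpace I x) (Z : CVF I M) =>
    VectorField.mlieBracket_const_smul_right (V := V) (c := (-1 : ℝ)) (mdifferentiableAt_im Z x)
  have h2 := fun (V : Π x : M, TangentSpace I x) (Z : CVF I M) =>
    VectorField.mlieBracket_const_smul_left (W := V) (c := (-1 : ℝ)) (mdifferentiableAt_im Z x)
  apply ext_re_im
  · rw [reT_conjT, reT_cbracket, reT_cbracket, hn, hn, hr, hr, h2, h1]
    simp
  · rw [imT_conjT, imT_cbracket, imT_cbracket, hn, hn, hr, hr, h2, h1]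
    simp [add_comm]

end Bracket

/-! ### The complexified metric on vector fields -/

section Metric

variable {E : Type*} [NormedAddCommGroup E] [NormedSpace ℝ E]
  {H : Type*} [TopologicalSpace H] {I : ModelWithCorners ℝ E H}
  {M : Type*} [TopologicalSpace M] [ChartedSpace H M] [IsManifold I ∞ M]

theorem baseChange_eq {V : Type*} [AddCommGroup V] [Module ℝ V] (B : LinearMap.BilinForm ℝ V)
    (v w : ℂ ⊗[ℝ] V) : B.baseChange ℂ v w = ((B (reT v) (reT w) - B (imT v) (imT w) : ℝ) : ℂ) +
      Complex.I * ((B (reT v) (imT w) + B (imT v) (reT w) : ℝ) : ℂ) := by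
  conv_lhs => rw [eq_re_add_im v, eq_re_add_im w]
  simp [LinearMap.BilinForm.baseChange_tmul]
  ring

theorem baseChange_conj {V : Type*} [AddCommGroup V] [Module ℝ V] (B : LinearMap.BilinForm ℝ V)
    (v w : ℂ ⊗[ℝ] V) :
    B.baseChange ℂ (conjT v) (conjT w) = starRingEnd ℂ (B.baseChange ℂ v w) := by
  simp [baseChange_eq]
  ring

theorem smooth_form (g : LorentzMetric I M) {v w : Π x : M, TangentSpace I x}
    (hv : ContMDiff I I.tangent ∞ (fun x => (⟨x, v x⟩ : TangentBundle I M)))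
    (hw : ContMDiff I I.tangent ∞ (fun x => (⟨x, w x⟩ : TangentBundle I M))) :
    ContMDiff I 𝓘(ℝ, ℝ) ∞ (fun x => g.form x (v x) (w x)) := by
  have h : ContMDiff I (I.prod 𝓘(ℝ, ℝ)) ∞
      (fun x => TotalSpace.mk' ℝ (E := Bundle.Trivial M ℝ) x (g.val x (v x) (w x))) :=
    ContMDiff.clm_bundle_apply₂ (F₁ := E) (F₂ := E) (F₃ := ℝ) (b := fun x : M => x)
      g.contMDiff hv hw
  intro x
  exact ((contMDiffAt_section _).1 (h x))

/-- The smooth function `g(X, Y)`. -/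
def G (g : LorentzMetric I M) : CVF I M →ₗ[CFun I M] CVF I M →ₗ[CFun I M] CFun I M :=
  LinearMap.mk₂ (CFun I M)
    (fun X Y => ⟨fun x => g.cform x (X.1 x) (Y.1 x), by
      have h := fun {a b : Π x : M, TangentSpace I x} ha hb =>
        Complex.ofRealCLM.contMDiff.comp (smooth_form g (v := a) (w := b) ha hb)
      have := ((h (CVF.smooth_re X) (CVF.smooth_re Y)).sub
        (h (CVF.smooth_im X) (CVF.smooth_im Y))).add (contMDiff_const (c := Complex.I) |>.mul
          ((h (CVF.smooth_re X) (CVF.smooth_im Y)).add (h (CVF.smooth_im X) (CVF.smooth_re Y))))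
      refine this.congr fun x => ?_
      simp [LorentzMetric.cform, baseChange_eq]⟩)
    (fun X X' Y => by
      ext x
      show g.cform x _ _ = g.cform x _ _ + g.cform x _ _
      simp)
    (fun f X Y => by
      ext x
      exact LinearMap.map_smul₂ (g.cform x) (f x) (X.1 x) (Y.1 x))
    (fun X Y Y' => by
      ext x
      show g.cform x _ _ = g.cform x _ _ + g.cform x _ _
      simp)
    (fun f X Y => by
      ext x
      exact map_smul (g.cform x (X.1 x)) (f x) (Y.1 x))

theorem G_apply (g : LorentzMetric I M) (X Y : CVF I M) (x : M) :
    G g X Y x = g.cform x (X.1 x) (Y.1 x) := rfl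

theorem cform_symm (g : LorentzMetric I M) (x : M) (v w : CTangent I x) :
    g.cform x v w = g.cform x w v := baseChange_symm (g.lorentz x).symm v w

theorem G_symm (g : LorentzMetric I M) (X Y : CVF I M) : G g X Y = G g Y X := by
  ext x; exact cform_symm g x _ _

theorem G_conj (g : LorentzMetric I M) (X Y : CVF I M) :
    G g (CVF.conj X) (CVF.conj Y) = (G g X Y).conj := by
  ext x; exact baseChange_conj _ _ _

/-- Testing against real vectors suffices: it separates the real and imaginary parts of `v`, to
which nondegeneracy of the Lorentz form applies. -/
theorem cform_nondeg (g : LorentzMetric I M) {x : M} {v : CTangent I x}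
    (h : ∀ w, g.cform x v w = 0) : v = 0 := by
  have h1 : ∀ b, g.form x (reT v) b = 0 ∧ g.form x (imT v) b = 0 := fun b => by
    have := h ((1 : ℂ) ⊗ₜ[ℝ] b)
    rw [LorentzMetric.cform, baseChange_eq, Complex.ext_iff] at this
    simpa using this
  apply ext_re_im
  · rw [map_zero]; exact (g.lorentz x).nondeg _ fun b => (h1 b).1
  · rw [map_zero]; exact (g.lorentz x).nondeg _ fun b => (h1 b).2

end Metric

/-! ### Bump functions and localization -/

section Bump

variable {E : Type*} [NormedAddCommGroup E] [NormedSpace ℝ E] [FiniteDimensional ℝ E]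
  {H : Type*} [TopologicalSpace H] {I : ModelWithCorners ℝ E H}
  {M : Type*} [TopologicalSpace M] [ChartedSpace H M] [IsManifold I ∞ M] [T2Space M]

-- The neighbourhood where the function equals 1 serves to extend local sections; the upper bound 1
-- keeps a denominator positive in `exists_local_inv`.
variable (I) in
theorem exists_bump {U : Set M} (hU : IsOpen U) {x₀ : M} (hx : x₀ ∈ U) :
    ∃ ρ : M → ℝ, ContMDiff I 𝓘(ℝ, ℝ) ∞ ρ ∧ tsupport ρ ⊆ U ∧ (∀ x, 0 ≤ ρ x) ∧ (∀ x, ρ x ≤ 1) ∧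
      ∃ V, IsOpen V ∧ x₀ ∈ V ∧ V ⊆ U ∧ ∀ x ∈ V, ρ x = 1 := by
  obtain ⟨f, -, hf⟩ := (SmoothBumpFunction.nhds_basis_tsupport (I := I) x₀).mem_iff.1
    (hU.mem_nhds hx)
  obtain ⟨V, hV, hVo, hxV⟩ := mem_nhds_iff.1 f.eventuallyEq_one
  refine ⟨f, f.contMDiff, hf, fun x => f.nonneg, fun x => f.le_one, V, hVo, hxV, ?_, hV⟩
  intro x hx
  apply hf
  apply subset_tsupport
  rw [Function.mem_support, show f x = 1 from hV hx]
  exact one_ne_zero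

/-- A real function as a smooth complex function. -/
def CFun.ofReal {ρ : M → ℝ} (h : ContMDiff I 𝓘(ℝ, ℝ) ∞ ρ) : CFun I M :=
  ⟨fun x => (ρ x : ℂ), Complex.ofRealCLM.contMDiff.comp h⟩

omit [FiniteDimensional ℝ E] [IsManifold I ∞ M] [T2Space M] in
theorem CFun.ofReal_apply {ρ : M → ℝ} (h : ContMDiff I 𝓘(ℝ, ℝ) ∞ ρ) (x : M) :
    CFun.ofReal h x = (ρ x : ℂ) := rfl

theorem exists_bump_smul {U : Set M} (hU : IsOpen U) {x₀ : M} (hx : x₀ ∈ U) :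
    ∃ ψ : CFun I M, ψ x₀ = 1 ∧ ∀ x ∉ U, ψ x = 0 := by
  obtain ⟨ρ, h, hs, -, -, V, -, hxV, -, hV⟩ := exists_bump I hU hx
  refine ⟨CFun.ofReal h, ?_, fun x hx => ?_⟩
  · simp [CFun.ofReal_apply, hV x₀ hxV]
  · have : ρ x = 0 := image_eq_zero_of_notMem_tsupport fun h => hx (hs h)
    simp [CFun.ofReal_apply, this]

/-- Sections that are smooth near a point agree near that point with global smooth sections. -/
theorem exists_extension {U : Set M} (hU : IsOpen U) {x₀ : M} (hx : x₀ ∈ U) {ι : Type*}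
    (e : ι → Π x : M, CTangent I x) (he : ∀ i, SmoothOnC I (e i) U) :
    ∃ (X : ι → CVF I M) (V : Set M), IsOpen V ∧ x₀ ∈ V ∧ V ⊆ U ∧
      ∀ x ∈ V, ∀ i, (X i).1 x = e i x := by
  obtain ⟨ρ, h, hs, -, -, V, hVo, hxV, hVU, hV⟩ := exists_bump I hU hx
  refine ⟨fun i => ⟨fun x => (ρ x : ℂ) • e i x, ?_⟩, V, hVo, hxV, hVU, fun x hx i => ?_⟩
  · refine smoothOnC_of_re_im (ContMDiffOn.smul_section_of_tsupport h.contMDiffOn hU hs (he i).1)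
      (ContMDiffOn.smul_section_of_tsupport h.contMDiffOn hU hs (he i).2) ?_ ?_
    · intro x; rw [reT_smul]; simp
    · intro x; rw [imT_smul]; simp
  · simp [hV x hx]

/-- A smooth function has an inverse near each point where it does not vanish. -/
theorem exists_local_inv (u : CFun I M) {x₀ : M} (hx : u x₀ ≠ 0) :
    ∃ (f : CFun I M) (V : Set M), IsOpen V ∧ x₀ ∈ V ∧ ∀ x ∈ V, f x * u x = 1 := by
  have hU : IsOpen {x | u x ≠ 0} := isOpen_ne_fun u.contMDiff.continuous continuous_const
  obtain ⟨ρ, h, hs, h0, h1, V, hVo, hxV, hVU, hV⟩ := exists_bump I hU hx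
  -- The inverse is `ū / (|u|² + 1 - ρ)`. The denominator has no zero, as `ρ = 0` wherever `u = 0`,
  -- and it reduces to `|u|²` where `ρ = 1`.
  have hne : ∀ x, Complex.normSq (u x) + (1 - ρ x) ≠ 0 := fun x => by
    by_cases hu : u x = 0
    · have : ρ x = 0 := image_eq_zero_of_notMem_tsupport fun h => hs h hu
      simp [hu, this]
    · have := Complex.normSq_pos.2 hu
      have := h1 x
      exact ne_of_gt (by linarith)
  have hsq : ContMDiff I 𝓘(ℝ, ℝ) ∞ fun x => Complex.normSq (u x) := by
    have hre : ContMDiff I 𝓘(ℝ, ℝ) ∞ fun x => (u x).re :=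
      (Complex.reCLM.contMDiff (n := ∞)).comp u.contMDiff
    have him : ContMDiff I 𝓘(ℝ, ℝ) ∞ fun x => (u x).im :=
      (Complex.imCLM.contMDiff (n := ∞)).comp u.contMDiff
    refine ((hre.mul hre).add (him.mul him)).congr fun x => ?_
    simp [Complex.normSq_apply]
  have hden : ContMDiff I 𝓘(ℝ, ℝ) ∞ fun x => (Complex.normSq (u x) + (1 - ρ x))⁻¹ :=
    (hsq.add (contMDiff_const.sub h)).inv₀ hne
  refine ⟨CFun.ofReal hden * u.conj, V, hVo, hxV, fun x hx => ?_⟩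
  have hu : u x ≠ 0 := hVU hx
  have hc : (Complex.normSq (u x) : ℂ) ≠ 0 := by
    exact_mod_cast (Complex.normSq_pos.2 hu).ne'
  rw [ContMDiffMap.coe_mul, Pi.mul_apply]
  show (((Complex.normSq (u x) + (1 - ρ x))⁻¹ : ℝ) : ℂ) * starRingEnd ℂ (u x) * u x = 1
  rw [hV x hx, mul_assoc, mul_comm (starRingEnd ℂ _), Complex.mul_conj]
  push_cast
  rw [sub_self, add_zero, inv_mul_cancel₀ hc]

end Bump

/-! ### Pointwise algebra of the Witt decomposition -/

section Pointwise

variable {E : Type*} [NormedAddCommGroup E] [NormedSpace ℝ E] [FiniteDimensional ℝ E]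
  {H : Type*} [TopologicalSpace H] {I : ModelWithCorners ℝ E H}
  {M : Type*} [TopologicalSpace M] [ChartedSpace H M] [IsManifold I ∞ M]
  {g : LorentzMetric I M} {m : ℕ} {𝒩 : AlmostRobinsonStructure g m} {ℛ : DualNullBundle 𝒩}

namespace OpticalPairing

variable (p : OpticalPairing ℛ)

theorem cform_ν_νs (x : M) : g.cform x (p.ν.1 x) (p.νs.1 x) = 1 := by
  show (g.form x).baseChange ℂ ((1 : ℂ) ⊗ₜ p.nu x) ((1 : ℂ) ⊗ₜ p.nuS x) = 1
  simp [LinearMap.BilinForm.baseChange_tmul, p.pairing]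

theorem cform_νs_ν (x : M) : g.cform x (p.νs.1 x) (p.ν.1 x) = 1 := by
  rw [cform_symm, cform_ν_νs]

theorem ν_mem_N (x : M) : p.ν.1 x ∈ 𝒩.N x := p.nu_mem x

omit [FiniteDimensional ℝ E] in
theorem cform_N {x : M} {v w : CTangent I x} (hv : v ∈ 𝒩.N x) (hw : w ∈ 𝒩.N x) :
    g.cform x v w = 0 := by
  rw [← 𝒩.maxNull x, LinearMap.BilinForm.mem_orthogonal_iff] at hw
  exact hw v hv

theorem cform_ν_ν (x : M) : g.cform x (p.ν.1 x) (p.ν.1 x) = 0 :=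
  cform_N (p.ν_mem_N x) (p.ν_mem_N x)

theorem cform_νs_νs (x : M) : g.cform x (p.νs.1 x) (p.νs.1 x) = 0 := by
  show (g.form x).baseChange ℂ ((1 : ℂ) ⊗ₜ p.nuS x) ((1 : ℂ) ⊗ₜ p.nuS x) = 0
  simp [LinearMap.BilinForm.baseChange_tmul, ℛ.null x _ (p.nuS_mem x)]

theorem conjT_ν (x : M) : conjT (p.ν.1 x) = p.ν.1 x := by
  show conjT ((1 : ℂ) ⊗ₜ p.nu x) = (1 : ℂ) ⊗ₜ p.nu x
  apply ext_re_im <;> simp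

theorem conjT_νs (x : M) : conjT (p.νs.1 x) = p.νs.1 x := by
  show conjT ((1 : ℂ) ⊗ₜ p.nuS x) = (1 : ℂ) ⊗ₜ p.nuS x
  apply ext_re_im <;> simp

/-- Both spaces are lines, and `g(ν, ν^*) = 1` prevents `ν` and `ν^*` from vanishing. -/
theorem spans (x : M) : realPart (𝒩.N x) = Submodule.span ℝ {p.nu x} ∧
    ℛ.Rs x = Submodule.span ℝ {p.nuS x} := by
  obtain ⟨n, n', hn, hn', -, -, -⟩ := (ℛ.isWittDatum x).exists_pair
  have h1 := p.pairing x
  have hm : p.nu x ∈ realPart (𝒩.N x) := p.nu_mem x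
  have hm' := p.nuS_mem x
  rw [hn] at hm
  rw [hn'] at hm'
  obtain ⟨a, ha⟩ := Submodule.mem_span_singleton.1 hm
  obtain ⟨b, hb⟩ := Submodule.mem_span_singleton.1 hm'
  have ha0 : a ≠ 0 := by rintro rfl; simp [← ha] at h1
  have hb0 : b ≠ 0 := by rintro rfl; simp [← hb] at h1
  rw [hn, hn', ← ha, ← hb]
  exact ⟨(Submodule.span_singleton_smul_eq (IsUnit.mk0 _ ha0) _).symm,
    (Submodule.span_singleton_smul_eq (IsUnit.mk0 _ hb0) _).symm⟩

theorem mem_RC {x : M} {v : CTangent I x} : v ∈ ℛ.RC x ↔ ∃ a : ℂ, a • p.ν.1 x = v := by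
  show v ∈ (realPart (𝒩.N x)).baseChange ℂ ↔ _
  rw [(p.spans x).1, Submodule.baseChange_span, Set.image_singleton, Submodule.mem_span_singleton]
  rfl

theorem mem_RsC {x : M} {v : CTangent I x} : v ∈ ℛ.RsC x ↔ ∃ a : ℂ, a • p.νs.1 x = v := by
  show v ∈ (ℛ.Rs x).baseChange ℂ ↔ _
  rw [(p.spans x).2, Submodule.baseChange_span, Set.image_singleton, Submodule.mem_span_singleton]
  rfl

theorem mem_S10 {x : M} {v : CTangent I x} : v ∈ ℛ.S10 x ↔ v ∈ 𝒩.N x ∧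
    g.cform x (p.ν.1 x) v = 0 ∧ g.cform x (p.νs.1 x) v = 0 := by
  show v ∈ 𝒩.N x ⊓ (screen (g.form x) (𝒩.N x) (ℛ.Rs x)).baseChange ℂ ↔ _
  rw [Submodule.mem_inf, mem_screen_baseChange (p.spans x).1 (p.spans x).2]
  rfl

theorem mem_S01' {x : M} {v : CTangent I x} : v ∈ ℛ.S01 x ↔ conjT v ∈ 𝒩.N x ∧
    g.cform x (p.ν.1 x) v = 0 ∧ g.cform x (p.νs.1 x) v = 0 := by
  show v ∈ conjSub (𝒩.N x) ⊓ (screen (g.form x) (𝒩.N x) (ℛ.Rs x)).baseChange ℂ ↔ _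
  rw [Submodule.mem_inf, mem_screen_baseChange (p.spans x).1 (p.spans x).2]
  rfl

omit [FiniteDimensional ℝ E] in
theorem cform_conj {x : M} (v w : CTangent I x) :
    g.cform x (conjT v) (conjT w) = starRingEnd ℂ (g.cform x v w) := baseChange_conj _ _ _

theorem cform_ν_conj {x : M} (v : CTangent I x) :
    g.cform x (p.ν.1 x) (conjT v) = starRingEnd ℂ (g.cform x (p.ν.1 x) v) := by
  rw [← cform_conj, conjT_ν]

theorem cform_νs_conj {x : M} (v : CTangent I x) :
    g.cform x (p.νs.1 x) (conjT v) = starRingEnd ℂ (g.cform x (p.νs.1 x) v) := by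
  rw [← cform_conj, conjT_νs]

include p in
theorem conjT_mem_S10 {x : M} {v : CTangent I x} : conjT v ∈ ℛ.S10 x ↔ v ∈ ℛ.S01 x := by
  rw [p.mem_S10, p.mem_S01', cform_ν_conj, cform_νs_conj]
  simp

include p in
theorem conjT_mem_S01 {x : M} {v : CTangent I x} : conjT v ∈ ℛ.S01 x ↔ v ∈ ℛ.S10 x := by
  rw [← p.conjT_mem_S10, conjT_conjT]

theorem P10_mem {x : M} (v : CTangent I x) : ℛ.P10 x v ∈ ℛ.S10 x :=
  Submodule.projection_apply_mem _ _

theorem P01_eq {x : M} (v : CTangent I x) : ℛ.P01 x v = conjT (ℛ.P10 x (conjT v)) := rfl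

include p in
theorem P01_mem {x : M} (v : CTangent I x) : ℛ.P01 x v ∈ ℛ.S01 x := by
  rw [P01_eq, p.conjT_mem_S01]; exact P10_mem _

theorem P10_of_mem {x : M} {v : CTangent I x} (hv : v ∈ ℛ.S10 x) : ℛ.P10 x v = v :=
  Submodule.projection_apply_of_mem_left _ hv

theorem P10_of_mem_S01 {x : M} {v : CTangent I x} (hv : v ∈ ℛ.S01 x) : ℛ.P10 x v = 0 :=
  Submodule.projection_apply_of_mem_right _ (Submodule.mem_sup_right hv)

theorem P10_ν (x : M) : ℛ.P10 x (p.ν.1 x) = 0 :=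
  Submodule.projection_apply_of_mem_right _ (Submodule.mem_sup_left
    (Submodule.mem_sup_left (p.mem_RC.2 ⟨1, one_smul _ _⟩)))

theorem P10_νs (x : M) : ℛ.P10 x (p.νs.1 x) = 0 :=
  Submodule.projection_apply_of_mem_right _ (Submodule.mem_sup_left
    (Submodule.mem_sup_right (p.mem_RsC.2 ⟨1, one_smul _ _⟩)))

include p in
theorem P01_of_mem {x : M} {v : CTangent I x} (hv : v ∈ ℛ.S01 x) : ℛ.P01 x v = v := by
  rw [P01_eq, P10_of_mem (p.conjT_mem_S10.2 hv), conjT_conjT]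

include p in
theorem P01_of_mem_S10 {x : M} {v : CTangent I x} (hv : v ∈ ℛ.S10 x) : ℛ.P01 x v = 0 := by
  rw [P01_eq, P10_of_mem_S01 (p.conjT_mem_S01.2 hv), map_zero]

theorem P01_ν (x : M) : ℛ.P01 x (p.ν.1 x) = 0 := by
  rw [P01_eq, conjT_ν, P10_ν, map_zero]

theorem P01_νs (x : M) : ℛ.P01 x (p.νs.1 x) = 0 := by
  rw [P01_eq, conjT_νs, P10_νs, map_zero]

/-- The Witt decomposition of a vector. -/
theorem decomp {x : M} (v : CTangent I x) : ℛ.P10 x v + ℛ.P01 x v +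
    g.cform x (p.νs.1 x) v • p.ν.1 x + g.cform x (p.ν.1 x) v • p.νs.1 x = v := by
  have hv : v ∈ ℛ.S10 x ⊔ (ℛ.RC x ⊔ ℛ.RsC x ⊔ ℛ.S01 x) := by
    rw [show ℛ.S10 x ⊔ (ℛ.RC x ⊔ ℛ.RsC x ⊔ ℛ.S01 x) = ⊤ from
      (ℛ.isWittDatum x).isCompl_S10.sup_eq_top]
    trivial
  obtain ⟨s, hs, u, hu, rfl⟩ := Submodule.mem_sup.1 hv
  obtain ⟨n, hn, t, ht, rfl⟩ := Submodule.mem_sup.1 hu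
  obtain ⟨a, ha, b, hb, rfl⟩ := Submodule.mem_sup.1 hn
  obtain ⟨a, rfl⟩ := p.mem_RC.1 ha
  obtain ⟨b, rfl⟩ := p.mem_RsC.1 hb
  obtain ⟨-, h1, h2⟩ := p.mem_S10.1 hs
  obtain ⟨-, h3, h4⟩ := p.mem_S01'.1 ht
  simp only [map_add, map_smul, P10_of_mem hs, P10_of_mem_S01 ht, P10_ν, P10_νs, p.P01_of_mem ht,
    p.P01_of_mem_S10 hs, P01_ν, P01_νs, h1, h2, h3, h4, cform_ν_ν, cform_νs_νs, cform_ν_νs,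
    cform_νs_ν, smul_eq_mul]
  module

theorem cform_S10_S10 {x : M} {v w : CTangent I x} (hv : v ∈ ℛ.S10 x) (hw : w ∈ ℛ.S10 x) :
    g.cform x v w = 0 := cform_N hv.1 hw.1

include p in
theorem cform_S01_S01 {x : M} {v w : CTangent I x} (hv : v ∈ ℛ.S01 x) (hw : w ∈ ℛ.S01 x) :
    g.cform x v w = 0 := by
  have := cform_S10_S10 (p.conjT_mem_S10.2 hv) (p.conjT_mem_S10.2 hw)
  rwa [cform_conj, map_eq_zero] at this

theorem cform_ν_S10 {x : M} {v : CTangent I x} (hv : v ∈ ℛ.S10 x) :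
    g.cform x (p.ν.1 x) v = 0 := (p.mem_S10.1 hv).2.1

theorem cform_νs_S10 {x : M} {v : CTangent I x} (hv : v ∈ ℛ.S10 x) :
    g.cform x (p.νs.1 x) v = 0 := (p.mem_S10.1 hv).2.2

theorem cform_ν_S01 {x : M} {v : CTangent I x} (hv : v ∈ ℛ.S01 x) :
    g.cform x (p.ν.1 x) v = 0 := (p.mem_S01'.1 hv).2.1

theorem cform_νs_S01 {x : M} {v : CTangent I x} (hv : v ∈ ℛ.S01 x) :
    g.cform x (p.νs.1 x) v = 0 := (p.mem_S01'.1 hv).2.2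

-- `S^{0,1}` is null and orthogonal to `ν` and `ν^*`, so only the (1,0)-component of `v`
-- contributes.
include p in
theorem cform_P01_right {x : M} (v w : CTangent I x) :
    g.cform x v (ℛ.P01 x w) = g.cform x (ℛ.P10 x v) (ℛ.P01 x w) := by
  conv_lhs => rw [← p.decomp v]
  simp [p.cform_S01_S01 (p.P01_mem v) (p.P01_mem w), p.cform_ν_S01 (p.P01_mem w),
    p.cform_νs_S01 (p.P01_mem w)]

include p in
/-- The projections onto `S^{1,0}` and `S^{0,1}` are adjoint. -/
theorem cform_P10_left {x : M} (v w : CTangent I x) :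
    g.cform x (ℛ.P10 x v) w = g.cform x (ℛ.P10 x v) (ℛ.P01 x w) := by
  conv_lhs => rw [← p.decomp w]
  simp [cform_S10_S10 (P10_mem v) (P10_mem w), cform_symm g x (ℛ.P10 x v) (p.ν.1 x),
    cform_symm g x (ℛ.P10 x v) (p.νs.1 x), p.cform_ν_S10 (P10_mem v),
    p.cform_νs_S10 (P10_mem v)]

/-- The real isometry of `T^ℂ M` that exchanges `ν` and `ν^*` and fixes the screen space. -/
def swap (x : M) (v : CTangent I x) : CTangent I x :=
  v + (g.cform x (p.ν.1 x) v - g.cform x (p.νs.1 x) v) • (p.ν.1 x - p.νs.1 x)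

theorem swap_add_smul {x : M} {s : CTangent I x} (hs : s ∈ ℛ.S10 x) (a : ℂ) :
    p.swap x (s + a • p.ν.1 x) = s + a • p.νs.1 x := by
  simp only [swap, map_add, map_smul, p.cform_ν_S10 hs, p.cform_νs_S10 hs, cform_ν_ν, cform_νs_ν,
    smul_eq_mul]
  module

/-- This is `N = S^{1,0} ⊕ R^ℂ`. Orthogonality to `ν` is automatic on the null space `N`, so it
remains to subtract the multiple of `ν` that makes the vector orthogonal to `ν^*`. -/
theorem eq_add_smul_of_mem_N {x : M} {v : CTangent I x} (hv : v ∈ 𝒩.N x) :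
    v = ℛ.P10 x v + g.cform x (p.νs.1 x) v • p.ν.1 x := by
  have h1 : v - g.cform x (p.νs.1 x) v • p.ν.1 x ∈ ℛ.S10 x := by
    refine p.mem_S10.2 ⟨sub_mem hv (Submodule.smul_mem _ _ (p.ν_mem_N x)), ?_, ?_⟩
    · simp [cform_N (p.ν_mem_N x) hv, cform_ν_ν]
    · simp [cform_νs_ν]
  have h2 := P10_of_mem h1
  rw [map_sub, map_smul, P10_ν, smul_zero, sub_zero] at h2
  rw [h2]
  abel

/-- A vector is determined modulo `R^* ⊕ S^{0,1}` by its pairings with the conjugates of the swapped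
vectors of `N`. -/
theorem cform_conj_swap {x : M} (v : CTangent I x) {w : CTangent I x} (hw : w ∈ 𝒩.N x) :
    g.cform x v (conjT (p.swap x w)) =
      g.cform x (ℛ.P10 x v + g.cform x (p.νs.1 x) v • p.ν.1 x) (conjT (p.swap x w)) := by
  rw [p.eq_add_smul_of_mem_N hw, p.swap_add_smul (P10_mem w)]
  have h1 := p.conjT_mem_S01.2 (P10_mem (ℛ := ℛ) w)
  have h2 := cform_symm g x v (p.νs.1 x)
  have h3 := cform_symm g x (ℛ.P10 x v) (p.νs.1 x)
  have h4 := p.cform_P01_right v (conjT (ℛ.P10 x w))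
  rw [p.P01_of_mem h1] at h4
  simp [map_add, LinearMap.map_smulₛₗ, conjT_νs, h2, h3, h4, p.cform_νs_S10 (P10_mem v),
    p.cform_ν_S01 h1, cform_ν_νs]

/-- Swapping and conjugating carries `N = S^{1,0} ⊕ R^ℂ` onto the complement `S^{0,1} ⊕ (R^*)^ℂ`. A
vector of `N` is orthogonal to `N` already; if it is orthogonal to this complement too,
nondegeneracy applies. -/
theorem eq_zero_of_cform_conj_swap {x : M} {u : CTangent I x} (hu : u ∈ 𝒩.N x)
    (h : ∀ w ∈ 𝒩.N x, g.cform x u (conjT (p.swap x w)) = 0) : u = 0 := by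
  apply cform_nondeg g
  intro w
  have e1 : g.cform x u (p.νs.1 x) = 0 := by
    have := h _ (p.ν_mem_N x)
    have e := p.swap_add_smul (zero_mem (ℛ.S10 x)) 1
    simp only [zero_add, one_smul] at e
    rwa [e, conjT_νs] at this
  have e2 : g.cform x u (ℛ.P01 x w) = 0 := by
    have hs := P10_mem (ℛ := ℛ) (conjT w)
    have := h _ hs.1
    have e := p.swap_add_smul hs 0
    simp only [zero_smul, add_zero] at e
    rwa [e] at this
  conv_lhs => rw [← p.decomp w]
  simp [e1, e2, cform_N hu (P10_mem (ℛ := ℛ) w).1, cform_N hu (p.ν_mem_N x)]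

end OpticalPairing

end Pointwise

/-! ### Smoothness of the projections, and representation of linear forms -/

section Smoothness

variable {E : Type*} [NormedAddCommGroup E] [NormedSpace ℝ E] [FiniteDimensional ℝ E]
  {H : Type*} [TopologicalSpace H] {I : ModelWithCorners ℝ E H}
  {M : Type*} [TopologicalSpace M] [ChartedSpace H M] [IsManifold I ∞ M]
  {g : LorentzMetric I M} {m : ℕ} {𝒩 : AlmostRobinsonStructure g m} {ℛ : DualNullBundle 𝒩}

theorem smoothOnC_of_local {X : Π x : M, CTangent I x}
    (h : ∀ x₀, ∃ (V : Set M) (Y : CVF I M), IsOpen V ∧ x₀ ∈ V ∧ ∀ x ∈ V, X x = Y.1 x) :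
    SmoothOnC I X Set.univ := by
  constructor <;> refine contMDiffOn_univ.2 fun x₀ => ?_ <;>
    obtain ⟨V, Y, hV, hx, hXY⟩ := h x₀
  · refine (CVF.smooth_re Y x₀).congr_of_eventuallyEq ?_
    filter_upwards [hV.mem_nhds hx] with x hx
    rw [hXY x hx]
  · refine (CVF.smooth_im Y x₀).congr_of_eventuallyEq ?_
    filter_upwards [hV.mem_nhds hx] with x hx
    rw [hXY x hx]

namespace OpticalPairing

variable (p : OpticalPairing ℛ)

/-- The exchange of `ν` and `ν^*` on smooth vector fields. -/
def swapField (X : CVF I M) : CVF I M := X + (G g p.ν X - G g p.νs X) • (p.ν - p.νs)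

theorem swapField_apply (X : CVF I M) (x : M) : (p.swapField X).1 x = p.swap x (X.1 x) := rfl

variable [T2Space M]

/-- Near each point, the projection onto `N` along `R^* ⊕ S^{0,1}` is given by smooth fields. -/
theorem exists_frame (x₀ : M) : ∃ (a b : Fin (m + 1) → CVF I M) (V : Set M), IsOpen V ∧ x₀ ∈ V ∧
    ∀ x ∈ V, ∀ v : CTangent I x, ℛ.P10 x v + g.cform x (p.νs.1 x) v • p.ν.1 x =
      ∑ j, g.cform x v ((b j).1 x) • (a j).1 x := by
  obtain ⟨U, hU, hxU, e, he, hf⟩ := 𝒩.isSubbundle x₀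
  obtain ⟨n, V₁, hV₁, hxV₁, hVU, hn⟩ := exists_extension hU hxU e he
  have hspan : ∀ x ∈ V₁, ∀ u ∈ 𝒩.N x, ∃ c : Fin (m + 1) → ℂ, ∑ i, c i • (n i).1 x = u := by
    intro x hx u hu
    rw [← (hf x (hVU hx)).2, Submodule.mem_span_range_iff_exists_fun] at hu
    obtain ⟨c, hc⟩ := hu
    exact ⟨c, by simpa only [hn x hx] using hc⟩
  have hmem : ∀ x ∈ V₁, ∀ i, (n i).1 x ∈ 𝒩.N x := fun x hx i => by
    rw [hn x hx, ← (hf x (hVU hx)).2]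
    exact Submodule.subset_span ⟨i, rfl⟩
  have hli : LinearIndependent ℂ fun i => (n i).1 x₀ := by
    simpa only [hn x₀ hxV₁] using (hf x₀ hxU).1
  -- The `b j` span `(R^*)^ℂ ⊕ S^{0,1}` on `V₁`. This space is null, so pairing with it ignores
  -- precisely the components to be projected away. The projection onto `N` is thus recovered from
  -- the Gram matrix `A` of the `n i` and `b j`.
  set b : Fin (m + 1) → CVF I M := fun j => CVF.conj (p.swapField (n j)) with hb
  set A : Matrix (Fin (m + 1)) (Fin (m + 1)) (CFun I M) := Matrix.of fun i j => G g (n i) (b j)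
    with hA
  have hA_apply : ∀ (c : Fin (m + 1) → ℂ) x j, g.cform x (∑ i, c i • (n i).1 x) ((b j).1 x) =
      ∑ i, c i * A i j x := fun c x j => by
    simp [map_sum, LinearMap.sum_apply, hA, G_apply]
  -- A vector `c` in the left kernel of `A` at `x₀` gives `∑ c i • n i` in `N` orthogonal to all
  -- conjugates of swapped vectors of `N`. It vanishes, against linear independence of the frame.
  have hdet : A.det x₀ ≠ 0 := by
    intro h0
    have h1 : (A.map (ContMDiffMap.evalRingHom x₀)).det = 0 := by
      rw [← RingHom.mapMatrix_apply, ← RingHom.map_det]; exact h0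
    obtain ⟨c, hc0, hc⟩ := Matrix.exists_vecMul_eq_zero_iff.2 h1
    apply hc0
    have hz : ∑ i, c i • (n i).1 x₀ = 0 := by
      apply p.eq_zero_of_cform_conj_swap
      · exact Submodule.sum_mem _ fun i _ => Submodule.smul_mem _ _ (hmem x₀ hxV₁ i)
      · intro w hw
        obtain ⟨d, rfl⟩ := hspan x₀ hxV₁ w hw
        have e1 : conjT (p.swap x₀ (∑ i, d i • (n i).1 x₀)) =
            ∑ i, starRingEnd ℂ (d i) • (b i).1 x₀ := by
          -- The scalars `d i` are taken as constant functions, so that linearity over smooth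
          -- functions applies; the swap is complex linear, and conjugation then conjugates them.
          have e2 : p.swapField (∑ i, (ContMDiffMap.const (d i) : CFun I M) • n i) =
              ∑ i, (ContMDiffMap.const (d i) : CFun I M) • p.swapField (n i) := by
            simp only [swapField, map_sum, map_smul, smul_add, Finset.sum_add_distrib, smul_smul,
              smul_eq_mul, ← Finset.sum_smul]
            simp only [mul_sub, Finset.sum_sub_distrib]
          have e3 := congrArg (fun X : CVF I M => conjT (X.1 x₀)) e2
          simp only [swapField_apply, CVF.sum_apply, CVF.smul_apply, map_sum,
            LinearMap.map_smulₛₗ] at e3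
          exact e3
        rw [e1, map_sum]
        refine Finset.sum_eq_zero fun j _ => ?_
        rw [map_smul, hA_apply]
        have := congrFun hc j
        simp only [Matrix.vecMul, dotProduct, Matrix.map_apply] at this
        have this' : ∑ i, c i * A i j x₀ = 0 := this
        rw [this', smul_zero]
    exact funext fun i => Fintype.linearIndependent_iff.1 hli c hz i
  -- Cramer's rule: `f * A.adjugate` is a globally smooth matrix that inverts `A` on `V₂`.
  obtain ⟨f, V₂, hV₂, hxV₂, hf⟩ := exists_local_inv A.det hdet
  refine ⟨fun j => ∑ k, (f * A.adjugate j k) • n k, b, V₁ ∩ V₂, hV₁.inter hV₂, ⟨hxV₁, hxV₂⟩, ?_⟩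
  rintro x ⟨hx₁, hx₂⟩ v
  obtain ⟨c, hc⟩ := hspan x hx₁ (ℛ.P10 x v + g.cform x (p.νs.1 x) v • p.ν.1 x)
    (add_mem (P10_mem v).1 (Submodule.smul_mem _ _ (p.ν_mem_N x)))
  have hv : ∀ j, g.cform x v ((b j).1 x) = ∑ i, c i * A i j x := fun j => by
    rw [← hA_apply, hc]
    exact p.cform_conj_swap v (hmem x hx₁ j)
  rw [← hc]
  simp only [hv, CVF.sum_apply, CVF.smul_apply, Finset.smul_sum, smul_smul]
  rw [Finset.sum_comm]
  refine Finset.sum_congr rfl fun k _ => ?_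
  rw [← Finset.sum_smul]
  congr 1
  have hadj : ∀ i, ∑ j, A i j x * A.adjugate j k x = if i = k then A.det x else 0 := fun i => by
    have h1 := congrFun (congrFun (Matrix.mul_adjugate A) i) k
    have h2 := congrArg (fun q : CFun I M => q x) h1
    rw [Matrix.mul_apply] at h2
    simp only [CFun.sum_apply, ContMDiffMap.coe_mul, Pi.mul_apply, Matrix.smul_apply,
      Matrix.one_apply, smul_eq_mul] at h2
    rw [h2]
    split_ifs <;> simp
  have : ∑ j, (∑ i, c i * A i j x) * (f * A.adjugate j k) x =
      ∑ i, c i * f x * ∑ j, A i j x * A.adjugate j k x := by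
    simp only [Finset.sum_mul, Finset.mul_sum, ContMDiffMap.coe_mul, Pi.mul_apply]
    rw [Finset.sum_comm]
    exact Finset.sum_congr rfl fun i _ => Finset.sum_congr rfl fun j _ => by ring
  rw [this]
  simp only [hadj, mul_ite, mul_zero, Finset.sum_ite_eq', Finset.mem_univ,
    if_true]
  rw [mul_assoc, hf x hx₂, mul_one]

/-- The `(1,0)`-component of smooth vector fields. -/
def pr10 : CVF I M →ₗ[CFun I M] CVF I M where
  toFun X := ⟨fun x => ℛ.P10 x (X.1 x), smoothOnC_of_local fun x₀ => by
    obtain ⟨a, b, V, hV, hx, h⟩ := p.exists_frame x₀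
    -- The frame projects onto `N = S^{1,0} ⊕ R^ℂ`; the component along `ν` has to be removed.
    refine ⟨V, ∑ j, G g X (b j) • a j - G g p.νs X • p.ν, hV, hx, fun x hx => ?_⟩
    have := h x hx (X.1 x)
    rw [CVF.sub_apply, CVF.sum_apply, eq_sub_iff_add_eq]
    exact this⟩
  map_add' _ _ := CVF.ext' fun x => map_add (ℛ.P10 x) _ _
  map_smul' _ _ := CVF.ext' fun x => map_smul (ℛ.P10 x) _ _

theorem pr10_apply (X : CVF I M) (x : M) : (p.pr10 X).1 x = ℛ.P10 x (X.1 x) := rfl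

/-- The `(0,1)`-component of smooth vector fields. -/
def pr01 : CVF I M →ₗ[CFun I M] CVF I M where
  toFun X := ⟨fun x => ℛ.P01 x (X.1 x), (CVF.conj (p.pr10 (CVF.conj X))).2⟩
  map_add' _ _ := CVF.ext' fun x => map_add (ℛ.P01 x) _ _
  map_smul' _ _ := CVF.ext' fun x => map_smul (ℛ.P01 x) _ _

theorem pr01_apply (X : CVF I M) (x : M) : (p.pr01 X).1 x = ℛ.P01 x (X.1 x) := rfl

theorem decomp_field (X : CVF I M) :
    p.pr10 X + p.pr01 X + G g p.νs X • p.ν + G g p.ν X • p.νs = X :=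
  CVF.ext' fun x => p.decomp (X.1 x)

include p in
/-- Near each point, there is a smooth resolution of the identity. -/
theorem exists_resolution (x₀ : M) : ∃ (ι : Type) (_ : Fintype ι) (a b : ι → CVF I M) (V : Set M),
    IsOpen V ∧ x₀ ∈ V ∧ ∀ x ∈ V, ∀ v : CTangent I x,
      v = ∑ j, g.cform x v ((b j).1 x) • (a j).1 x := by
  obtain ⟨a, b, V, hV, hx, h⟩ := p.exists_frame x₀
  -- The frame of `N` and its conjugate both count the component in `R^ℂ = N ∩ N̄`. The term with
  -- `-ν` removes the duplicate and the last term supplies the component in `(R^*)^ℂ`.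
  refine ⟨(Fin (m + 1) ⊕ Fin (m + 1)) ⊕ (Unit ⊕ Unit), inferInstance,
    Sum.elim (Sum.elim a fun j => CVF.conj (a j)) (Sum.elim (fun _ => -p.ν) fun _ => p.νs),
    Sum.elim (Sum.elim b fun j => CVF.conj (b j)) (Sum.elim (fun _ => p.νs) fun _ => p.ν),
    V, hV, hx, fun x hx v => ?_⟩
  simp only [Fintype.sum_sum_type, Sum.elim_inl, Sum.elim_inr, ← h x hx v, Finset.univ_unique,
    Finset.sum_singleton, CVF.conj_apply, CVF.neg_apply]
  have h2 := congrArg conjT (h x hx (conjT v))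
  simp only [map_sum, LinearMap.map_smulₛₗ, map_add, conjT_ν, ← cform_conj, conjT_conjT,
    conjT_νs] at h2
  rw [← h2, cform_symm g x v (p.ν.1 x), cform_symm g x v (p.νs.1 x)]
  have h3 := p.decomp v
  rw [P01_eq] at h3
  nth_rewrite 1 [← h3]
  module

include p in
theorem exists_field (x : M) (v : CTangent I x) : ∃ X : CVF I M, X.1 x = v := by
  obtain ⟨ι, _, a, b, V, -, hx, h⟩ := p.exists_resolution x
  refine ⟨∑ j, (ContMDiffMap.const (g.cform x v ((b j).1 x)) : CFun I M) • a j, ?_⟩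
  rw [CVF.sum_apply]
  exact (h x hx v).symm

include p in
theorem ext_G {X Y : CVF I M} (h : ∀ Z, G g X Z = G g Y Z) : X = Y := by
  apply CVF.ext'
  intro x
  rw [← sub_eq_zero]
  apply cform_nondeg g
  intro w
  obtain ⟨Z, rfl⟩ := p.exists_field x w
  have := congrArg (fun f : CFun I M => f x) (h Z)
  simp only [G_apply] at this
  rw [map_sub, LinearMap.sub_apply, this, sub_self]

include p in
/-- Every linear form on smooth vector fields is the pairing with a smooth vector field. -/
theorem exists_rep (φ : CVF I M →ₗ[CFun I M] CFun I M) : ∃ t : CVF I M, ∀ Z, G g t Z = φ Z := by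
  have hloc : ∀ x₀, ∃ (t : CVF I M) (V : Set M), IsOpen V ∧ x₀ ∈ V ∧
      ∀ x ∈ V, ∀ Z, G g t Z x = φ Z x := by
    intro x₀
    obtain ⟨ι, _, a, b, V, hV, hx, h⟩ := p.exists_resolution x₀
    refine ⟨∑ j, φ (a j) • b j, V, hV, hx, fun x hx Z => ?_⟩
    -- The resolution of the identity holds only on `V`. Multiplied by `ψ` it becomes a global
    -- identity of fields, to which `φ` applies; at `x`, where `ψ = 1`, nothing is lost.
    obtain ⟨ψ, h1, h0⟩ := exists_bump_smul (I := I) hV hx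
    have e : ψ • Z = ∑ j, (ψ * G g Z (b j)) • a j := by
      apply CVF.ext'
      intro y
      simp only [CVF.sum_apply, CVF.smul_apply, ContMDiffMap.coe_mul, Pi.mul_apply, mul_smul,
        ← Finset.smul_sum]
      by_cases hy : y ∈ V
      · exact congrArg _ (h y hy (Z.1 y))
      · simp [h0 y hy]
    have e2 := congrArg (fun f : CFun I M => f x) (congrArg φ e)
    simp only [map_smul, map_sum, smul_eq_mul, ContMDiffMap.coe_mul, Pi.mul_apply, h1, one_mul,
      CFun.sum_apply] at e2
    rw [e2]
    simp only [map_sum, map_smul, LinearMap.sum_apply, LinearMap.smul_apply, CFun.sum_apply,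
      smul_eq_mul, ContMDiffMap.coe_mul, Pi.mul_apply]
    exact Finset.sum_congr rfl fun j _ => by rw [G_symm, mul_comm]
  choose t V hV hx ht using hloc
  -- By nondegeneracy the local solutions agree on overlaps, so no partition of unity is needed.
  have hcomp : ∀ x₀, ∀ x ∈ V x₀, (t x).1 x = (t x₀).1 x := by
    intro x₀ x hxx
    rw [← sub_eq_zero]
    apply cform_nondeg g
    intro w
    obtain ⟨Z, rfl⟩ := p.exists_field x w
    have h1 := ht x x (hx x) Z
    have h2 := ht x₀ x hxx Z
    simp only [G_apply] at h1 h2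
    rw [map_sub, LinearMap.sub_apply, h1, h2, sub_self]
  refine ⟨⟨fun x => (t x).1 x, smoothOnC_of_local fun x₀ =>
    ⟨V x₀, t x₀, hV x₀, hx x₀, hcomp x₀⟩⟩, fun Z => ?_⟩
  ext x
  exact ht x x (hx x) Z

end OpticalPairing

end Smoothness

/-! ### The Koszul formula and the connection -/

section Connection

variable {E : Type*} [NormedAddCommGroup E] [NormedSpace ℝ E] [FiniteDimensional ℝ E]
  [CompleteSpace E]
  {H : Type*} [TopologicalSpace H] {I : ModelWithCorners ℝ E H}
  {M : Type*} [TopologicalSpace M] [ChartedSpace H M] [IsManifold I ∞ M]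

section Koszul

variable (g : LorentzMetric I M) (P P' Q Q' : CVF I M →ₗ[CFun I M] CVF I M)

/-- The partial Koszul form: it differentiates along `Q X` by the metric and along `Q' X` by the
Lie bracket. -/
def koszul (X Y Z : CVF I M) : CFun I M :=
  der (Q X) (G g (P Y) (P' Z)) - G g (P Y) (br (Q X) (P' Z)) + G g (br (Q' X) (P Y)) (P' Z)

variable {g P P' Q Q'}

theorem koszul_add_left (X X' Y Z : CVF I M) : koszul g P P' Q Q' (X + X') Y Z =
    koszul g P P' Q Q' X Y Z + koszul g P P' Q Q' X' Y Z := by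
  simp only [koszul, map_add, LinearMap.add_apply, der_add_left, br_add_left]
  ring

theorem koszul_add_middle (X Y Y' Z : CVF I M) : koszul g P P' Q Q' X (Y + Y') Z =
    koszul g P P' Q Q' X Y Z + koszul g P P' Q Q' X Y' Z := by
  simp only [koszul, map_add, LinearMap.add_apply, der_add_right, br_add_right]
  ring

theorem koszul_add_right (X Y Z Z' : CVF I M) : koszul g P P' Q Q' X Y (Z + Z') =
    koszul g P P' Q Q' X Y Z + koszul g P P' Q Q' X Y Z' := by
  simp only [koszul, map_add, LinearMap.add_apply, der_add_right, br_add_right]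
  ring

/-- A bracket is not tensorial in its first argument: the defects are multiples of `g(P Y, Q X)` and
`g(Q' X, P' Z)`, which the hypotheses remove. -/
theorem koszul_smul_left (h : ∀ X Y, G g (P Y) (Q X) = 0) (h' : ∀ X Z, G g (Q' X) (P' Z) = 0)
    (f : CFun I M) (X Y Z : CVF I M) :
    koszul g P P' Q Q' (f • X) Y Z = f * koszul g P P' Q Q' X Y Z := by
  simp only [koszul, map_smul, map_sub, map_add, LinearMap.sub_apply, LinearMap.add_apply,
    LinearMap.smul_apply, der_smul_left, br_smul_left, h, h', smul_eq_mul]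
  ring

theorem koszul_smul_middle (f : CFun I M) (X Y Z : CVF I M) :
    koszul g P P' Q Q' X (f • Y) Z = f * koszul g P P' Q Q' X Y Z +
      (der (Q X) f + der (Q' X) f) * G g (P Y) (P' Z) := by
  simp only [koszul, map_smul, map_add, LinearMap.add_apply,
    LinearMap.smul_apply, der_mul, br_smul_right, smul_eq_mul]
  ring

/-- The derivatives of `f` along `Q X` in the first two terms cancel. -/
theorem koszul_smul_right (f : CFun I M) (X Y Z : CVF I M) :
    koszul g P P' Q Q' X Y (f • Z) = f * koszul g P P' Q Q' X Y Z := by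
  simp only [koszul, map_smul, map_add, der_mul, br_smul_right, smul_eq_mul]
  ring

/-- Exchanging the roles of bracket and metric dual makes all bracket terms cancel. With `Q + Q' =
id` this is metricity. -/
theorem koszul_add_swap (X Y Z : CVF I M) :
    koszul g P P' Q Q' X Y Z + koszul g P' P Q' Q X Z Y =
      der (Q X + Q' X) (G g (P Y) (P' Z)) := by
  simp only [koszul, der_add_left]
  rw [G_symm g (P' Z) (P Y), G_symm g (P' Z) (br (Q' X) (P Y)),
    G_symm g (br (Q X) (P' Z)) (P Y)]
  ring

/-- On a section of one summand only one of the four forms survives, so the connection preserves the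
summands. -/
theorem koszul_of_middle_eq_zero {Y : CVF I M} (hY : P Y = 0) (X Z : CVF I M) :
    koszul g P P' Q Q' X Y Z = 0 := by
  have : br (Q' X) (0 : CVF I M) = 0 := by simpa using br_add_right (Q' X) 0 0
  simp [koszul, hY, der_zero, this]

theorem koszul_conj {R R' S S' : CVF I M →ₗ[CFun I M] CVF I M}
    (hP : ∀ X, P (CVF.conj X) = CVF.conj (R X)) (hP' : ∀ X, P' (CVF.conj X) = CVF.conj (R' X))
    (hQ : ∀ X, Q (CVF.conj X) = CVF.conj (S X)) (hQ' : ∀ X, Q' (CVF.conj X) = CVF.conj (S' X))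
    (X Y Z : CVF I M) : koszul g P P' Q Q' (CVF.conj X) (CVF.conj Y) (CVF.conj Z) =
      (koszul g R R' S S' X Y Z).conj := by
  simp only [koszul, hP, hP', hQ, hQ', G_conj, br_conj, der_conj]
  ext x
  show starRingEnd ℂ _ - starRingEnd ℂ _ + starRingEnd ℂ _ = starRingEnd ℂ (_ - _ + _)
  simp

end Koszul

omit [FiniteDimensional ℝ E] [CompleteSpace E] in
theorem der_const (X : CVF I M) (c : ℂ) : der X (ContMDiffMap.const c : CFun I M) = 0 := by
  ext x
  have : mvfderiv I (fun _ : M => c) x = 0 := mvfderiv_const c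
  show cderiv X.1 (fun _ : M => c) x = 0
  simp [cderiv, this]

variable (I M) in
/-- The constant function `1 / 2`. -/
def half : CFun I M := ContMDiffMap.const (1 / 2)

omit [FiniteDimensional ℝ E] [CompleteSpace E] [IsManifold I ∞ M] in
theorem half_add_half : half I M + half I M = 1 := by
  ext x
  show (1 / 2 + 1 / 2 : ℂ) = 1
  norm_num

omit [FiniteDimensional ℝ E] [CompleteSpace E] [IsManifold I ∞ M] in
theorem half_conj : (half I M).conj = half I M := by
  ext x
  show starRingEnd ℂ (1 / 2 : ℂ) = 1 / 2
  rw [map_div₀, map_one, map_ofNat]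

namespace OpticalPairing

variable {g : LorentzMetric I M} {m : ℕ} {𝒩 : AlmostRobinsonStructure g m} {ℛ : DualNullBundle 𝒩}
  (p : OpticalPairing ℛ)

@[simp] theorem conj_ν : CVF.conj p.ν = p.ν := CVF.ext' p.conjT_ν

@[simp] theorem conj_νs : CVF.conj p.νs = p.νs := CVF.ext' p.conjT_νs

/-- The component in `R^ℂ`. -/
def prν : CVF I M →ₗ[CFun I M] CVF I M := (G g p.νs).smulRight p.ν

/-- The component in `(R^*)^ℂ`. -/
def prνs : CVF I M →ₗ[CFun I M] CVF I M := (G g p.ν).smulRight p.νs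

theorem prν_apply (X : CVF I M) : p.prν X = G g p.νs X • p.ν := rfl

theorem prνs_apply (X : CVF I M) : p.prνs X = G g p.ν X • p.νs := rfl

@[simp] theorem G_ν_νs : G g p.ν p.νs = 1 := by ext x; exact p.cform_ν_νs x

@[simp] theorem G_νs_ν : G g p.νs p.ν = 1 := by ext x; exact p.cform_νs_ν x

@[simp] theorem G_ν_ν : G g p.ν p.ν = 0 := by ext x; exact p.cform_ν_ν x

@[simp] theorem G_νs_νs : G g p.νs p.νs = 0 := by ext x; exact p.cform_νs_νs x

theorem smul_conj (f : CFun I M) (X : CVF I M) : CVF.conj (f • X) = f.conj • CVF.conj X :=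
  CVF.ext' fun x => LinearMap.map_smulₛₗ conjT (f x) (X.1 x)

theorem add_conj (X Y : CVF I M) : CVF.conj (X + Y) = CVF.conj X + CVF.conj Y :=
  CVF.ext' fun x => map_add conjT (X.1 x) (Y.1 x)

theorem prν_conj (X : CVF I M) : p.prν (CVF.conj X) = CVF.conj (p.prν X) := by
  have := G_conj g p.νs X
  rw [conj_νs] at this
  rw [prν_apply, prν_apply, smul_conj, this, conj_ν]

theorem prνs_conj (X : CVF I M) : p.prνs (CVF.conj X) = CVF.conj (p.prνs X) := by
  have := G_conj g p.ν X
  rw [conj_ν] at this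
  rw [prνs_apply, prνs_apply, smul_conj, this, conj_νs]

variable [T2Space M]

theorem pr01_conj (X : CVF I M) : p.pr01 (CVF.conj X) = CVF.conj (p.pr10 X) :=
  CVF.ext' fun x => by simp [pr01_apply, pr10_apply, P01_eq]

theorem pr10_conj (X : CVF I M) : p.pr10 (CVF.conj X) = CVF.conj (p.pr01 X) :=
  CVF.ext' fun x => by simp [pr01_apply, pr10_apply, P01_eq]

@[simp] theorem pr10_ν : p.pr10 p.ν = 0 := CVF.ext' fun x => p.P10_ν x

@[simp] theorem pr10_νs : p.pr10 p.νs = 0 := CVF.ext' fun x => p.P10_νs x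

@[simp] theorem pr01_ν : p.pr01 p.ν = 0 := CVF.ext' fun x => p.P01_ν x

@[simp] theorem pr01_νs : p.pr01 p.νs = 0 := CVF.ext' fun x => p.P01_νs x

@[simp] theorem pr10_pr10 (X : CVF I M) : p.pr10 (p.pr10 X) = p.pr10 X :=
  CVF.ext' fun _ => P10_of_mem (P10_mem _)

@[simp] theorem pr01_pr01 (X : CVF I M) : p.pr01 (p.pr01 X) = p.pr01 X :=
  CVF.ext' fun _ => p.P01_of_mem (p.P01_mem _)

@[simp] theorem pr10_pr01 (X : CVF I M) : p.pr10 (p.pr01 X) = 0 :=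
  CVF.ext' fun _ => P10_of_mem_S01 (p.P01_mem _)

@[simp] theorem pr01_pr10 (X : CVF I M) : p.pr01 (p.pr10 X) = 0 :=
  CVF.ext' fun _ => p.P01_of_mem_S10 (P10_mem _)

@[simp] theorem G_ν_pr10 (X : CVF I M) : G g p.ν (p.pr10 X) = 0 := by
  ext x; exact p.cform_ν_S10 (P10_mem _)

@[simp] theorem G_νs_pr10 (X : CVF I M) : G g p.νs (p.pr10 X) = 0 := by
  ext x; exact p.cform_νs_S10 (P10_mem _)

@[simp] theorem G_ν_pr01 (X : CVF I M) : G g p.ν (p.pr01 X) = 0 := by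
  ext x; exact p.cform_ν_S01 (p.P01_mem _)

@[simp] theorem G_νs_pr01 (X : CVF I M) : G g p.νs (p.pr01 X) = 0 := by
  ext x; exact p.cform_νs_S01 (p.P01_mem _)

@[simp] theorem G_pr10_ν (X : CVF I M) : G g (p.pr10 X) p.ν = 0 := by rw [G_symm, G_ν_pr10]

@[simp] theorem G_pr10_νs (X : CVF I M) : G g (p.pr10 X) p.νs = 0 := by rw [G_symm, G_νs_pr10]

@[simp] theorem G_pr01_ν (X : CVF I M) : G g (p.pr01 X) p.ν = 0 := by rw [G_symm, G_ν_pr01]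

@[simp] theorem G_pr01_νs (X : CVF I M) : G g (p.pr01 X) p.νs = 0 := by rw [G_symm, G_νs_pr01]

@[simp] theorem G_pr10_pr10 (X Y : CVF I M) : G g (p.pr10 X) (p.pr10 Y) = 0 := by
  ext x; exact cform_S10_S10 (P10_mem _) (P10_mem _)

@[simp] theorem G_pr01_pr01 (X Y : CVF I M) : G g (p.pr01 X) (p.pr01 Y) = 0 := by
  ext x; exact p.cform_S01_S01 (p.P01_mem _) (p.P01_mem _)

theorem decomp_field' (X : CVF I M) : p.pr10 X + p.pr01 X + p.prν X + p.prνs X = X :=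
  p.decomp_field X

theorem G_pr10_left (X Y : CVF I M) : G g (p.pr10 X) Y = G g X (p.pr01 Y) := by
  ext x
  exact (p.cform_P10_left _ _).trans (p.cform_P01_right _ _).symm

theorem G_pr01_left (X Y : CVF I M) : G g (p.pr01 X) Y = G g X (p.pr10 Y) := by
  rw [G_symm, ← G_pr10_left, G_symm]

theorem G_prν_left (X Y : CVF I M) : G g (p.prν X) Y = G g X (p.prνs Y) := by
  rw [prν_apply, prνs_apply, map_smul, map_smul, LinearMap.smul_apply, G_symm g X, smul_eq_mul,
    smul_eq_mul, mul_comm]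

theorem G_prνs_left (X Y : CVF I M) : G g (p.prνs X) Y = G g X (p.prν Y) := by
  rw [G_symm, ← G_prν_left, G_symm]

/-- Each summand pairs nontrivially with its dual only: `S^{1,0}` with `S^{0,1}`, and `R` with
`R^*`. -/
theorem G_decomp (Y Z : CVF I M) : G g (p.pr10 Y) (p.pr01 Z) + G g (p.pr01 Y) (p.pr10 Z) +
    G g (p.prν Y) (p.prνs Z) + G g (p.prνs Y) (p.prν Z) = G g Y Z := by
  conv_rhs => rw [← p.decomp_field' Y, ← p.decomp_field' Z]
  simp [prν_apply, prνs_apply]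
  ring

/-- The directions in which the connection differentiates `S^{1,0}` by the metric. -/
def dirS : CVF I M →ₗ[CFun I M] CVF I M := p.pr10 + half I M • (p.prν + p.prνs)

/-- The directions in which the connection differentiates `S^{0,1}` by the metric. -/
def dirSbar : CVF I M →ₗ[CFun I M] CVF I M := p.pr01 + half I M • (p.prν + p.prνs)

/-- The directions in which the connection differentiates `R` by the metric. -/
def dirR : CVF I M →ₗ[CFun I M] CVF I M := half I M • (p.pr10 + p.pr01) + p.prν

/-- The directions in which the connection differentiates `R^*` by the metric. -/
def dirRs : CVF I M →ₗ[CFun I M] CVF I M := half I M • (p.pr10 + p.pr01) + p.prνs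

theorem dirS_add_dirSbar (X : CVF I M) : p.dirS X + p.dirSbar X = X := by
  conv_rhs => rw [← p.decomp_field' X]
  simp only [dirS, dirSbar, LinearMap.add_apply, LinearMap.smul_apply]
  rw [add_add_add_comm, ← add_smul, half_add_half, one_smul, add_assoc _ (p.prν X)]

theorem dirR_add_dirRs (X : CVF I M) : p.dirR X + p.dirRs X = X := by
  conv_rhs => rw [← p.decomp_field' X]
  simp only [dirR, dirRs, LinearMap.add_apply, LinearMap.smul_apply]
  rw [add_add_add_comm, ← add_smul, half_add_half, one_smul, add_assoc _ (p.prν X)]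

/-- The linear form `Z ↦ g(∇_X Y, Z)`. -/
def connForm (X Y : CVF I M) : CVF I M →ₗ[CFun I M] CFun I M where
  toFun Z := koszul g p.pr10 p.pr01 p.dirS p.dirSbar X Y Z +
    koszul g p.pr01 p.pr10 p.dirSbar p.dirS X Y Z +
    koszul g p.prν p.prνs p.dirR p.dirRs X Y Z + koszul g p.prνs p.prν p.dirRs p.dirR X Y Z
  map_add' Z Z' := by simp only [koszul_add_right]; ring
  map_smul' f Z := by simp only [koszul_smul_right, RingHom.id_apply, smul_eq_mul]; ring

/-- The value `∇_X Y` of the Chern-Robinson connection. -/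
def conn (X Y : CVF I M) : CVF I M := (p.exists_rep (p.connForm X Y)).choose

theorem G_conn (X Y Z : CVF I M) : G g (p.conn X Y) Z =
    koszul g p.pr10 p.pr01 p.dirS p.dirSbar X Y Z +
    koszul g p.pr01 p.pr10 p.dirSbar p.dirS X Y Z +
    koszul g p.prν p.prνs p.dirR p.dirRs X Y Z + koszul g p.prνs p.prν p.dirRs p.dirR X Y Z :=
  (p.exists_rep (p.connForm X Y)).choose_spec Z

theorem conn_add_left (X X' Y : CVF I M) : p.conn (X + X') Y = p.conn X Y + p.conn X' Y := by
  apply p.ext_G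
  intro Z
  simp only [map_add, LinearMap.add_apply, G_conn, koszul_add_left]
  ring

theorem conn_add_right (X Y Y' : CVF I M) : p.conn X (Y + Y') = p.conn X Y + p.conn X Y' := by
  apply p.ext_G
  intro Z
  simp only [map_add, LinearMap.add_apply, G_conn, koszul_add_middle]
  ring

theorem conn_smul_left (f : CFun I M) (X Y : CVF I M) : p.conn (f • X) Y = f • p.conn X Y := by
  apply p.ext_G
  intro Z
  rw [map_smul, LinearMap.smul_apply, G_conn, G_conn]
  rw [koszul_smul_left, koszul_smul_left, koszul_smul_left, koszul_smul_left, smul_eq_mul]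
  · ring
  -- These are the orthogonality hypotheses of `koszul_smul_left`. They hold because `dirS` has no
  -- component in `S^{0,1}`, `dirR` none in `R^*`, and conversely for `dirSbar` and `dirRs`.
  all_goals
    intro X Y
    simp [dirS, dirSbar, dirR, dirRs, prν_apply, prνs_apply]

theorem conn_leibniz (f : CFun I M) (X Y : CVF I M) :
    p.conn X (f • Y) = der X f • Y + f • p.conn X Y := by
  apply p.ext_G
  intro Z
  have h1 := congrArg (fun W => der W f) (p.dirS_add_dirSbar X)
  have h2 := congrArg (fun W => der W f) (p.dirR_add_dirRs X)
  simp only [der_add_left] at h1 h2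
  simp only [map_add, map_smul, LinearMap.add_apply, LinearMap.smul_apply, G_conn,
    koszul_smul_middle, smul_eq_mul]
  -- In each form the derivatives of `f` along the two directions add up to `X f`; the remaining
  -- factors sum to `g(Y, Z)`.
  linear_combination (der X f) * p.G_decomp Y Z + h1 * (G g (p.pr10 Y) (p.pr01 Z) +
    G g (p.pr01 Y) (p.pr10 Z)) + h2 * (G g (p.prν Y) (p.prνs Z) + G g (p.prνs Y) (p.prν Z))

theorem conn_metric (X Y Z : CVF I M) :
    der X (G g Y Z) = G g (p.conn X Y) Z + G g Y (p.conn X Z) := by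
  rw [G_symm g Y (p.conn X Z), G_conn, G_conn]
  -- Each form in `(Y, Z)` is matched with the form of the dual summand in `(Z, Y)`.
  have h1 := koszul_add_swap (g := g) (P := p.pr10) (P' := p.pr01) (Q := p.dirS)
    (Q' := p.dirSbar) X Y Z
  have h2 := koszul_add_swap (g := g) (P := p.pr01) (P' := p.pr10) (Q := p.dirSbar)
    (Q' := p.dirS) X Y Z
  have h3 := koszul_add_swap (g := g) (P := p.prν) (P' := p.prνs) (Q := p.dirR)
    (Q' := p.dirRs) X Y Z
  have h4 := koszul_add_swap (g := g) (P := p.prνs) (P' := p.prν) (Q := p.dirRs)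
    (Q' := p.dirR) X Y Z
  rw [dirS_add_dirSbar] at h1
  rw [add_comm (p.dirSbar X), dirS_add_dirSbar] at h2
  rw [dirR_add_dirRs] at h3
  rw [add_comm (p.dirRs X), dirR_add_dirRs] at h4
  have h5 := congrArg (der X) (p.G_decomp Y Z)
  simp only [der_add_right] at h5
  linear_combination -h1 - h2 - h3 - h4 - h5

/-- Conjugation exchanges the forms of `S^{1,0}` and `S^{0,1}` and fixes those of `R` and `R^*`. The
conjugate clauses of the torsion follow from this. -/
theorem conn_conj (X Y : CVF I M) :
    p.conn (CVF.conj X) (CVF.conj Y) = CVF.conj (p.conn X Y) := by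
  apply p.ext_G
  intro Z
  obtain ⟨Z, rfl⟩ : ∃ Z', Z = CVF.conj Z' := ⟨CVF.conj Z, (CVF.conj_conj Z).symm⟩
  have hS : ∀ X, p.dirS (CVF.conj X) = CVF.conj (p.dirSbar X) := fun X => by
    simp [dirS, dirSbar, pr10_conj, prν_conj, prνs_conj, add_conj, smul_conj, half_conj]
  have hS' : ∀ X, p.dirSbar (CVF.conj X) = CVF.conj (p.dirS X) := fun X => by
    simp [dirS, dirSbar, pr01_conj, prν_conj, prνs_conj, add_conj, smul_conj, half_conj]
  have hR : ∀ X, p.dirR (CVF.conj X) = CVF.conj (p.dirR X) := fun X => by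
    simp [dirR, pr10_conj, pr01_conj, prν_conj, add_conj, smul_conj, half_conj,
      add_comm]
  have hR' : ∀ X, p.dirRs (CVF.conj X) = CVF.conj (p.dirRs X) := fun X => by
    simp [dirRs, pr10_conj, pr01_conj, prνs_conj, add_conj, smul_conj, half_conj,
      add_comm]
  rw [G_conj, G_conn, G_conn, koszul_conj p.pr10_conj p.pr01_conj hS hS',
    koszul_conj p.pr01_conj p.pr10_conj hS' hS, koszul_conj p.prν_conj p.prνs_conj hR hR',
    koszul_conj p.prνs_conj p.prν_conj hR' hR]
  ext x
  show starRingEnd ℂ _ + starRingEnd ℂ _ + starRingEnd ℂ _ + starRingEnd ℂ _ =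
    starRingEnd ℂ (_ + _ + _ + _)
  simp only [map_add]
  ring

end OpticalPairing

end Connection

/-! ### Torsion of the constructed connection -/

section Torsion

variable {E : Type*} [NormedAddCommGroup E] [NormedSpace ℝ E] [FiniteDimensional ℝ E]
  [CompleteSpace E]
  {H : Type*} [TopologicalSpace H] {I : ModelWithCorners ℝ E H}
  {M : Type*} [TopologicalSpace M] [ChartedSpace H M] [IsManifold I ∞ M]

@[simp] theorem br_zero_left (X : CVF I M) : br 0 X = 0 := by
  simpa using br_add_left 0 0 X

@[simp] theorem der_half (X : CVF I M) : der X (half I M) = 0 := der_const X _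

theorem der_zero_left (f : CFun I M) : der (0 : CVF I M) f = 0 := by
  simpa using der_add_left (0 : CVF I M) 0 f

/-- This and the next two definitional equalities turn pointwise torsion clauses into identities
between smooth functions. -/
theorem lie2_eq (g : LorentzMetric I M) (X Y Z : CVF I M) (x : M) :
    lie2 X.1 g.cform Y.1 Z.1 x =
      (der X (G g Y Z) - G g (br X Y) Z - G g Y (br X Z) : CFun I M) x := rfl

theorem lie1_flat_eq (g : LorentzMetric I M) (W X Y : CVF I M) (x : M) :
    lie1 X.1 (g.flat W.1) Y.1 x = (der X (G g W Y) - G g W (br X Y) : CFun I M) x := rfl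

theorem d1_flat_eq (g : LorentzMetric I M) (W X Y : CVF I M) (x : M) :
    d1 (g.flat W.1) X.1 Y.1 x =
      (der X (G g W Y) - der Y (G g W X) - G g W (br X Y) : CFun I M) x := rfl

theorem half_mul_apply (f : CFun I M) (x : M) : (half I M * f) x = (1 / 2 : ℂ) * f x := rfl

namespace OpticalPairing

variable {g : LorentzMetric I M} {m : ℕ} {𝒩 : AlmostRobinsonStructure g m} {ℛ : DualNullBundle 𝒩}
  (p : OpticalPairing ℛ)

@[simp] theorem prν_ν : p.prν p.ν = p.ν := by simp [prν_apply]
@[simp] theorem prν_νs : p.prν p.νs = 0 := by simp [prν_apply]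
@[simp] theorem prνs_ν : p.prνs p.ν = 0 := by simp [prνs_apply]
@[simp] theorem prνs_νs : p.prνs p.νs = p.νs := by simp [prνs_apply]

variable [T2Space M]

@[simp] theorem prν_pr10 (X : CVF I M) : p.prν (p.pr10 X) = 0 := by simp [prν_apply]
@[simp] theorem prν_pr01 (X : CVF I M) : p.prν (p.pr01 X) = 0 := by simp [prν_apply]
@[simp] theorem prνs_pr10 (X : CVF I M) : p.prνs (p.pr10 X) = 0 := by simp [prνs_apply]
@[simp] theorem prνs_pr01 (X : CVF I M) : p.prνs (p.pr01 X) = 0 := by simp [prνs_apply]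

/-- Replacing `X` by `p.pr10 X` encodes the hypothesis in the term itself, where the simp lemmas for
the projections can use it. -/
theorem isSectionOf_S10 {X : CVF I M} : IsSectionOf X ℛ.S10 ↔ p.pr10 X = X :=
  ⟨fun h => CVF.ext' fun x => P10_of_mem (h x), fun h x => by rw [← h]; exact P10_mem _⟩

theorem isSectionOf_S01 {X : CVF I M} : IsSectionOf X ℛ.S01 ↔ p.pr01 X = X :=
  ⟨fun h => CVF.ext' fun x => p.P01_of_mem (h x), fun h x => by rw [← h]; exact p.P01_mem _⟩

theorem isSectionOf_RC {X : CVF I M} : IsSectionOf X ℛ.RC ↔ p.prν X = X := by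
  refine ⟨fun h => CVF.ext' fun x => ?_, fun h x => ?_⟩
  · obtain ⟨a, ha⟩ := p.mem_RC.1 (h x)
    show g.cform x (p.νs.1 x) (X.1 x) • p.ν.1 x = X.1 x
    rw [← ha, map_smul, cform_νs_ν, smul_eq_mul, mul_one]
  · rw [← h]
    exact p.mem_RC.2 ⟨_, rfl⟩

theorem isSectionOf_RsC {X : CVF I M} : IsSectionOf X ℛ.RsC ↔ p.prνs X = X := by
  refine ⟨fun h => CVF.ext' fun x => ?_, fun h x => ?_⟩
  · obtain ⟨a, ha⟩ := p.mem_RsC.1 (h x)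
    show g.cform x (p.ν.1 x) (X.1 x) • p.νs.1 x = X.1 x
    rw [← ha, map_smul, cform_ν_νs, smul_eq_mul, mul_one]
  · rw [← h]
    exact p.mem_RsC.2 ⟨_, rfl⟩

include p in
theorem isSectionOf_conj {X : CVF I M} (h : IsSectionOf X ℛ.S01) :
    IsSectionOf (CVF.conj X) ℛ.S10 := fun x => p.conjT_mem_S10.2 (h x)

@[simp] theorem dirS_pr10 (X : CVF I M) : p.dirS (p.pr10 X) = p.pr10 X := by simp [dirS]
@[simp] theorem dirS_pr01 (X : CVF I M) : p.dirS (p.pr01 X) = 0 := by simp [dirS]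
@[simp] theorem dirS_ν : p.dirS p.ν = half I M • p.ν := by simp [dirS]
@[simp] theorem dirS_νs : p.dirS p.νs = half I M • p.νs := by simp [dirS]
@[simp] theorem dirSbar_pr10 (X : CVF I M) : p.dirSbar (p.pr10 X) = 0 := by simp [dirSbar]
@[simp] theorem dirSbar_pr01 (X : CVF I M) : p.dirSbar (p.pr01 X) = p.pr01 X := by simp [dirSbar]
@[simp] theorem dirSbar_ν : p.dirSbar p.ν = half I M • p.ν := by simp [dirSbar]
@[simp] theorem dirSbar_νs : p.dirSbar p.νs = half I M • p.νs := by simp [dirSbar]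
@[simp] theorem dirR_pr10 (X : CVF I M) : p.dirR (p.pr10 X) = half I M • p.pr10 X := by
  simp [dirR]
@[simp] theorem dirR_ν : p.dirR p.ν = p.ν := by simp [dirR]
@[simp] theorem dirR_νs : p.dirR p.νs = 0 := by simp [dirR]
@[simp] theorem dirRs_pr10 (X : CVF I M) : p.dirRs (p.pr10 X) = half I M • p.pr10 X := by
  simp [dirRs]
@[simp] theorem dirRs_ν : p.dirRs p.ν = 0 := by simp [dirRs]
@[simp] theorem dirRs_νs : p.dirRs p.νs = p.νs := by simp [dirRs]

theorem G_conn_pr10 (X Y Z : CVF I M) : G g (p.conn X (p.pr10 Y)) Z =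
    koszul g p.pr10 p.pr01 p.dirS p.dirSbar X (p.pr10 Y) Z := by
  rw [G_conn, koszul_of_middle_eq_zero (p.pr01_pr10 Y), koszul_of_middle_eq_zero (p.prν_pr10 Y),
    koszul_of_middle_eq_zero (p.prνs_pr10 Y)]
  ring

theorem G_conn_pr01 (X Y Z : CVF I M) : G g (p.conn X (p.pr01 Y)) Z =
    koszul g p.pr01 p.pr10 p.dirSbar p.dirS X (p.pr01 Y) Z := by
  rw [G_conn, koszul_of_middle_eq_zero (p.pr10_pr01 Y), koszul_of_middle_eq_zero (p.prν_pr01 Y),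
    koszul_of_middle_eq_zero (p.prνs_pr01 Y)]
  ring

theorem G_conn_prν (X Y Z : CVF I M) (h : p.prν Y = Y) : G g (p.conn X Y) Z =
    koszul g p.prν p.prνs p.dirR p.dirRs X Y Z := by
  rw [G_conn, koszul_of_middle_eq_zero (P := p.pr10), koszul_of_middle_eq_zero (P := p.pr01),
    koszul_of_middle_eq_zero (P := p.prνs)]
  · ring
  all_goals rw [← h, prν_apply]; simp

theorem G_conn_prνs (X Y Z : CVF I M) (h : p.prνs Y = Y) : G g (p.conn X Y) Z =
    koszul g p.prνs p.prν p.dirRs p.dirR X Y Z := by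
  rw [G_conn, koszul_of_middle_eq_zero (P := p.pr10), koszul_of_middle_eq_zero (P := p.pr01),
    koszul_of_middle_eq_zero (P := p.prν)]
  · ring
  all_goals rw [← h, prνs_apply]; simp

/-- The surviving form sees its last argument only through `pr01`, the adjoint of `pr10`. -/
theorem pr10_conn (X Y : CVF I M) : p.pr10 (p.conn X (p.pr10 Y)) = p.conn X (p.pr10 Y) := by
  apply p.ext_G
  intro Z
  rw [G_pr10_left, G_conn_pr10, G_conn_pr10]
  simp [koszul]

theorem pr01_conn (X Y : CVF I M) : p.pr01 (p.conn X (p.pr01 Y)) = p.conn X (p.pr01 Y) := by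
  apply p.ext_G
  intro Z
  rw [G_pr01_left, G_conn_pr01, G_conn_pr01]
  simp [koszul]

theorem prν_conn (X Y : CVF I M) (h : p.prν Y = Y) : p.prν (p.conn X Y) = p.conn X Y := by
  apply p.ext_G
  intro Z
  rw [G_prν_left, p.G_conn_prν _ _ _ h, p.G_conn_prν _ _ _ h]
  have : p.prνs (p.prνs Z) = p.prνs Z := by simp [prνs_apply]
  simp [koszul, this]

theorem prνs_conn (X Y : CVF I M) (h : p.prνs Y = Y) : p.prνs (p.conn X Y) = p.conn X Y := by
  apply p.ext_G
  intro Z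
  rw [G_prνs_left, p.G_conn_prνs _ _ _ h, p.G_conn_prνs _ _ _ h]
  have : p.prν (p.prν Z) = p.prν Z := by simp [prν_apply]
  simp [koszul, this]

/-- `dirS` kills `S^{0,1}`, so only the bracket term remains. -/
theorem conn_anti_hol (X Y : CVF I M) :
    p.conn (p.pr01 Y) (p.pr10 X) = p.pr10 (br (p.pr01 Y) (p.pr10 X)) := by
  apply p.ext_G
  intro Z
  rw [G_conn_pr10, G_pr10_left]
  simp [koszul, der_zero_left]

theorem conn_hol_anti (X Y : CVF I M) :
    p.conn (p.pr10 X) (p.pr01 Y) = p.pr01 (br (p.pr10 X) (p.pr01 Y)) := by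
  apply p.ext_G
  intro Z
  rw [G_conn_pr01, G_pr01_left]
  simp [koszul, der_zero_left]

theorem G_conn_hol_hol (X Y Z : CVF I M) : G g (p.conn (p.pr10 X) (p.pr10 Y)) (p.pr01 Z) =
    der (p.pr10 X) (G g (p.pr10 Y) (p.pr01 Z)) - G g (p.pr10 Y) (br (p.pr10 X) (p.pr01 Z)) := by
  rw [G_conn_pr10]
  simp [koszul]

/-- Along the null directions `dirS` and `dirSbar` are both one half of the identity, whence the
mean. -/
theorem G_conn_null_hol {n : CVF I M} (hn : n = p.ν ∨ n = p.νs) (X Z : CVF I M) :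
    G g (p.conn n (p.pr10 X)) (p.pr01 Z) = half I M * (der n (G g (p.pr10 X) (p.pr01 Z)) -
      G g (p.pr10 X) (br n (p.pr01 Z)) + G g (br n (p.pr10 X)) (p.pr01 Z)) := by
  rw [G_conn_pr10]
  rcases hn with rfl | rfl <;>
  · simp [koszul, der_smul_left, br_smul_left]
    ring

theorem conn_eq_smul_ν (X : CVF I M) : p.conn X p.ν = G g p.νs (p.conn X p.ν) • p.ν :=
  (p.prν_conn X p.ν p.prν_ν).symm

theorem conn_eq_smul_νs (X : CVF I M) : p.conn X p.νs = G g p.ν (p.conn X p.νs) • p.νs :=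
  (p.prνs_conn X p.νs p.prνs_νs).symm

theorem G_conn_hol_ν (X : CVF I M) : G g p.νs (p.conn (p.pr10 X) p.ν) =
    half I M * (G g p.νs (br (p.pr10 X) p.ν) - G g p.ν (br (p.pr10 X) p.νs)) := by
  rw [G_symm, p.G_conn_prν _ _ _ p.prν_ν]
  simp [koszul, br_smul_left, der_one]
  rw [G_symm g p.νs]
  ring

/-- Differentiating the constant `g(ν, ν^*) = 1` forces opposite coefficients. -/
theorem G_conn_hol_νs (X : CVF I M) : G g p.ν (p.conn (p.pr10 X) p.νs) =
    - G g p.νs (p.conn (p.pr10 X) p.ν) := by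
  have := p.conn_metric (p.pr10 X) p.ν p.νs
  rw [G_ν_νs, der_one, G_symm g (p.conn _ _)] at this
  linear_combination -this

theorem conn_ν_νs : p.conn p.ν p.νs = G g p.ν (br p.ν p.νs) • p.νs := by
  rw [conn_eq_smul_νs, G_symm, p.G_conn_prνs _ _ _ p.prνs_νs, G_symm]
  simp [koszul, der_zero_left]

theorem conn_νs_ν : p.conn p.νs p.ν = G g p.νs (br p.νs p.ν) • p.ν := by
  rw [conn_eq_smul_ν, G_symm, p.G_conn_prν _ _ _ p.prν_ν, G_symm]
  simp [koszul, der_zero_left]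

/-- The Chern-Robinson connection. -/
def chernRobinson : CConnection I M where
  toFun := p.conn
  add_left := p.conn_add_left
  smul_left := p.conn_smul_left
  add_right := p.conn_add_right
  leibniz f X Y x := congrArg (fun W : CVF I M => W.1 x) (p.conn_leibniz f X Y)

/-- The torsion of the Chern-Robinson connection, as a smooth vector field. -/
def tor (X Y : CVF I M) : CVF I M := p.conn X Y - p.conn Y X - br X Y

theorem torsion_eq (X Y : CVF I M) (x : M) :
    p.chernRobinson.torsion X Y x = (p.tor X Y).1 x := rfl

theorem tor_conj (X Y : CVF I M) : p.tor (CVF.conj X) (CVF.conj Y) = CVF.conj (p.tor X Y) := by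
  rw [tor, conn_conj, conn_conj, br_conj]
  apply CVF.ext'
  intro x
  simp [tor]

/-- The torsion term `𝒯^{1,0}(X, Y)` for sections of `S^{1,0}`. -/
theorem tor_hol_hol (X Y : CVF I M) : ∃ t : CVF I M, p.pr10 t = t ∧
    (∀ Z, G g t (p.pr01 Z) = der (p.pr10 X) (G g (p.pr01 Z) (p.pr10 Y)) -
      G g (br (p.pr10 X) (p.pr01 Z)) (p.pr10 Y) - G g (p.pr01 Z) (br (p.pr10 X) (p.pr10 Y)) +
      (der (p.pr01 Z) (G g (p.pr10 X) (p.pr10 Y)) - der (p.pr10 Y) (G g (p.pr10 X) (p.pr01 Z)) -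
        G g (p.pr10 X) (br (p.pr01 Z) (p.pr10 Y)))) ∧
    p.tor (p.pr10 X) (p.pr10 Y) = -p.pr01 (br (p.pr10 X) (p.pr10 Y)) +
      (der (p.pr10 X) (G g p.νs (p.pr10 Y)) - der (p.pr10 Y) (G g p.νs (p.pr10 X)) -
        G g p.νs (br (p.pr10 X) (p.pr10 Y))) • p.ν +
      (der (p.pr10 X) (G g p.ν (p.pr10 Y)) - der (p.pr10 Y) (G g p.ν (p.pr10 X)) -
        G g p.ν (br (p.pr10 X) (p.pr10 Y))) • p.νs + t := by
  -- The witness is the (1,0)-part of the torsion; both covariant derivatives already lie in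
  -- `S^{1,0}`.
  refine ⟨p.conn (p.pr10 X) (p.pr10 Y) - p.conn (p.pr10 Y) (p.pr10 X) -
    p.pr10 (br (p.pr10 X) (p.pr10 Y)), ?_, fun Z => ?_, ?_⟩
  · rw [map_sub, map_sub, pr10_conn, pr10_conn, pr10_pr10]
  · rw [map_sub, map_sub, LinearMap.sub_apply, LinearMap.sub_apply, G_conn_hol_hol,
      G_conn_hol_hol, p.G_pr10_left (br _ _), pr01_pr01, G_pr10_pr10, der_zero,
      G_symm g (p.pr01 Z) (p.pr10 Y), G_symm g (br (p.pr10 X) (p.pr01 Z)),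
      G_symm g (p.pr01 Z), br_swap (p.pr10 Y) (p.pr01 Z), map_neg]
    ring
  · have := p.decomp_field (br (p.pr10 X) (p.pr10 Y))
    simp only [G_ν_pr10, G_νs_pr10, der_zero, zero_sub]
    rw [tor]
    nth_rewrite 1 [← this]
    module

theorem tor_hol_anti (X Y : CVF I M) : p.tor (p.pr10 X) (p.pr01 Y) =
      (der (p.pr10 X) (G g p.νs (p.pr01 Y)) - der (p.pr01 Y) (G g p.νs (p.pr10 X)) -
        G g p.νs (br (p.pr10 X) (p.pr01 Y))) • p.ν +
      (der (p.pr10 X) (G g p.ν (p.pr01 Y)) - der (p.pr01 Y) (G g p.ν (p.pr10 X)) -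
        G g p.ν (br (p.pr10 X) (p.pr01 Y))) • p.νs := by
  have := p.decomp_field (br (p.pr10 X) (p.pr01 Y))
  simp only [G_ν_pr10, G_νs_pr10, G_ν_pr01, G_νs_pr01, der_zero, zero_sub]
  rw [tor, conn_hol_anti, conn_anti_hol, br_swap (p.pr10 X) (p.pr01 Y), map_neg]
  nth_rewrite 3 [← this]
  module

/-- The torsion term `𝒯^{1,0}(n, X)` for `n ∈ {ν, ν^*}`. -/
theorem exists_null_hol {n : CVF I M} (hn : n = p.ν ∨ n = p.νs) (X : CVF I M) :
    ∃ t : CVF I M, p.pr10 t = t ∧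
    (∀ Z, G g t (p.pr01 Z) = half I M * (der n (G g (p.pr10 X) (p.pr01 Z)) -
      G g (br n (p.pr10 X)) (p.pr01 Z) - G g (p.pr10 X) (br n (p.pr01 Z)))) ∧
    p.conn n (p.pr10 X) = p.pr10 (br n (p.pr10 X)) + t := by
  refine ⟨p.conn n (p.pr10 X) - p.pr10 (br n (p.pr10 X)), ?_, fun Z => ?_, ?_⟩
  · rw [map_sub, pr10_conn, pr10_pr10]
  · rw [map_sub, LinearMap.sub_apply, p.G_conn_null_hol hn, p.G_pr10_left (br _ _), pr01_pr01]
    linear_combination (G g (br n (p.pr10 X)) (p.pr01 Z)) * half_add_half (I := I) (M := M)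
  · abel

theorem tor_ν_hol (X : CVF I M) : ∃ t : CVF I M, p.pr10 t = t ∧
    (∀ Z, G g t (p.pr01 Z) = half I M * (der p.ν (G g (p.pr10 X) (p.pr01 Z)) -
      G g (br p.ν (p.pr10 X)) (p.pr01 Z) - G g (p.pr10 X) (br p.ν (p.pr01 Z)))) ∧
    p.tor p.ν (p.pr10 X) = -p.pr01 (br p.ν (p.pr10 X)) +
      (der p.ν (G g p.ν (p.pr10 X)) - G g p.ν (br p.ν (p.pr10 X))) • p.νs -
      (half I M * (der (p.pr10 X) (G g p.ν p.νs) - G g (br (p.pr10 X) p.ν) p.νs -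
        G g p.ν (br (p.pr10 X) p.νs))) • p.ν + t := by
  obtain ⟨t, ht, hZ, hc⟩ := p.exists_null_hol (Or.inl rfl) X
  refine ⟨t, ht, hZ, ?_⟩
  have := p.decomp_field (br p.ν (p.pr10 X))
  rw [tor, hc, conn_eq_smul_ν, G_conn_hol_ν, G_ν_pr10, G_ν_νs, der_zero, der_one,
    br_swap p.ν (p.pr10 X), G_symm g _ p.νs, map_neg]
  -- One half of the `ν`-component of the bracket cancels against `∇_X ν`; the other half belongs to
  -- the prescribed term.
  have h2 : G g p.νs (br p.ν (p.pr10 X)) = half I M * G g p.νs (br p.ν (p.pr10 X)) +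
      half I M * G g p.νs (br p.ν (p.pr10 X)) := by
    rw [← add_mul, half_add_half, one_mul]
  rw [h2] at this
  linear_combination (norm := module) this

theorem tor_νs_hol (X : CVF I M) : ∃ t : CVF I M, p.pr10 t = t ∧
    (∀ Z, G g t (p.pr01 Z) = half I M * (der p.νs (G g (p.pr10 X) (p.pr01 Z)) -
      G g (br p.νs (p.pr10 X)) (p.pr01 Z) - G g (p.pr10 X) (br p.νs (p.pr01 Z)))) ∧
    p.tor p.νs (p.pr10 X) = -p.pr01 (br p.νs (p.pr10 X)) +
      (der p.νs (G g p.νs (p.pr10 X)) - G g p.νs (br p.νs (p.pr10 X))) • p.ν -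
      (half I M * (der (p.pr10 X) (G g p.ν p.νs) - G g (br (p.pr10 X) p.ν) p.νs -
        G g p.ν (br (p.pr10 X) p.νs))) • p.νs + t := by
  obtain ⟨t, ht, hZ, hc⟩ := p.exists_null_hol (Or.inr rfl) X
  refine ⟨t, ht, hZ, ?_⟩
  have := p.decomp_field (br p.νs (p.pr10 X))
  rw [tor, hc, conn_eq_smul_νs, G_conn_hol_νs, G_conn_hol_ν, G_νs_pr10, G_ν_νs, der_zero, der_one,
    br_swap p.νs (p.pr10 X), G_symm g _ p.νs, map_neg]
  have h2 : G g p.ν (br p.νs (p.pr10 X)) = half I M * G g p.ν (br p.νs (p.pr10 X)) +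
      half I M * G g p.ν (br p.νs (p.pr10 X)) := by
    rw [← add_mul, half_add_half, one_mul]
  rw [h2] at this
  linear_combination (norm := module) this

theorem tor_ν_νs : p.tor p.ν p.νs = -(br p.ν p.νs - G g p.νs (br p.ν p.νs) • p.ν -
    G g p.ν (br p.ν p.νs) • p.νs) := by
  rw [tor, conn_ν_νs, conn_νs_ν, br_swap p.ν p.νs, map_neg]
  module

theorem isRep_of {φ : CVF I M → M → ℂ} {t : CVF I M} (ht : p.pr10 t = t)
    (h : ∀ Z x, G g t (p.pr01 Z) x = φ (p.pr01 Z) x) : IsRep ℛ φ t := by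
  refine ⟨p.isSectionOf_S10.2 ht, fun Z hZ x => ?_⟩
  have := h Z x
  rw [p.isSectionOf_S01.1 hZ] at this
  exact this

theorem hasChernRobinsonTorsion_chernRobinson :
    p.HasChernRobinsonTorsion p.chernRobinson where
  hol_hol X Y hX hY := by
    rw [← p.isSectionOf_S10.1 hX, ← p.isSectionOf_S10.1 hY]
    obtain ⟨t, ht, hZ, h⟩ := p.tor_hol_hol X Y
    refine ⟨t, p.isRep_of ht fun Z x => ?_, fun x => ?_⟩
    · rw [lie2_eq, d1_flat_eq, hZ]
      rfl
    · rw [torsion_eq, h, σ, σs, d1_flat_eq, d1_flat_eq]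
      rfl
  hol_anti X Y hX hY x := by
    rw [← p.isSectionOf_S10.1 hX, ← p.isSectionOf_S01.1 hY, torsion_eq, tor_hol_anti, σ, σs,
      d1_flat_eq, d1_flat_eq]
    rfl
  nu_hol X hX := by
    rw [← p.isSectionOf_S10.1 hX]
    obtain ⟨t, ht, hZ, h⟩ := p.tor_ν_hol X
    refine ⟨t, p.isRep_of ht fun Z x => ?_, fun x => ?_⟩
    · rw [lie2_eq, hZ, half_mul_apply]
    · rw [torsion_eq, h, σs, lie1_flat_eq, lie2_eq, ← half_mul_apply]
      rfl
  nuS_hol X hX := by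
    rw [← p.isSectionOf_S10.1 hX]
    obtain ⟨t, ht, hZ, h⟩ := p.tor_νs_hol X
    refine ⟨t, p.isRep_of ht fun Z x => ?_, fun x => ?_⟩
    · rw [lie2_eq, hZ, half_mul_apply]
    · rw [torsion_eq, h, σ, lie1_flat_eq, lie2_eq, ← half_mul_apply]
      rfl
  nu_nuS x := by
    rw [torsion_eq, tor_ν_νs]
    rfl
  anti_anti X Y _ _ x := by
    rw [torsion_eq, torsion_eq, tor_conj, CVF.conj_apply]
  nu_anti X _ x := by
    have := p.tor_conj p.ν X
    rw [conj_ν] at this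
    rw [torsion_eq, torsion_eq, this, CVF.conj_apply]
  nuS_anti X _ x := by
    have := p.tor_conj p.νs X
    rw [conj_νs] at this
    rw [torsion_eq, torsion_eq, this, CVF.conj_apply]

theorem isChernRobinson_chernRobinson : p.IsChernRobinson p.chernRobinson where
  metric X Y Z x := congrArg (fun f : CFun I M => f x) (p.conn_metric X Y Z)
  preserves_R X Y hY := p.isSectionOf_RC.2 (p.prν_conn X Y (p.isSectionOf_RC.1 hY))
  preserves_Rs X Y hY := p.isSectionOf_RsC.2 (p.prνs_conn X Y (p.isSectionOf_RsC.1 hY))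
  preserves_S10 X Y hY := p.isSectionOf_S10.2 (by
    have := p.pr10_conn X Y
    rwa [p.isSectionOf_S10.1 hY] at this)
  preserves_S01 X Y hY := p.isSectionOf_S01.2 (by
    have := p.pr01_conn X Y
    rwa [p.isSectionOf_S01.1 hY] at this)
  torsion := p.hasChernRobinsonTorsion_chernRobinson

end OpticalPairing

end Torsion

/-! ### Uniqueness -/

section Uniqueness

variable {E : Type*} [NormedAddCommGroup E] [NormedSpace ℝ E] [FiniteDimensional ℝ E]
  [CompleteSpace E]
  {H : Type*} [TopologicalSpace H] {I : ModelWithCorners ℝ E H}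
  {M : Type*} [TopologicalSpace M] [ChartedSpace H M] [IsManifold I ∞ M]

/-- The difference of two connections is a tensor. -/
def CConnection.diff (D D' : CConnection I M) : CVF I M →ₗ[CFun I M] CVF I M →ₗ[CFun I M] CVF I M :=
  LinearMap.mk₂ (CFun I M) (fun X Y => D.toFun X Y - D'.toFun X Y)
    (fun X X' Y => by rw [D.add_left, D'.add_left]; abel)
    (fun f X Y => by rw [← fsmul_eq, D.smul_left, D'.smul_left, fsmul_eq, fsmul_eq, smul_sub])
    (fun X Y Y' => by rw [D.add_right, D'.add_right]; abel)
    (fun f X Y => CVF.ext' fun x => by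
      have h := D.leibniz f X Y x
      have h' := D'.leibniz f X Y x
      rw [fsmul_eq] at h h'
      rw [CVF.sub_apply, CVF.smul_apply, CVF.sub_apply, h, h', smul_sub]
      abel)

theorem CConnection.diff_apply (D D' : CConnection I M) (X Y : CVF I M) :
    D.diff D' X Y = D.toFun X Y - D'.toFun X Y := rfl

/-- The bracket is common to both torsions and drops out. -/
theorem CConnection.diff_symm {D D' : CConnection I M} {X Y : CVF I M}
    (h : ∀ x, D.torsion X Y x = D'.torsion X Y x) : D.diff D' X Y = D.diff D' Y X := by
  apply CVF.ext'
  intro x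
  have := h x
  simp only [CConnection.torsion, sub_left_inj] at this
  rw [diff_apply, diff_apply, CVF.sub_apply, CVF.sub_apply, sub_eq_sub_iff_sub_eq_sub]
  exact this

namespace OpticalPairing

variable {g : LorentzMetric I M} {m : ℕ} {𝒩 : AlmostRobinsonStructure g m} {ℛ : DualNullBundle 𝒩}
  (p : OpticalPairing ℛ) [T2Space M]

/-- The four projections of the Witt decomposition. -/
def pr : Fin 4 → CVF I M →ₗ[CFun I M] CVF I M := ![p.pr10, p.pr01, p.prν, p.prνs]

theorem pr_pr_self (i : Fin 4) (X : CVF I M) : p.pr i (p.pr i X) = p.pr i X := by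
  fin_cases i
  · exact p.pr10_pr10 X
  · exact p.pr01_pr01 X
  · simp [pr, prν_apply]
  · simp [pr, prνs_apply]

theorem pr_pr_of_ne {i j : Fin 4} (h : i ≠ j) (X : CVF I M) : p.pr i (p.pr j X) = 0 := by
  fin_cases i <;> fin_cases j <;> first | exact absurd rfl h | simp [pr, prν_apply, prνs_apply]

theorem sum_pr (X : CVF I M) : ∑ i, p.pr i X = X := by
  rw [Fin.sum_univ_four]
  exact p.decomp_field' X

/-- That the dual summand differs from the given one reflects that every summand is null. -/
theorem exists_dual (i : Fin 4) :
    ∃ j, j ≠ i ∧ ∀ X Y, G g (p.pr i X) Y = G g X (p.pr j Y) := by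
  fin_cases i
  · exact ⟨1, by decide, p.G_pr10_left⟩
  · exact ⟨0, by decide, p.G_pr01_left⟩
  · exact ⟨3, by decide, p.G_prν_left⟩
  · exact ⟨2, by decide, p.G_prνs_left⟩

/-- A skew tensor that is symmetric and preserves the Witt decomposition vanishes. -/
theorem eq_zero_of_symm (A : CVF I M →ₗ[CFun I M] CVF I M →ₗ[CFun I M] CVF I M)
    (hskew : ∀ X Y Z, G g (A X Y) Z + G g Y (A X Z) = 0)
    (hpr : ∀ i X Y, p.pr i (A X (p.pr i Y)) = A X (p.pr i Y))
    (hsymm : ∀ i j X Y, A (p.pr i X) (p.pr j Y) = A (p.pr j Y) (p.pr i X)) (X Y : CVF I M) :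
    A X Y = 0 := by
  -- By preservation the value lies in summand `j`, and by symmetry also in summand `i`.
  have hne : ∀ i j, i ≠ j → ∀ X Y, A (p.pr i X) (p.pr j Y) = 0 := by
    intro i j hij X Y
    rw [← hpr, hsymm, ← hpr, pr_pr_of_ne p hij.symm]
  have h : ∀ i j X Y, A (p.pr i X) (p.pr j Y) = 0 := by
    intro i j X Y
    by_cases hij : i = j
    · subst hij
      apply p.ext_G
      intro Z
      -- The value lies in summand `i`, so only pairings with the dual summand `k ≠ i` matter;
      -- skewness reduces them to the mixed case.
      obtain ⟨k, hk, hd⟩ := p.exists_dual i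
      rw [← hpr, hd]
      have := hskew (p.pr i X) (p.pr i Y) (p.pr k Z)
      rw [hne i k hk.symm, map_zero, add_zero] at this
      rw [this, map_zero, LinearMap.zero_apply]
    · exact hne i j hij X Y
  rw [← p.sum_pr X, ← p.sum_pr Y]
  simp only [map_sum, LinearMap.sum_apply, h, Finset.sum_const_zero]

-- The torsion clauses only assert that some `t` exists. Since a section of `S^{1,0}` is determined
-- by its pairings with `S^{0,1}`, any two connections share the same `t`.
include p in
theorem isRep_unique {φ : CVF I M → M → ℂ} {t t' : CVF I M} (h : IsRep ℛ φ t)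
    (h' : IsRep ℛ φ t') : t = t' := by
  apply p.ext_G
  intro Z
  rw [← p.isSectionOf_S10.1 h.1, ← p.isSectionOf_S10.1 h'.1, G_pr10_left, G_pr10_left]
  have hs : IsSectionOf (p.pr01 Z) ℛ.S01 := p.isSectionOf_S01.2 (p.pr01_pr01 Z)
  ext x
  exact (h.2 _ hs x).trans (h'.2 _ hs x).symm

theorem isSectionOf_pr10 (X : CVF I M) : IsSectionOf (p.pr10 X) ℛ.S10 :=
  p.isSectionOf_S10.2 (p.pr10_pr10 X)

theorem isSectionOf_pr01 (X : CVF I M) : IsSectionOf (p.pr01 X) ℛ.S01 :=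
  p.isSectionOf_S01.2 (p.pr01_pr01 X)

theorem exists_conj_pr01 (X : CVF I M) :
    ∃ X', IsSectionOf X' ℛ.S10 ∧ p.pr01 X = CVF.conj X' :=
  ⟨CVF.conj (p.pr01 X), p.isSectionOf_conj (p.isSectionOf_pr01 X), (CVF.conj_conj _).symm⟩

section Torsion

variable {p} {D D' : CConnection I M} (h : p.HasChernRobinsonTorsion D)
  (h' : p.HasChernRobinsonTorsion D')

include h h'

theorem torsion_hol_hol {X Y : CVF I M} (hX : IsSectionOf X ℛ.S10) (hY : IsSectionOf Y ℛ.S10)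
    (x : M) : D.torsion X Y x = D'.torsion X Y x := by
  obtain ⟨t, ht, e⟩ := h.hol_hol X Y hX hY
  obtain ⟨t', ht', e'⟩ := h'.hol_hol X Y hX hY
  rw [e, e', p.isRep_unique ht ht']

theorem torsion_ν_hol {X : CVF I M} (hX : IsSectionOf X ℛ.S10) (x : M) :
    D.torsion p.ν X x = D'.torsion p.ν X x := by
  obtain ⟨t, ht, e⟩ := h.nu_hol X hX
  obtain ⟨t', ht', e'⟩ := h'.nu_hol X hX
  rw [e, e', p.isRep_unique ht ht']

theorem torsion_νs_hol {X : CVF I M} (hX : IsSectionOf X ℛ.S10) (x : M) :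
    D.torsion p.νs X x = D'.torsion p.νs X x := by
  obtain ⟨t, ht, e⟩ := h.nuS_hol X hX
  obtain ⟨t', ht', e'⟩ := h'.nuS_hol X hX
  rw [e, e', p.isRep_unique ht ht']

/-- The clauses concern only `ν`, `ν^*` and sections of `S^{1,0}` and `S^{0,1}`. Tensoriality
extends them to all of `R` and `R^*`, conjugation supplies the remaining (0,1) cases, and on a line
bundle symmetry is automatic. -/
theorem diff_symm_pr (i j : Fin 4) (X Y : CVF I M) :
    D.diff D' (p.pr i X) (p.pr j Y) = D.diff D' (p.pr j Y) (p.pr i X) := by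
  have h00 : ∀ X Y, D.diff D' (p.pr10 X) (p.pr10 Y) = D.diff D' (p.pr10 Y) (p.pr10 X) :=
    fun X Y => CConnection.diff_symm
      (torsion_hol_hol h h' (p.isSectionOf_pr10 X) (p.isSectionOf_pr10 Y))
  have h01 : ∀ X Y, D.diff D' (p.pr10 X) (p.pr01 Y) = D.diff D' (p.pr01 Y) (p.pr10 X) :=
    fun X Y => CConnection.diff_symm fun x => by
      rw [h.hol_anti _ _ (p.isSectionOf_pr10 X) (p.isSectionOf_pr01 Y),
        h'.hol_anti _ _ (p.isSectionOf_pr10 X) (p.isSectionOf_pr01 Y)]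
  have h11 : ∀ X Y, D.diff D' (p.pr01 X) (p.pr01 Y) = D.diff D' (p.pr01 Y) (p.pr01 X) :=
    fun X Y => CConnection.diff_symm fun x => by
      obtain ⟨X', hX, eX⟩ := p.exists_conj_pr01 X
      obtain ⟨Y', hY, eY⟩ := p.exists_conj_pr01 Y
      rw [eX, eY, h.anti_anti _ _ hX hY, h'.anti_anti _ _ hX hY, torsion_hol_hol h h' hX hY]
  have h20 : ∀ X Y, D.diff D' (p.prν X) (p.pr10 Y) = D.diff D' (p.pr10 Y) (p.prν X) := by
    intro X Y
    rw [prν_apply, map_smul, map_smul, LinearMap.smul_apply,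
      CConnection.diff_symm (torsion_ν_hol h h' (p.isSectionOf_pr10 Y))]
  have h30 : ∀ X Y, D.diff D' (p.prνs X) (p.pr10 Y) = D.diff D' (p.pr10 Y) (p.prνs X) := by
    intro X Y
    rw [prνs_apply, map_smul, map_smul, LinearMap.smul_apply,
      CConnection.diff_symm (torsion_νs_hol h h' (p.isSectionOf_pr10 Y))]
  have h21 : ∀ X Y, D.diff D' (p.prν X) (p.pr01 Y) = D.diff D' (p.pr01 Y) (p.prν X) := by
    intro X Y
    obtain ⟨Y', hY, eY⟩ := p.exists_conj_pr01 Y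
    rw [prν_apply, map_smul, map_smul, LinearMap.smul_apply, CConnection.diff_symm fun x => ?_]
    rw [eY, h.nu_anti _ hY, h'.nu_anti _ hY, torsion_ν_hol h h' hY]
  have h31 : ∀ X Y, D.diff D' (p.prνs X) (p.pr01 Y) = D.diff D' (p.pr01 Y) (p.prνs X) := by
    intro X Y
    obtain ⟨Y', hY, eY⟩ := p.exists_conj_pr01 Y
    rw [prνs_apply, map_smul, map_smul, LinearMap.smul_apply, CConnection.diff_symm fun x => ?_]
    rw [eY, h.nuS_anti _ hY, h'.nuS_anti _ hY, torsion_νs_hol h h' hY]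
  have h23 : ∀ X Y, D.diff D' (p.prν X) (p.prνs Y) = D.diff D' (p.prνs Y) (p.prν X) := by
    intro X Y
    have : D.diff D' p.ν p.νs = D.diff D' p.νs p.ν :=
      CConnection.diff_symm fun x => by rw [h.nu_nuS, h'.nu_nuS]
    simp only [prν_apply, prνs_apply, map_smul, LinearMap.smul_apply, this]
    rw [smul_comm]
  have h22 : ∀ X Y, D.diff D' (p.prν X) (p.prν Y) = D.diff D' (p.prν Y) (p.prν X) := by
    intro X Y
    simp only [prν_apply, map_smul, LinearMap.smul_apply]
    rw [smul_comm]
  have h33 : ∀ X Y, D.diff D' (p.prνs X) (p.prνs Y) = D.diff D' (p.prνs Y) (p.prνs X) := by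
    intro X Y
    simp only [prνs_apply, map_smul, LinearMap.smul_apply]
    rw [smul_comm]
  fin_cases i <;> fin_cases j
  exacts [h00 X Y, h01 X Y, (h20 Y X).symm, (h30 Y X).symm, (h01 Y X).symm, h11 X Y,
    (h21 Y X).symm, (h31 Y X).symm, h20 X Y, h21 X Y, h22 X Y, h23 X Y, h30 X Y, h31 X Y,
    (h23 Y X).symm, h33 X Y]

end Torsion

theorem pr_toFun {D : CConnection I M} (h : p.IsChernRobinson D) (i : Fin 4) (X Y : CVF I M) :
    p.pr i (D.toFun X (p.pr i Y)) = D.toFun X (p.pr i Y) := by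
  have hs := p.pr_pr_self i Y
  fin_cases i
  · exact p.isSectionOf_S10.1 (h.preserves_S10 _ _ (p.isSectionOf_S10.2 hs))
  · exact p.isSectionOf_S01.1 (h.preserves_S01 _ _ (p.isSectionOf_S01.2 hs))
  · exact p.isSectionOf_RC.1 (h.preserves_R _ _ (p.isSectionOf_RC.2 hs))
  · exact p.isSectionOf_RsC.1 (h.preserves_Rs _ _ (p.isSectionOf_RsC.2 hs))

theorem isChernRobinson_unique {D D' : CConnection I M} (h : p.IsChernRobinson D)
    (h' : p.IsChernRobinson D') : D = D' := by
  have hz := p.eq_zero_of_symm (D.diff D') (fun X Y Z => by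
      ext x
      have e := h.metric X Y Z x
      have e' := h'.metric X Y Z x
      show g.cform x ((D.toFun X Y).1 x - (D'.toFun X Y).1 x) (Z.1 x) +
        g.cform x (Y.1 x) ((D.toFun X Z).1 x - (D'.toFun X Z).1 x) = 0
      rw [map_sub, map_sub, LinearMap.sub_apply]
      linear_combination e' - e)
    (fun i X Y => by
      rw [CConnection.diff_apply, map_sub, p.pr_toFun h, p.pr_toFun h'])
    (diff_symm_pr h.torsion h'.torsion)
  apply CConnection.ext
  funext X Y
  exact sub_eq_zero.1 (hz X Y)

end OpticalPairing

end Uniqueness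

/-! ### Identities for `ω` and `J` -/

section FundamentalForm

variable {E : Type*} [NormedAddCommGroup E] [NormedSpace ℝ E] [FiniteDimensional ℝ E]
  [CompleteSpace E]
  {H : Type*} [TopologicalSpace H] {I : ModelWithCorners ℝ E H}
  {M : Type*} [TopologicalSpace M] [ChartedSpace H M] [IsManifold I ∞ M]

variable (I M) in
/-- The constant function `√-1`. -/
def imUnit : CFun I M := ContMDiffMap.const Complex.I

theorem imUnit_mul_imUnit : imUnit I M * imUnit I M = -1 := by
  ext x
  exact Complex.I_mul_I

@[simp] theorem der_imUnit (X : CVF I M) : der X (imUnit I M) = 0 := der_const X _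

namespace OpticalPairing

variable {g : LorentzMetric I M} {m : ℕ} {𝒩 : AlmostRobinsonStructure g m} {ℛ : DualNullBundle 𝒩}
  (p : OpticalPairing ℛ) [T2Space M]

/-- The endomorphism `J` on smooth vector fields. -/
def JF : CVF I M →ₗ[CFun I M] CVF I M := imUnit I M • p.pr10 - imUnit I M • p.pr01

theorem JF_apply (X : CVF I M) : p.JF X = imUnit I M • p.pr10 X - imUnit I M • p.pr01 X := rfl

@[simp] theorem JF_pr10 (X : CVF I M) : p.JF (p.pr10 X) = imUnit I M • p.pr10 X := by
  simp [JF_apply]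

@[simp] theorem JF_pr01 (X : CVF I M) : p.JF (p.pr01 X) = -(imUnit I M • p.pr01 X) := by
  simp [JF_apply]

/-- Only the (1,0)-part of `X` pairs with `S^{0,1}`, and `J` is `√-1` there; hence `X` may be
arbitrary, in particular a bracket. -/
theorem G_JF_pr01 (X Z : CVF I M) :
    G g (p.JF X) (p.pr01 Z) = imUnit I M * G g X (p.pr01 Z) := by
  rw [JF_apply, map_sub, LinearMap.sub_apply, map_smul, map_smul, LinearMap.smul_apply,
    LinearMap.smul_apply, G_pr01_pr01, G_pr10_left, pr01_pr01, smul_zero, sub_zero, smul_eq_mul]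

theorem G_JF_pr10 (X Z : CVF I M) :
    G g (p.JF X) (p.pr10 Z) = -(imUnit I M * G g X (p.pr10 Z)) := by
  rw [JF_apply, map_sub, LinearMap.sub_apply, map_smul, map_smul, LinearMap.smul_apply,
    LinearMap.smul_apply, G_pr10_pr10, G_pr01_left, pr10_pr10, smul_zero, zero_sub, smul_eq_mul]

/-- The exterior derivative of `ω`. -/
def dω (X Y Z : CVF I M) : CFun I M :=
  der X (G g (p.JF Y) Z) - der Y (G g (p.JF X) Z) + der Z (G g (p.JF X) Y) -
    G g (p.JF (br X Y)) Z + G g (p.JF (br X Z)) Y - G g (p.JF (br Y Z)) X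

theorem d2_omega_eq (X Y Z : CVF I M) (x : M) :
    d2 ℛ.omega X.1 Y.1 Z.1 x = p.dω X Y Z x := rfl

/-- The Lie derivative of `ω`. -/
def lieω (X Y Z : CVF I M) : CFun I M :=
  der X (G g (p.JF Y) Z) - G g (p.JF (br X Y)) Z - G g (p.JF Y) (br X Z)

theorem lie2_omega_eq (X Y Z : CVF I M) (x : M) :
    lie2 X.1 ℛ.omega Y.1 Z.1 x = p.lieω X Y Z x := rfl

theorem d2_omega_JX_eq (X Y Z : CVF I M) (x : M) :
    d2 ℛ.omega (ℛ.JX X.1) (ℛ.JX Y.1) (ℛ.JX Z.1) x = p.dω (p.JF X) (p.JF Y) (p.JF Z) x := rfl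

theorem cform_J_lieEnd_eq (n X Y : CVF I M) (x : M) :
    g.cform x (ℛ.J x (lieEnd n.1 ℛ.J X.1 x)) (Y.1 x) =
      G g (p.JF (br n (p.JF X) - p.JF (br n X))) Y x := rfl

theorem cform_P01_cbracket_eq (n X Y : CVF I M) (x : M) :
    g.cform x (ℛ.P01 x (cbracket n.1 X.1 x)) (Y.1 x) = G g (p.pr01 (br n X)) Y x := rfl

/-- As `g` and `ω` vanish on pairs from `S^{1,0}`, five of the six terms of `dω` survive. Each is
`±√-1` times a term on the left, and `(√-1)² = -1` finishes. -/
theorem torsionForm_eq (X Y Z : CVF I M) :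
    (der (p.pr10 X) (G g (p.pr01 Z) (p.pr10 Y)) - G g (br (p.pr10 X) (p.pr01 Z)) (p.pr10 Y) -
      G g (p.pr01 Z) (br (p.pr10 X) (p.pr10 Y))) + (der (p.pr01 Z) (G g (p.pr10 X) (p.pr10 Y)) -
      der (p.pr10 Y) (G g (p.pr10 X) (p.pr01 Z)) -
      G g (p.pr10 X) (br (p.pr01 Z) (p.pr10 Y))) =
    -(imUnit I M * p.dω (p.pr10 X) (p.pr10 Y) (p.pr01 Z)) := by
  simp only [dω, G_JF_pr01, G_JF_pr10, der_mul, der_imUnit, G_pr10_pr10, der_zero]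
  rw [br_swap (p.pr10 Y) (p.pr01 Z), map_neg, G_symm g (p.pr01 Z) (p.pr10 Y),
    G_symm g (p.pr01 Z) (br _ _), G_symm g (p.pr10 X) (br _ _), mul_zero, neg_zero, der_zero]
  linear_combination (der (p.pr10 X) (G g (p.pr10 Y) (p.pr01 Z)) -
    der (p.pr10 Y) (G g (p.pr10 X) (p.pr01 Z)) - G g (br (p.pr10 X) (p.pr10 Y)) (p.pr01 Z) -
    G g (br (p.pr10 X) (p.pr01 Z)) (p.pr10 Y) + G g (br (p.pr10 Y) (p.pr01 Z)) (p.pr10 X)) *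
    imUnit_mul_imUnit (I := I) (M := M)

/-- The factor is `√-1 · √-1 · (-√-1) = √-1`. The scalars are constant, so they pass through all
derivatives and brackets. -/
theorem dω_JF (X Y Z : CVF I M) :
    p.dω (p.JF (p.pr10 X)) (p.JF (p.pr10 Y)) (p.JF (p.pr01 Z)) =
      imUnit I M * p.dω (p.pr10 X) (p.pr10 Y) (p.pr01 Z) := by
  have h3 : imUnit I M * imUnit I M * imUnit I M = -imUnit I M := by
    rw [imUnit_mul_imUnit]; ring
  -- The scalars move inside the projections so that the rules for `J` match, and are taken out
  -- again afterwards.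
  have hn : -(imUnit I M • p.pr01 Z) = p.pr01 (-(imUnit I M • Z)) := by simp
  have hX : imUnit I M • p.pr10 X = p.pr10 (imUnit I M • X) := by simp
  have hY : imUnit I M • p.pr10 Y = p.pr10 (imUnit I M • Y) := by simp
  rw [JF_pr10, JF_pr10, JF_pr01, hn, hX, hY]
  simp only [dω, G_JF_pr01, G_JF_pr10]
  rw [← hn, ← hX, ← hY, ← neg_smul]
  have hneg : ∀ W : CVF I M, der W (-imUnit I M) = 0 := fun W => by
    have := der_add_right W (imUnit I M) (-imUnit I M)
    rw [add_neg_cancel, der_zero, der_imUnit, zero_add] at this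
    exact this.symm
  simp only [br_smul_left, br_smul_right, der_imUnit, hneg, zero_smul, zero_add, sub_zero,
    map_smul, LinearMap.smul_apply, smul_eq_mul, G_pr10_pr10, mul_zero, neg_zero, der_zero,
    der_smul_left, der_mul, zero_mul, add_zero]
  linear_combination (-imUnit I M * der (p.pr10 X) (G g (p.pr10 Y) (p.pr01 Z)) +
    imUnit I M * der (p.pr10 Y) (G g (p.pr10 X) (p.pr01 Z)) +
    imUnit I M * G g (br (p.pr10 X) (p.pr10 Y)) (p.pr01 Z) +
    imUnit I M * G g (br (p.pr10 X) (p.pr01 Z)) (p.pr10 Y) -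
    imUnit I M * G g (br (p.pr10 Y) (p.pr01 Z)) (p.pr10 X)) * h3

theorem lieω_hol_anti (n X Z : CVF I M) : p.lieω n (p.pr10 X) (p.pr01 Z) =
    imUnit I M * (der n (G g (p.pr10 X) (p.pr01 Z)) - G g (br n (p.pr10 X)) (p.pr01 Z) -
      G g (p.pr10 X) (br n (p.pr01 Z))) := by
  simp only [lieω, G_JF_pr01, JF_pr10, map_smul, LinearMap.smul_apply, smul_eq_mul, der_mul,
    der_imUnit]
  ring

theorem lieω_hol_hol (n X Y : CVF I M) : p.lieω n (p.pr10 X) (p.pr10 Y) =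
    imUnit I M * (G g (br n (p.pr10 X)) (p.pr10 Y) - G g (p.pr10 X) (br n (p.pr10 Y))) := by
  simp only [lieω, G_JF_pr10, JF_pr10, map_smul, LinearMap.smul_apply, smul_eq_mul, G_pr10_pr10,
    der_zero, mul_zero, neg_zero]
  ring

/-- Against `S^{1,0}` the operator `J` acts as `-√-1`, so the factor is `-√-1 (√-1 + √-1) = 2`. -/
theorem G_JF_lie_JF (n X Y : CVF I M) :
    G g (p.JF (br n (p.JF (p.pr10 X)) - p.JF (br n (p.pr10 X)))) (p.pr10 Y) =
      G g (p.pr01 (br n (p.pr10 X))) (p.pr10 Y) + G g (p.pr01 (br n (p.pr10 X))) (p.pr10 Y) := by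
  rw [G_JF_pr10, map_sub, LinearMap.sub_apply, G_JF_pr10, JF_pr10, br_smul_right, der_imUnit,
    zero_smul, zero_add, map_smul, LinearMap.smul_apply, smul_eq_mul, p.G_pr01_left, pr10_pr10]
  linear_combination (-2 * G g (br n (p.pr10 X)) (p.pr10 Y)) *
    imUnit_mul_imUnit (I := I) (M := M)

/-- The Lie derivative of `g` is the symmetric and that of `ω` the skew combination of `g([n, X],
Y)` and `g(X, [n, Y])`; the sum isolates the first. -/
theorem neg_G_pr01_lie (n X Y : CVF I M) :
    -G g (p.pr01 (br n (p.pr10 X))) (p.pr10 Y) =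
      half I M * (der n (G g (p.pr10 X) (p.pr10 Y)) - G g (br n (p.pr10 X)) (p.pr10 Y) -
        G g (p.pr10 X) (br n (p.pr10 Y))) +
      half I M * (imUnit I M * p.lieω n (p.pr10 X) (p.pr10 Y)) := by
  rw [lieω_hol_hol, G_pr01_left, pr10_pr10, G_pr10_pr10, der_zero, ← mul_assoc (imUnit I M),
    imUnit_mul_imUnit]
  linear_combination (G g (br n (p.pr10 X)) (p.pr10 Y)) * half_add_half (I := I) (M := M)

/-- By uniqueness it suffices to inspect the constructed connection, where the formula is built in.
-/
theorem toFun_anti_hol {D : CConnection I M} (hD : p.IsChernRobinson D) {X Y : CVF I M}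
    (hX : IsSectionOf X ℛ.S10) (hY : IsSectionOf Y ℛ.S01) (x : M) :
    (D.toFun Y X).1 x = ℛ.dbar Y.1 X.1 x := by
  rw [p.isChernRobinson_unique hD p.isChernRobinson_chernRobinson, ← p.isSectionOf_S10.1 hX,
    ← p.isSectionOf_S01.1 hY]
  exact congrArg (fun W : CVF I M => W.1 x) (p.conn_anti_hol X Y)

include p in
theorem lie2_add_d1_eq {X Y Z : CVF I M} (hX : IsSectionOf X ℛ.S10) (hY : IsSectionOf Y ℛ.S10)
    (hZ : IsSectionOf Z ℛ.S01) (x : M) :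
    lie2 X.1 g.cform Z.1 Y.1 x + d1 (g.flat X.1) Z.1 Y.1 x =
      -Complex.I * d2 ℛ.omega X.1 Y.1 Z.1 x := by
  rw [← p.isSectionOf_S10.1 hX, ← p.isSectionOf_S10.1 hY, ← p.isSectionOf_S01.1 hZ,
    lie2_eq, d1_flat_eq, p.d2_omega_eq, neg_mul]
  exact congrArg (fun f : CFun I M => f x) (p.torsionForm_eq X Y Z)

include p in
theorem d2_omega_JX {X Y Z : CVF I M} (hX : IsSectionOf X ℛ.S10) (hY : IsSectionOf Y ℛ.S10)
    (hZ : IsSectionOf Z ℛ.S01) (x : M) :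
    d2 ℛ.omega (ℛ.JX X.1) (ℛ.JX Y.1) (ℛ.JX Z.1) x = Complex.I * d2 ℛ.omega X.1 Y.1 Z.1 x := by
  rw [p.d2_omega_JX_eq, p.d2_omega_eq, ← p.isSectionOf_S10.1 hX, ← p.isSectionOf_S10.1 hY,
    ← p.isSectionOf_S01.1 hZ, p.dω_JF]
  rfl

include p in
theorem lie2_hol_anti (n : CVF I M) {X Z : CVF I M} (hX : IsSectionOf X ℛ.S10)
    (hZ : IsSectionOf Z ℛ.S01) (x : M) :
    lie2 n.1 ℛ.omega X.1 Z.1 x = Complex.I * lie2 n.1 g.cform X.1 Z.1 x := by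
  rw [← p.isSectionOf_S10.1 hX, ← p.isSectionOf_S01.1 hZ, lie2_eq, p.lie2_omega_eq,
    p.lieω_hol_anti]
  rfl

include p in
theorem cform_J_lieEnd (n : CVF I M) {X Y : CVF I M} (hX : IsSectionOf X ℛ.S10)
    (hY : IsSectionOf Y ℛ.S10) (x : M) :
    g.cform x (ℛ.J x (lieEnd n.1 ℛ.J X.1 x)) (Y.1 x) =
      2 * g.cform x (ℛ.P01 x (cbracket n.1 X.1 x)) (Y.1 x) := by
  rw [p.cform_J_lieEnd_eq, p.cform_P01_cbracket_eq, ← p.isSectionOf_S10.1 hX,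
    ← p.isSectionOf_S10.1 hY, G_JF_lie_JF, two_mul]
  rfl

include p in
theorem neg_cform_P01_cbracket (n : CVF I M) {X Y : CVF I M} (hX : IsSectionOf X ℛ.S10)
    (hY : IsSectionOf Y ℛ.S10) (x : M) :
    -g.cform x (ℛ.P01 x (cbracket n.1 X.1 x)) (Y.1 x) =
      (1 / 2 : ℂ) * lie2 n.1 g.cform X.1 Y.1 x +
        (1 / 2 : ℂ) * (Complex.I * lie2 n.1 ℛ.omega X.1 Y.1 x) := by
  rw [p.cform_P01_cbracket_eq, lie2_eq, p.lie2_omega_eq, ← p.isSectionOf_S10.1 hX,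
    ← p.isSectionOf_S10.1 hY]
  exact congrArg (fun f : CFun I M => f x) (p.neg_G_pr01_lie n X Y)

end OpticalPairing

end FundamentalForm

end Robinson

end

/-! ### The main theorem -/

theorem proposition3p1 (m : ℕ) {M : Type*} [TopologicalSpace M]
    [ChartedSpace (EuclideanSpace ℝ (Fin (2 * m + 2))) M] [IsManifold (𝓡 (2 * m + 2)) ∞ M]
    [T2Space M] [SecondCountableTopology M]
    (g : Robinson.LorentzMetric (𝓡 (2 * m + 2)) M)
    (𝒩 : Robinson.AlmostRobinsonStructure g m) (ℛ : Robinson.DualNullBundle 𝒩)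
    (p : Robinson.OpticalPairing ℛ) :
    -- existence and uniqueness of the Chern-Robinson connection
    (∃! D : Robinson.CConnection (𝓡 (2 * m + 2)) M, p.IsChernRobinson D) ∧
    -- it restricts to `∂̄_Y X = [Y, X]^{1,0}`
    (∀ D : Robinson.CConnection (𝓡 (2 * m + 2)) M, p.IsChernRobinson D →
      ∀ X Y : Robinson.CVF (𝓡 (2 * m + 2)) M, Robinson.IsSectionOf X ℛ.S10 → Robinson.IsSectionOf Y ℛ.S01 →
        ∀ x, (D.toFun Y X).1 x = ℛ.dbar Y.1 X.1 x) ∧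
    -- the alternative expressions of `g(𝒯^{1,0}(X, Y), Z)`
    (∀ X Y Z : Robinson.CVF (𝓡 (2 * m + 2)) M, Robinson.IsSectionOf X ℛ.S10 → Robinson.IsSectionOf Y ℛ.S10 → Robinson.IsSectionOf Z ℛ.S01 →
      ∀ x, Robinson.lie2 X.1 g.cform Z.1 Y.1 x + Robinson.d1 (g.flat X.1) Z.1 Y.1 x
            = - Complex.I * Robinson.d2 ℛ.omega X.1 Y.1 Z.1 x ∧
          - Complex.I * Robinson.d2 ℛ.omega X.1 Y.1 Z.1 x
            = - Robinson.d2 ℛ.omega (ℛ.JX X.1) (ℛ.JX Y.1) (ℛ.JX Z.1) x) ∧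
    -- the alternative expressions for `n = ν` and `n = ν^*`
    (∀ n : Robinson.CVF (𝓡 (2 * m + 2)) M, n = p.ν ∨ n = p.νs →
      (∀ X Z : Robinson.CVF (𝓡 (2 * m + 2)) M, Robinson.IsSectionOf X ℛ.S10 → Robinson.IsSectionOf Z ℛ.S01 →
        ∀ x, (1 / 2 : ℂ) * Robinson.lie2 n.1 g.cform X.1 Z.1 x
            = - (Complex.I / 2) * Robinson.lie2 n.1 ℛ.omega X.1 Z.1 x) ∧
      (∀ X Y : Robinson.CVF (𝓡 (2 * m + 2)) M, Robinson.IsSectionOf X ℛ.S10 → Robinson.IsSectionOf Y ℛ.S10 →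
        ∀ x, - g.cform x (ℛ.P01 x (Robinson.cbracket n.1 X.1 x)) (Y.1 x)
              = - (1 / 2 : ℂ) * g.cform x (ℛ.J x (Robinson.lieEnd n.1 ℛ.J X.1 x)) (Y.1 x) ∧
            - g.cform x (ℛ.P01 x (Robinson.cbracket n.1 X.1 x)) (Y.1 x)
              = (1 / 2 : ℂ) * Robinson.lie2 n.1 g.cform X.1 Y.1 x
                + (Complex.I / 2) * Robinson.lie2 n.1 ℛ.omega X.1 Y.1 x)) := by
  refine ⟨⟨p.chernRobinson, p.isChernRobinson_chernRobinson, fun D hD =>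
    p.isChernRobinson_unique hD p.isChernRobinson_chernRobinson⟩, ?_, ?_, ?_⟩
  · exact fun D hD X Y hX hY x => p.toFun_anti_hol hD hX hY x
  · intro X Y Z hX hY hZ x
    refine ⟨p.lie2_add_d1_eq hX hY hZ x, ?_⟩
    rw [p.d2_omega_JX hX hY hZ, neg_mul]
  · intro n _
    refine ⟨fun X Z hX hZ x => ?_, fun X Y hX hY x => ⟨?_, ?_⟩⟩
    · rw [p.lie2_hol_anti n hX hZ]
      linear_combination ((1 / 2 : ℂ) * Robinson.lie2 n.1 g.cform X.1 Z.1 x) * Complex.I_mul_I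
    · rw [p.cform_J_lieEnd n hX hY]
      ring
    · rw [p.neg_cform_P01_cbracket n hX hY]
      ring
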